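/- **Notation.** Fix integers $\ell, N_s\ge 1$, put $L=\ell N_s$, let $\eta\in\mathbb C$ and $q=e^{\eta}$, and assume $\sinh(n\eta)\neq0$ for $1\le n\le \ell$, so that the $q$-binomials $\left[{\ell\atop n}\right]_q$ formed from $[n]_q=\frac{q^n-q^{-n}}{q-q^{-1}}$ are defined and nonzero. Let $V=\mathbb C^2$ with basis $|0\rangle,|1\rangle$, let $e^{a,b}$ be the matrix units, and let $|0\rangle=|0\rangle_1\otimes\cdots\otimes|0\rangle_L$ be the vacuum of $V^{\otimes L}$. *Spin-1/2 monodromy matrices.* Let $b(u)=\frac{\sinh u}{\sinh(u+\eta)}$, $c(u)=\frac{\sinh\eta}{\sinh(u+\eta)}$, and $\sigma(\pm)=\pm1$, $\sigma(p)=0$. For a grading $w\in\{+,-,p\}$ the matrix $R^{(1\,w)}(u)$ on $V\otimes V$ is, in the basis $00,01,10,11$, block diagonal with blocks $1$, $\begin{pmatrix} b(u)& e^{-\sigma(w)u}c(u)\\ e^{\sigma(w)u}c(u)& b(u)\end{pmatrix}$, $1$, and $$T^{(1\,w)}(\lambda;\{w_j\})=R^{(1\,w)}_{0L}(\lambda-w_L)\cdots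 R^{(1\,w)}_{01}(\lambda-w_1)=\begin{pmatrix}A&B\\ C&D\end{pmatrix}$$ with respect to the auxiliary space $0$; $T_{a,b}$ ($a,b\in\{0,1\}$) are its operator entries. For $\xi_1,\dots,\xi_{N_s}\in\mathbb C$ and pairwise distinct numbers $r_b^{(\beta)}\in\mathbb C$ put $w^{(\ell;\epsilon)}_{\ell(b-1)+\beta}=\xi_b-(\beta-1)\eta+\epsilon r_b^{(\beta)}$ for $1\le b\le N_s$, $1\le\beta\le\ell$, and $w^{(\ell)}_j=w^{(\ell;0)}_j$. Let $T^{(\ell\,w;\epsilon)}(\lambda)=T^{(1\,w)}(\lambda;\{w_j^{(\ell;\epsilon)}\})$, with entries $B^{(\ell\,w;\epsilon)}$ and $C^{(\ell\,w;\epsilon)}$ at the positions $(0,1)$ and $(1,0)$. *Spin-$\ell/2$ chain.* In $V^{\otimes\ell}$ let $\|\ell,n\rangle=\frac1{[n]_q!}\big(\Delta^{(\ell-1)}(X^-)\big)^n|0\rangle^{\otimes\ell}$ for $0\le n\le\ell$, where $\Delta^{(\ell-1)}(X^-)=\sum_{j}1^{\otimes(j-1)}\otimes X^-\otimes (K^{-1})^{\otimes(\ell-j)}$,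 $X^-=e^{1,0}$, $K=\mathrm{diag}(q,q^{-1})$. Let $F(\ell,n)=\|\ell,n\rangle^{T}\|\ell,n\rangle$, $\langle\ell,n\|=\|\ell,n\rangle^{T}/F(\ell,n)$, $P^{(\ell)}=\sum_n\|\ell,n\rangle\langle\ell,n\|$, $V^{(\ell)}=P^{(\ell)}V^{\otimes\ell}$, let $P^{(\ell)}_{1\cdots L}$ be the product of the projections of the $N_s$ consecutive blocks of $\ell$ sites, and let $\chi$ be the operator on $(V^{(\ell)})^{\otimes N_s}$ acting on the $b$-th factor as $\|\ell,n\rangle\mapsto e^{n\Lambda_b}\|\ell,n\rangle$, with $\Lambda_b=\xi_b-(\ell-1)\eta/2$. Define $T^{(\ell\,+)}(\lambda)=P^{(\ell)}_{1\cdots L}T^{(\ell\,+;0)}(\lambda)P^{(\ell)}_{1\cdots L}$, $$T^{(\ell\,p)}(\lambda)=\chi_0^{-1}T^{(\ell\,+)}(\lambda)\chi_0,\qquad T^{(\ell\,-)}(\lambda)=\chi_0^{-1}T^{(\ell\,p)}(\lambda)\chi_0,\qquad \chi_0=\mathrm{diag}(1,e^{\lambda})_0\,\chi,$$ with entries $B^{(\ell\,w)}$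 and $C^{(\ell\,w)}$ at the positions $(0,1)$ and $(1,0)$. For a function $g$ on $\{0,\dots,\ell\}$ without zeros let $\widehat E_k^{i,j\,(\ell\,p)}$ be $\frac{g(j)}{g(i)}\|\ell,i\rangle\langle\ell,j\|$ acting on the $k$-th factor, let $\widehat E_k^{i,j\,(\ell\,\pm)}=\chi^{\pm1}\widehat E_k^{i,j\,(\ell\,p)}\chi^{\mp1}$, and let $$\widehat N^{(\ell)}_{i,j}=\frac{g(j)}{g(i)}\left[{\ell\atop i}\right]_q\left[{\ell\atop j}\right]_q^{-1}e^{\eta\left(-i(\ell-i)+j(\ell-j)\right)/2}.$$ Finally let $\phi_n(\{\lambda_\alpha\};\{w_j\})=\prod_{j=1}^n\prod_{\alpha}b(\lambda_\alpha-w_j)$, and for $0\le n\le\ell$ let $\mathcal S_n$ be the set of sequences in $\{0,1\}^\ell$ with exactly $n$ ones. *Bethe-ansatz equations.* For a function $d$, parameters $\lambda_1,\dots,\lambda_M$ satisfy the Bethe-ansatz equations with $d$ if $$\frac1{d(\lambda_\alpha)}=\prod_{\beta\ne\alpha}\frac{\sinh(\lambda_\alpha-\lambda_\beta+\eta)}{\sinh(\lambda_\alpha-\lambda_\beta-\eta)}\qquad(1\le\alpha\le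 M),$$ where all denominators, including those in $d(\lambda_\alpha)$, are nonzero. The spin-$\ell/2$ equations are those with $d(\lambda)=\prod_{k=1}^{N_s}\frac{\sinh(\lambda-\xi_k)}{\sinh(\lambda-\xi_k+\ell\eta)}$; the spin-1/2 equations with inhomogeneities $\{w_j\}$ are those with $d(\lambda)=\prod_{j=1}^{L}b(\lambda-w_j)$. **Assumptions.** Let $\mu_1,\dots,\mu_N\in\mathbb C$ be arbitrary, let $\lambda_1,\dots,\lambda_M$ solve the spin-$\ell/2$ Bethe-ansatz equations, and let none of the $\mu_\alpha,\lambda_\beta$ lie in $w^{(\ell)}_j-\eta+\pi i\mathbb Z$ for $1\le j\le L$. Let $\epsilon\to0$ within a set $\mathcal E\subset\mathbb C\setminus\{0\}$ that accumulates at $0$ (for instance the nonzero real numbers). For all small $\epsilon\in\mathcal E$ let $\lambda_1(\epsilon),\dots,\lambda_M(\epsilon)$ be a solution, pairwise distinct modulo $\pi i$, of the spin-1/2 Bethe-ansatz equations with inhomogeneities $\{w_j^{(\ell;\epsilon)}\}$, and suppose $\lambda_\beta(\epsilon)\to\lambda_\beta$ for each $\beta$. Let $w\in\{+,-,p\}$.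 **Proposition.** Let $1\le i_1,j_1\le\ell$ with $i_1-j_1=N-M$, and fix any $\varepsilon'\in\mathcal S_{i_1}$. Then all limits below exist and $$\langle0|\prod_{\alpha=1}^NC^{(\ell\,w)}(\mu_\alpha)\cdot\widehat E_1^{i_1,j_1\,(\ell\,w)}\cdot\prod_{\beta=1}^MB^{(\ell\,w)}(\lambda_\beta)|0\rangle=\widehat N^{(\ell)}_{i_1,j_1}\,e^{\sigma(w)\left(\sum_k\mu_k-\sum_\gamma\lambda_\gamma\right)}\,\phi_\ell(\{\lambda_\beta\};\{w^{(\ell)}_j\})$$ $$\times\sum_{\varepsilon\in\mathcal S_{j_1}}\lim_{\epsilon\to0}\langle0|\prod_{\alpha=1}^NC^{(\ell\,p;\epsilon)}(\mu_\alpha)\;T^{(\ell\,p;\epsilon)}_{\varepsilon_1,\varepsilon_1'}(w_1^{(\ell;\epsilon)})\cdots T^{(\ell\,p;\epsilon)}_{\varepsilon_\ell,\varepsilon_\ell'}(w_\ell^{(\ell;\epsilon)})\;\prod_{\beta=1}^MB^{(\ell\,p;\epsilon)}(\lambda_\beta(\epsilon))|0\rangle .$$ **Corollary.** Let $m\le N_s$,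 let $1\le i_k,j_k\le\ell$ for $1\le k\le m$ with $\sum_ki_k-\sum_kj_k=N-M$, and fix any $\varepsilon^{[k]\prime}\in\mathcal S_{i_k}$ for each $k$. Then all limits below exist and $$\langle0|\prod_{\alpha=1}^NC^{(\ell\,w)}(\mu_\alpha)\cdot\prod_{k=1}^m\widehat E_k^{i_k,j_k\,(\ell\,w)}\cdot\prod_{\beta=1}^MB^{(\ell\,w)}(\lambda_\beta)|0\rangle=\Big(\prod_{k=1}^m\widehat N^{(\ell)}_{i_k,j_k}\Big)e^{\sigma(w)\left(\sum_k\mu_k-\sum_\gamma\lambda_\gamma\right)}\,\phi_{m\ell}(\{\lambda_\beta\};\{w^{(\ell)}_j\})$$ $$\times\sum_{\varepsilon^{[1]}\in\mathcal S_{j_1}}\cdots\sum_{\varepsilon^{[m]}\in\mathcal S_{j_m}}\lim_{\epsilon\to0}\langle0|\prod_{\alpha=1}^NC^{(\ell\,p;\epsilon)}(\mu_\alpha)\prod_{k=1}^m\Big(T^{(\ell\,p;\epsilon)}_{\varepsilon^{[k]}_1,\varepsilon^{[k]\prime}_1}(w^{(\ell;\epsilon)}_{\ell(k-1)+1})\cdots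 T^{(\ell\,p;\epsilon)}_{\varepsilon^{[k]}_\ell,\varepsilon^{[k]\prime}_\ell}(w^{(\ell;\epsilon)}_{\ell(k-1)+\ell})\Big)\prod_{\beta=1}^MB^{(\ell\,p;\epsilon)}(\lambda_\beta(\epsilon))|0\rangle ,$$ where the products over $k$ are ordered by increasing $k$ from left to right. -/

import Mathlib

open Filter Topology

namespace XXZ

noncomputable section

/-- The gradings of the affine quantum group: homogeneous of type `+`, of type `-`, principal. -/
inductive Grading
  | plus
  | minus
  | principal

/-- `σ(±) = ± 1`, `σ(p) = 0`. -/
def Grading.sigma : Grading → ℤ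
  | .plus => 1
  | .minus => -1
  | .principal => 0

/-- Spin configurations of `L` sites (`0` is up, `1` is down). They index the standard basis of
`(V^(1))^{⊗ L}`, where `V^(1) = ℂ²`. -/
abbrev Config (L : ℕ) := Fin L → Fin 2

/-- Operators on `(V^(1))^{⊗ L}`, as matrices in the standard basis. -/
abbrev Op (L : ℕ) := Matrix (Config L) (Config L) ℂ

/-- The two-by-two matrix `x` acting on site `j`, the identity on all other sites. -/
def siteOp {L : ℕ} (j : Fin L) (x : Matrix (Fin 2) (Fin 2) ℂ) : Op L :=
  Matrix.of fun s t => if ∀ k, k ≠ j → s k = t k then x (s j) (t j) else 0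

/-- `⟨0| X |0⟩`, where `|0⟩` is the vacuum vector: all spins up. -/
def vacExp {L : ℕ} (X : Op L) : ℂ := X (fun _ => 0) (fun _ => 0)

/-! ### The spin-1/2 monodromy matrix -/

/-- `b(u) = sinh u / sinh (u + η)`. -/
def bFun (η u : ℂ) : ℂ := Complex.sinh u / Complex.sinh (u + η)

/-- `c(u) = sinh η / sinh (u + η)`. -/
def cFun (η u : ℂ) : ℂ := Complex.sinh η / Complex.sinh (u + η)

/-- The `R`-matrix `R^{(1 w)}(u)` on `V^(1) ⊗ V^(1)`; rows are indexed by `(a, b)` and columns by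
`(c, d)`. In the basis `00, 01, 10, 11` the middle block is `[[b, c⁻], [c⁺, b]]`, with
`c^±(u) = e^{± σ(w) u} c(u)`. -/
def rMatrix (η : ℂ) (w : Grading) (u : ℂ) : Matrix (Fin 2 × Fin 2) (Fin 2 × Fin 2) ℂ :=
  Matrix.of fun p p' =>
    if p = p' then (if p.1 = p.2 then 1 else bFun η u)
    else if p = (0, 1) ∧ p' = (1, 0) then Complex.exp (-(w.sigma * u)) * cFun η u
    else if p = (1, 0) ∧ p' = (0, 1) then Complex.exp (w.sigma * u) * cFun η u
    else 0

/-- `R_{0 j}^{(1 w)}(u)`, where `0` is the auxiliary space and `j` a site of the chain: a two-by-two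
matrix (indexed by the basis of the auxiliary space) of operators on the chain. -/
def rAux {L : ℕ} (η : ℂ) (w : Grading) (u : ℂ) (j : Fin L) : Matrix (Fin 2) (Fin 2) (Op L) :=
  Matrix.of fun a c => siteOp j (Matrix.of fun b d => rMatrix η w u (a, b) (c, d))

/-- The spin-1/2 monodromy matrix
`T^{(1 w)}(x; {w_j}) = R_{0 L}(x - w_L) ⋯ R_{0 1}(x - w_1)`. Its entries are
`A = T 0 0`, `B = T 0 1`, `C = T 1 0`, `D = T 1 1`. -/
def monodromy {L : ℕ} (η : ℂ) (w : Grading) (ws : Fin L → ℂ) (x : ℂ) :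
    Matrix (Fin 2) (Fin 2) (Op L) :=
  (List.ofFn fun j : Fin L => rAux η w (x - ws j) j).reverse.prod

/-- `C(μ_1) ⋯ C(μ_N)` for a monodromy matrix `T`. -/
def cProd {L N : ℕ} (T : ℂ → Matrix (Fin 2) (Fin 2) (Op L)) (μ : Fin N → ℂ) : Op L :=
  (List.ofFn fun α => T (μ α) 1 0).prod

/-- `B(x_1) ⋯ B(x_M)` for a monodromy matrix `T`. -/
def bProd {L M : ℕ} (T : ℂ → Matrix (Fin 2) (Fin 2) (Op L)) (x : Fin M → ℂ) : Op L :=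
  (List.ofFn fun α => T (x α) 0 1).prod

/-! ### The spin-`ℓ/2` representation inside `(V^(1))^{⊗ ℓ}` -/

/-- `q = e^η`. -/
def qPar (η : ℂ) : ℂ := Complex.exp η

/-- `[n]_q = (q^n - q^{-n}) / (q - q^{-1})`. -/
def qInt (η : ℂ) (n : ℕ) : ℂ :=
  (qPar η ^ n - (qPar η)⁻¹ ^ n) / (qPar η - (qPar η)⁻¹)

/-- `[n]_q ! = [n]_q ⋯ [1]_q`. -/
def qFact (η : ℂ) (n : ℕ) : ℂ := ∏ k ∈ Finset.range n, qInt η (k + 1)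

/-- The `q`-binomial coefficient, for `n ≤ m`. -/
def qBinom (η : ℂ) (m n : ℕ) : ℂ := qFact η m / (qFact η (m - n) * qFact η n)

/-- `X⁻` on `V^(1)`: `X⁻ |0⟩ = |1⟩`, `X⁻ |1⟩ = 0`. -/
def xMinus : Matrix (Fin 2) (Fin 2) ℂ := !![0, 0; 1, 0]

/-- `K⁻¹` on `V^(1)`: `K |0⟩ = q |0⟩`, `K |1⟩ = q⁻¹ |1⟩`. -/
def kInv (η : ℂ) : Matrix (Fin 2) (Fin 2) ℂ := !![(qPar η)⁻¹, 0; 0, qPar η]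

/-- `Δ^{(ℓ-1)}(X⁻) = ∑_j 1^{⊗ (j-1)} ⊗ X⁻ ⊗ (K⁻¹)^{⊗ (ℓ-j)}`, the iteration of
`Δ(X⁻) = X⁻ ⊗ K⁻¹ + 1 ⊗ X⁻`. -/
def lowering (η : ℂ) (ℓ : ℕ) : Op ℓ :=
  ∑ j : Fin ℓ, siteOp j xMinus *
    (((List.finRange ℓ).filter fun k => j < k).map fun k => siteOp k (kInv η)).prod

/-- `‖ℓ, n⟩ = (Δ^{(ℓ-1)}(X⁻))^n ‖ℓ, 0⟩ / [n]_q !`, with `‖ℓ, 0⟩ = |0⟩ ⊗ ⋯ ⊗ |0⟩`. -/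
def ket (η : ℂ) (ℓ n : ℕ) : Config ℓ → ℂ :=
  (qFact η n)⁻¹ • (lowering η ℓ ^ n).mulVec (Pi.single (fun _ => 0) 1)

/-- `F(ℓ, n) = (‖ℓ, n⟩)^T ‖ℓ, n⟩`. -/
def sqLength (η : ℂ) (ℓ n : ℕ) : ℂ := ket η ℓ n ⬝ᵥ ket η ℓ n

/-- The conjugate vector `⟨ℓ, n‖ = (‖ℓ, n⟩)^T / F(ℓ, n)`. -/
def bra (η : ℂ) (ℓ n : ℕ) : Config ℓ → ℂ := (sqLength η ℓ n)⁻¹ • ket η ℓ n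

/-- `Φ^{(ℓ)}(x)` on `V^{(ℓ)}`: `Φ^{(ℓ)}(x) ‖ℓ, n⟩ = e^{n x} ‖ℓ, n⟩` for `0 ≤ n ≤ ℓ`. An operator on
`V^{(ℓ)}` is written as an operator on `(V^(1))^{⊗ ℓ}` by composition with the projection. The
inverse of `Φ^{(ℓ)}(x)` on `V^{(ℓ)}` is `Φ^{(ℓ)}(-x)`. -/
def phiSpin (η : ℂ) (ℓ : ℕ) (x : ℂ) : Op ℓ :=
  ∑ n ∈ Finset.range (ℓ + 1), Complex.exp (n * x) • Matrix.vecMulVec (ket η ℓ n) (bra η ℓ n)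

/-- The projection `P^{(ℓ)} = ∑_n ‖ℓ, n⟩ ⟨ℓ, n‖` onto `V^{(ℓ)}`. -/
def proj (η : ℂ) (ℓ : ℕ) : Op ℓ :=
  ∑ n ∈ Finset.range (ℓ + 1), Matrix.vecMulVec (ket η ℓ n) (bra η ℓ n)

/-! ### The spin-`ℓ/2` chain with `Ns` sites, inside the spin-1/2 chain with `Ns * ℓ` sites -/

/-- The site with (1-based) number `ℓ (b - 1) + β`. -/
def site {Ns ℓ : ℕ} (b : Fin Ns) (β : Fin ℓ) : Fin (Ns * ℓ) := finProdFinEquiv (b, β)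

/-- The operator `X` on `(V^(1))^{⊗ ℓ}` acting on the `b`-th block of `ℓ` sites, the identity on all
other sites. -/
def blockOp {Ns ℓ : ℕ} (b : Fin Ns) (X : Op ℓ) : Op (Ns * ℓ) :=
  Matrix.of fun s t =>
    if ∀ c, c ≠ b → ∀ β, s (site c β) = t (site c β)
    then X (fun β => s (site b β)) (fun β => t (site b β)) else 0

/-- `P^{(ℓ)}_{1 ⋯ L}`, the product of the projections of all blocks. -/
def projAll (η : ℂ) (Ns ℓ : ℕ) : Op (Ns * ℓ) :=
  (List.ofFn fun b : Fin Ns => blockOp b (proj η ℓ)).prod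

/-- The almost complete `ℓ`-strings `w_{ℓ(b-1)+β} = ξ_b - (β - 1) η + ε r_b^{(β)}`,
`1 ≤ β ≤ ℓ`; they are complete `ℓ`-strings for `ε = 0`. -/
def strings {Ns ℓ : ℕ} (η : ℂ) (ξ : Fin Ns → ℂ) (r : Fin Ns → Fin ℓ → ℂ) (ε : ℂ)
    (j : Fin (Ns * ℓ)) : ℂ :=
  ξ (finProdFinEquiv.symm j).1 - (((finProdFinEquiv.symm j).2 : ℕ) : ℂ) * η
    + ε * r (finProdFinEquiv.symm j).1 (finProdFinEquiv.symm j).2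

/-- The complete `ℓ`-strings `w_{ℓ(b-1)+β} = ξ_b - (β - 1) η`. -/
def completeStrings {Ns : ℕ} (η : ℂ) (ℓ : ℕ) (ξ : Fin Ns → ℂ) : Fin (Ns * ℓ) → ℂ :=
  strings η ξ (fun _ _ => 0) 0

/-- The string centre `Λ_b = ξ_b - (ℓ - 1) η / 2`. -/
def center {Ns : ℕ} (η : ℂ) (ℓ : ℕ) (ξ : Fin Ns → ℂ) (b : Fin Ns) : ℂ :=
  ξ b - ((ℓ : ℂ) - 1) * η / 2

/-- The `k`-th power of the gauge transformation
`χ^{(ℓ)} = Φ^{(ℓ)}_1(Λ_1) ⋯ Φ^{(ℓ)}_{Ns}(Λ_{Ns})` on `(V^{(ℓ)})^{⊗ Ns}`, for an integer `k`. -/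
def gauge {Ns : ℕ} (η : ℂ) (ℓ : ℕ) (ξ : Fin Ns → ℂ) (k : ℤ) : Op (Ns * ℓ) :=
  (List.ofFn fun b : Fin Ns => blockOp b (phiSpin η ℓ (k * center η ℓ ξ b))).prod

/-- The spin-`ℓ/2` monodromy matrix of homogeneous grading `+`:
`T^{(ℓ +)}(x) = P^{(ℓ)}_{1 ⋯ L} T^{(1 +)}(x; complete strings) P^{(ℓ)}_{1 ⋯ L}`. -/
def spinMonodromyPlus {Ns : ℕ} (η : ℂ) (ℓ : ℕ) (ξ : Fin Ns → ℂ) (x : ℂ) :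
    Matrix (Fin 2) (Fin 2) (Op (Ns * ℓ)) :=
  Matrix.of fun a c =>
    projAll η Ns ℓ * monodromy η .plus (completeStrings η ℓ ξ) x a c * projAll η Ns ℓ

/-- `χ_0⁻¹ T(x) χ_0` with `χ_0 = Φ_0(x) χ^{(ℓ)}`, `Φ_0(x) = diag(1, e^x)` on the auxiliary space. -/
def gaugeInv {Ns : ℕ} (η : ℂ) (ℓ : ℕ) (ξ : Fin Ns → ℂ)
    (T : ℂ → Matrix (Fin 2) (Fin 2) (Op (Ns * ℓ))) (x : ℂ) :
    Matrix (Fin 2) (Fin 2) (Op (Ns * ℓ)) :=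
  Matrix.of fun a c =>
    Complex.exp ((((c : ℕ) : ℂ) - ((a : ℕ) : ℂ)) * x) •
      (gauge η ℓ ξ (-1) * T x a c * gauge η ℓ ξ 1)

/-- The spin-`ℓ/2` monodromy matrix `T^{(ℓ w)}`. The inverse gauge transformation leads from
grading `+` to principal grading, and from principal grading to grading `-`. -/
def spinMonodromy {Ns : ℕ} (η : ℂ) (ℓ : ℕ) (ξ : Fin Ns → ℂ) :
    Grading → ℂ → Matrix (Fin 2) (Fin 2) (Op (Ns * ℓ))
  | .plus => spinMonodromyPlus η ℓ ξ
  | .principal => gaugeInv η ℓ ξ (spinMonodromyPlus η ℓ ξ)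
  | .minus => gaugeInv η ℓ ξ (gaugeInv η ℓ ξ (spinMonodromyPlus η ℓ ξ))

/-- The general elementary operator of principal grading `Ê^{i j (ℓ p)} = ‖ℓ, i⟩ ⟨ℓ, j‖ g(j)/g(i)`
acting on the `k`-th component. -/
def elemPrincipal {Ns : ℕ} (η : ℂ) (ℓ : ℕ) (g : ℕ → ℂ) (k : Fin Ns) (i j : ℕ) : Op (Ns * ℓ) :=
  blockOp k ((g j / g i) • Matrix.vecMulVec (ket η ℓ i) (bra η ℓ j))

/-- The general elementary operator `Ê_k^{i j (ℓ w)}`: for principal grading the operator above, for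
the gradings `±` its transform `(χ^{(ℓ)})^{± 1} Ê_k^{i j (ℓ p)} (χ^{(ℓ)})^{∓ 1}`. -/
def elemOp {Ns : ℕ} (η : ℂ) (ℓ : ℕ) (ξ : Fin Ns → ℂ) (g : ℕ → ℂ) (w : Grading)
    (k : Fin Ns) (i j : ℕ) : Op (Ns * ℓ) :=
  match w with
  | .principal => elemPrincipal η ℓ g k i j
  | .plus => gauge η ℓ ξ 1 * elemPrincipal η ℓ g k i j * gauge η ℓ ξ (-1)
  | .minus => gauge η ℓ ξ (-1) * elemPrincipal η ℓ g k i j * gauge η ℓ ξ 1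

/-- `N̂_{i j}^{(ℓ)} = (g(j)/g(i)) [ℓ, i]_q [ℓ, j]_q⁻¹ q^{-i(ℓ-i)/2 + j(ℓ-j)/2}`, where
`q^{1/2} = e^{η/2}`. -/
def normHat (η : ℂ) (ℓ : ℕ) (g : ℕ → ℂ) (i j : ℕ) : ℂ :=
  g j / g i * (qBinom η ℓ i / qBinom η ℓ j) *
    Complex.exp (η * (-((i : ℂ) * ((ℓ : ℂ) - i)) / 2 + (j : ℂ) * ((ℓ : ℂ) - j) / 2))

/-- The sequences `(ε_1, …, ε_ℓ)` of zeros and ones with exactly `n` ones. -/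
def seqs (ℓ n : ℕ) : Finset (Fin ℓ → Fin 2) :=
  Finset.univ.filter fun e => (Finset.univ.filter fun β => e β = 1).card = n

/-! ### Bethe-ansatz equations -/

/-- `d(x; {w_j}) = ∏_j b(x - w_j)`. -/
def dHalf {L : ℕ} (η : ℂ) (ws : Fin L → ℂ) (x : ℂ) : ℂ := ∏ j, bFun η (x - ws j)

/-- `d^{(ℓ)}(x; {ξ_k}) = ∏_k sinh (x - ξ_k) / sinh (x - ξ_k + ℓ η)`. -/
def dSpin {Ns : ℕ} (η : ℂ) (ℓ : ℕ) (ξ : Fin Ns → ℂ) (x : ℂ) : ℂ :=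
  ∏ k, Complex.sinh (x - ξ k) / Complex.sinh (x - ξ k + ℓ * η)

/-- The Bethe-ansatz equations
`a(x_α) / d(x_α) = ∏_{β ≠ α} sinh (x_α - x_β + η) / sinh (x_α - x_β - η)` with `a = 1`; all
denominators are required to be nonzero. (For the two functions `d` above, `d x ≠ 0` contains that
no denominator of `d x` vanishes, because division by zero gives zero.) -/
def BetheEquations {M : ℕ} (η : ℂ) (d : ℂ → ℂ) (x : Fin M → ℂ) : Prop :=
  ∀ α, d (x α) ≠ 0 ∧ (∀ β, β ≠ α → Complex.sinh (x α - x β - η) ≠ 0) ∧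
    1 / d (x α) =
      ∏ β ∈ Finset.univ.erase α, Complex.sinh (x α - x β + η) / Complex.sinh (x α - x β - η)

/-- `φ_m({x_α}; {w_j}) = ∏_{j=1}^m ∏_α b(x_α - w_j)`. -/
def phiFun {L M : ℕ} (η : ℂ) (m : ℕ) (x : Fin M → ℂ) (ws : Fin L → ℂ) : ℂ :=
  ∏ j ∈ Finset.univ.filter (fun j : Fin L => (j : ℕ) < m), ∏ α, bFun η (x α - ws j)

end

end XXZ

namespace XXZ

noncomputable section

/-! ### Operators on single sites -/

/-! Three mechanisms combine: the quantum inverse scattering problem, fusion, and continuity in `ε`.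

Inverse scattering. For inhomogeneities `w_j` at which no `R`-matrix `R(w_j - w_k)` has a pole,
`R(0)` is a permutation. Hence a product of entries `T_{ε_j, ε'_j}(w_j)` over the first sites equals
the product of the matrix units `e^{ε'_j, ε_j}` at these sites times the product of the transfer
matrices `(A + D)(w_j)` (`prod_siteMonodromy`). The transfer matrices stand directly to the left of
the `B` operators. By the algebraic Bethe ansatz they act on the Bethe vector by the scalars `∏_α
b(λ_α - w_j)⁻¹`, since `d(w_j) = 0` removes the wanted term of `D` (`transfer_mulVec_bProd`).
Altogether a factor `φ⁻¹` comes out (`vacExp_prod_monodromy`).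

Fusion. Expectation values are read from the left, starting from the row `⟨0|`. In principal
grading, at complete strings, every entry of the monodromy matrix maps rows symmetric within each
block to such rows (`BlockSymmetric.vecMul_monodromy`). Conjugation by explicit diagonal weights
transports this to grading `+`, where the symmetric rows are those fixed by the projections. On
these rows the projections act as `1`, the gauge operators as diagonal matrices, and `T^{(ℓ w)}` as
a scalar times a diagonal conjugate of the principal spin-1/2 monodromy matrix
(`actsAs_spinMonodromy`). The same rows turn `‖ℓ, i⟩⟨ℓ, j‖` into a multiple of `∑_ε e^{ε', ε}` over
`ε ∈ S_j`, for any single `ε' ∈ S_i`, because a symmetric row does not distinguish the members of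
`S_i` (`actsAs_elemPrincipal`). The multiple is `N̂`, essentially a ratio of square lengths. The
diagonal conjugations cancel in the vacuum expectation value, and the scalars give `e^{σ(w)(∑μ -
∑λ)}` (`vacExp_spin`). No symmetry of the column vectors is needed.

Limit. At `ε = 0` neighbouring sites of a string violate the condition of inverse scattering, but
for small `ε ≠ 0` it holds (`eventually_sinh_strings_ne_zero`). There the correlation function
equals `φ⁻¹` times an expression in the matrix units, which is continuous at `ε = 0`; the factor `φ`
stays nonzero in the limit. -/

theorem mul_siteOp_apply {L : ℕ} (A : Op L) (j : Fin L) (x : Matrix (Fin 2) (Fin 2) ℂ)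
    (s t : Config L) :
    (A * siteOp j x) s t = ∑ a, A s (Function.update t j a) * x a (t j) := by
  rw [Matrix.mul_apply]
  symm
  refine Fintype.sum_of_injective (Function.update t j) (Function.update_injective t j) _ _ ?_ ?_
  · intro u hu
    rw [siteOp, Matrix.of_apply, if_neg, mul_zero]
    intro h
    refine hu ⟨u j, ?_⟩
    ext k
    by_cases hk : k = j
    · subst hk; simp
    · simp [hk, h k hk]
  · intro a
    rw [siteOp, Matrix.of_apply, if_pos]
    · simp
    · intro k hk; simp [hk]

theorem vecMul_siteOp_apply {L : ℕ} (v : Config L → ℂ) (j : Fin L)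
    (x : Matrix (Fin 2) (Fin 2) ℂ) (t : Config L) :
    Matrix.vecMul v (siteOp j x) t = ∑ a, v (Function.update t j a) * x a (t j) :=
  mul_siteOp_apply (Matrix.of fun _ => v) j x t t

theorem siteOp_one {L : ℕ} (j : Fin L) : siteOp j 1 = (1 : Op L) := by
  ext s t
  have := mul_siteOp_apply 1 j 1 s t
  rw [one_mul] at this
  rw [this]
  simp [Matrix.one_apply]

theorem siteOp_mul {L : ℕ} (j : Fin L) (x y : Matrix (Fin 2) (Fin 2) ℂ) :
    siteOp j (x * y) = siteOp j x * siteOp j y := by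
  ext s t
  have h := mul_siteOp_apply 1 j (x * y) s t
  have h' := mul_siteOp_apply (1 * siteOp j x) j y s t
  rw [one_mul] at h h'
  rw [h, h']
  have : ∀ a, (siteOp j x) s (Function.update t j a) =
      ∑ b, (1 : Op L) s (Function.update t j b) * x b a := by
    intro a
    have := mul_siteOp_apply 1 j x s (Function.update t j a)
    rw [one_mul] at this
    rw [this]
    refine Finset.sum_congr rfl fun b _ => ?_
    rw [Function.update_idem, Function.update_self]
  simp_rw [this, Matrix.mul_apply, Finset.mul_sum, Finset.sum_mul]
  rw [Finset.sum_comm]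
  simp_rw [mul_assoc]

/-- The embedding of the two-by-two matrices as operators on the site `j`. -/
def siteHom {L : ℕ} (j : Fin L) : Matrix (Fin 2) (Fin 2) ℂ →ₐ[ℂ] Op L :=
  AlgHom.ofLinearMap
    { toFun := siteOp j
      map_add' := fun x y => by
        ext s t; simp only [siteOp, Matrix.of_apply, Matrix.add_apply]; split_ifs <;> simp
      map_smul' := fun c x => by
        ext s t; simp only [siteOp, Matrix.of_apply, Matrix.smul_apply, RingHom.id_apply]
        split_ifs <;> simp }
    (siteOp_one j) (siteOp_mul j)

@[simp] theorem siteHom_apply {L : ℕ} (j : Fin L) (x : Matrix (Fin 2) (Fin 2) ℂ) :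
    siteHom j x = siteOp j x := rfl

theorem siteOp_commute {L : ℕ} {j k : Fin L} (h : j ≠ k) (x y : Matrix (Fin 2) (Fin 2) ℂ) :
    Commute (siteOp j x) (siteOp k y) := by
  have key : ∀ (j k : Fin L) (_ : j ≠ k) (x y : Matrix (Fin 2) (Fin 2) ℂ) (s t : Config L),
      (siteOp j x * siteOp k y) s t = ∑ a, ∑ b,
        (1 : Op L) s (Function.update (Function.update t k a) j b) * (x b (t j) * y a (t k)) := by
    intro j k h x y s t
    have h' := mul_siteOp_apply (1 * siteOp j x) k y s t
    rw [one_mul] at h'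
    rw [h']
    refine Finset.sum_congr rfl fun a _ => ?_
    have := mul_siteOp_apply 1 j x s (Function.update t k a)
    rw [one_mul] at this
    rw [this, Finset.sum_mul]
    refine Finset.sum_congr rfl fun b _ => ?_
    rw [Function.update_of_ne h]; ring
  ext s t
  rw [key j k h, key k j h.symm, Finset.sum_comm]
  refine Finset.sum_congr rfl fun a _ => Finset.sum_congr rfl fun b _ => ?_
  rw [Function.update_comm h]; ring

/-! ### The exchange relations of monodromy matrices -/

section Exchange

variable {A : Type*} [Ring A]

/-- `X ⊗ 1` for a two-by-two matrix `X` of operators. -/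
def fstAux (X : Matrix (Fin 2) (Fin 2) A) : Matrix (Fin 2 × Fin 2) (Fin 2 × Fin 2) A :=
  Matrix.of fun p q => if p.2 = q.2 then X p.1 q.1 else 0

/-- `1 ⊗ Y` for a two-by-two matrix `Y` of operators. -/
def sndAux (Y : Matrix (Fin 2) (Fin 2) A) : Matrix (Fin 2 × Fin 2) (Fin 2 × Fin 2) A :=
  Matrix.of fun p q => if p.1 = q.1 then Y p.2 q.2 else 0

theorem fstAux_mul (X Y : Matrix (Fin 2) (Fin 2) A) : fstAux (X * Y) = fstAux X * fstAux Y := by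
  ext ⟨a, b⟩ ⟨c, d⟩
  simp only [fstAux, Matrix.of_apply, Matrix.mul_apply, Fintype.sum_prod_type]
  by_cases h : b = d <;> simp [h]

theorem sndAux_mul (X Y : Matrix (Fin 2) (Fin 2) A) : sndAux (X * Y) = sndAux X * sndAux Y := by
  ext ⟨a, b⟩ ⟨c, d⟩
  simp only [sndAux, Matrix.of_apply, Matrix.mul_apply, Fintype.sum_prod_type]
  by_cases h : a = c <;> simp [h]

theorem fstAux_mul_sndAux_apply (X Y : Matrix (Fin 2) (Fin 2) A) (p q : Fin 2 × Fin 2) :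
    (fstAux X * sndAux Y) p q = X p.1 q.1 * Y p.2 q.2 := by
  simp [fstAux, sndAux, Matrix.mul_apply, Fintype.sum_prod_type]

theorem sndAux_mul_fstAux_apply (X Y : Matrix (Fin 2) (Fin 2) A) (p q : Fin 2 × Fin 2) :
    (sndAux Y * fstAux X) p q = Y p.2 q.2 * X p.1 q.1 := by
  simp [fstAux, sndAux, Matrix.mul_apply, Fintype.sum_prod_type]

variable [Algebra ℂ A]

/-- The relation `R₁₂ X₁ Y₂ = Y₂ X₁ R₁₂`. -/
def Exchange (R : Matrix (Fin 2 × Fin 2) (Fin 2 × Fin 2) ℂ) (X Y : Matrix (Fin 2) (Fin 2) A) :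
    Prop :=
  R.map (algebraMap ℂ A) * (fstAux X * sndAux Y) = sndAux Y * fstAux X * R.map (algebraMap ℂ A)

/-- Since `X'` commutes entrywise with `Y`, and `X` with `Y'`, the factors regroup as `(X₁ Y₂)(X'₁
Y'₂)`, and `R` is carried through one pair after the other. This builds the relation for a chain
from that for one site. -/
theorem Exchange.mul {R : Matrix (Fin 2 × Fin 2) (Fin 2 × Fin 2) ℂ}
    {X Y X' Y' : Matrix (Fin 2) (Fin 2) A} (h : Exchange R X Y) (h' : Exchange R X' Y')
    (c : ∀ a b c d, Commute (X' a b) (Y c d)) (c' : ∀ a b c d, Commute (X a b) (Y' c d)) :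
    Exchange R (X * X') (Y * Y') := by
  have e : fstAux X' * sndAux Y = sndAux Y * fstAux X' := by
    ext p q : 1
    rw [fstAux_mul_sndAux_apply, sndAux_mul_fstAux_apply, (c _ _ _ _).eq]
  have e' : sndAux Y' * fstAux X = fstAux X * sndAux Y' := by
    ext p q : 1
    rw [fstAux_mul_sndAux_apply, sndAux_mul_fstAux_apply, (c' _ _ _ _).eq]
  unfold Exchange at *
  rw [fstAux_mul, sndAux_mul]
  set S := R.map (algebraMap ℂ A)
  calc S * (fstAux X * fstAux X' * (sndAux Y * sndAux Y'))
      = S * (fstAux X * (fstAux X' * sndAux Y) * sndAux Y') := by noncomm_ring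
    _ = S * (fstAux X * sndAux Y) * (fstAux X' * sndAux Y') := by rw [e]; noncomm_ring
    _ = sndAux Y * fstAux X * (S * (fstAux X' * sndAux Y')) := by rw [h]; noncomm_ring
    _ = sndAux Y * (fstAux X * sndAux Y') * fstAux X' * S := by rw [h']; noncomm_ring
    _ = sndAux Y * sndAux Y' * (fstAux X * fstAux X') * S := by rw [← e']; noncomm_ring

theorem Exchange.entry {R : Matrix (Fin 2 × Fin 2) (Fin 2 × Fin 2) ℂ}
    {X Y : Matrix (Fin 2) (Fin 2) A} (h : Exchange R X Y) (p q : Fin 2 × Fin 2) :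
    ∑ r, R p r • (X r.1 q.1 * Y r.2 q.2) = ∑ r, R r q • (Y p.2 r.2 * X p.1 r.1) := by
  have := congrFun (congrFun h p) q
  rw [Matrix.mul_apply, Matrix.mul_apply] at this
  simpa only [fstAux_mul_sndAux_apply, sndAux_mul_fstAux_apply, Matrix.map_apply,
    ← Algebra.commutes, ← Algebra.smul_def] using this

theorem exchange_iff {R : Matrix (Fin 2 × Fin 2) (Fin 2 × Fin 2) ℂ}
    {X Y : Matrix (Fin 2) (Fin 2) A} : Exchange R X Y ↔ ∀ p q : Fin 2 × Fin 2,
    ∑ r, R p r • (X r.1 q.1 * Y r.2 q.2) = ∑ r, R r q • (Y p.2 r.2 * X p.1 r.1) := by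
  refine ⟨fun h => h.entry, fun h => ?_⟩
  ext p q : 1
  rw [Matrix.mul_apply, Matrix.mul_apply]
  simpa only [fstAux_mul_sndAux_apply, sndAux_mul_fstAux_apply, Matrix.map_apply,
    ← Algebra.commutes, ← Algebra.smul_def] using h p q

end Exchange

/-- The weights of the six-vertex model, `sinh (u + η)` times the principal `R`-matrix. -/
def sixVertex (η u : ℂ) : Matrix (Fin 2 × Fin 2) (Fin 2 × Fin 2) ℂ :=
  Matrix.of fun p p' =>
    if p = p' then (if p.1 = p.2 then Complex.sinh (u + η) else Complex.sinh u)
    else if p = (0, 1) ∧ p' = (1, 0) then Complex.sinh η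
    else if p = (1, 0) ∧ p' = (0, 1) then Complex.sinh η
    else 0

theorem rMatrix_principal {η u : ℂ} (h : Complex.sinh (u + η) ≠ 0) :
    rMatrix η .principal u = (Complex.sinh (u + η))⁻¹ • sixVertex η u := by
  ext p q
  simp only [rMatrix, sixVertex, Matrix.of_apply, Matrix.smul_apply, Grading.sigma, bFun, cFun,
    smul_eq_mul]
  split_ifs <;> simp [h, div_eq_inv_mul]

-- This is the Yang–Baxter equation, with a site of the chain as third space. Without the
-- denominators of `R` it needs no restriction on `x`, `y`, `η`. Each of the 64 entries is a
-- polynomial identity in `sinh` and `cosh` modulo `cosh² = 1 + sinh²`.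
set_option maxHeartbeats 2000000 in
theorem exchange_sixVertex_lax (η x y : ℂ) : Exchange (sixVertex η (x - y))
    (Matrix.of fun a c => Matrix.of fun b d => sixVertex η x (a, b) (c, d))
    (Matrix.of fun a c => Matrix.of fun b d => sixVertex η y (a, b) (c, d)) := by
  rw [exchange_iff]
  have e1 := Complex.cosh_sq x
  have e2 := Complex.cosh_sq y
  have e3 := Complex.cosh_sq η
  rintro ⟨a, b⟩ ⟨c, d⟩
  ext s t
  fin_cases a <;> fin_cases b <;> fin_cases c <;> fin_cases d <;> fin_cases s <;> fin_cases t <;>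
  · simp [sixVertex, Fintype.sum_prod_type, Matrix.mul_apply, Complex.sinh_add,
      Complex.sinh_sub, Complex.cosh_sub]
    all_goals try grind

/-- The monodromy matrix of the sites in a list, the first site of the list acting first. -/
def siteMonodromy {L : ℕ} (η : ℂ) (w : Grading) (ws : Fin L → ℂ) (x : ℂ) (js : List (Fin L)) :
    Matrix (Fin 2) (Fin 2) (Op L) :=
  (js.map fun j => rAux η w (x - ws j) j).reverse.prod

section

variable {L : ℕ} (η : ℂ) (w : Grading) (ws : Fin L → ℂ)

theorem monodromy_eq (x : ℂ) :
    monodromy η w ws x = siteMonodromy η w ws x (List.finRange L) := by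
  rw [monodromy, siteMonodromy, List.ofFn_eq_map]

@[simp] theorem siteMonodromy_nil (x : ℂ) : siteMonodromy η w ws x [] = 1 := rfl

theorem siteMonodromy_append (x : ℂ) (l l' : List (Fin L)) :
    siteMonodromy η w ws x (l ++ l') =
      siteMonodromy η w ws x l' * siteMonodromy η w ws x l := by
  simp [siteMonodromy]

theorem siteMonodromy_singleton (x : ℂ) (j : Fin L) :
    siteMonodromy η w ws x [j] = rAux η w (x - ws j) j := by
  simp [siteMonodromy]

theorem siteMonodromy_cons (x : ℂ) (j : Fin L) (l : List (Fin L)) :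
    siteMonodromy η w ws x (j :: l) =
      siteMonodromy η w ws x l * rAux η w (x - ws j) j := by
  rw [← siteMonodromy_singleton, ← siteMonodromy_append]; rfl

theorem siteOp_commute_siteMonodromy (x : ℂ) {j : Fin L} {l : List (Fin L)} (hj : j ∉ l)
    (y : Matrix (Fin 2) (Fin 2) ℂ) (a c : Fin 2) :
    Commute (siteOp j y) (siteMonodromy η w ws x l a c) := by
  induction l generalizing a c with
  | nil => by_cases h : a = c <;> simp [h]
  | cons k l ih =>
    rw [List.mem_cons, not_or] at hj
    rw [siteMonodromy_cons, Matrix.mul_apply]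
    refine Commute.sum_right _ _ _ fun b _ => (ih hj.2 _ _).mul_right ?_
    exact siteOp_commute hj.1 _ _

end

section Exchange

variable {A B : Type*} [Ring A] [Algebra ℂ A] [Ring B] [Algebra ℂ B]
  {R : Matrix (Fin 2 × Fin 2) (Fin 2 × Fin 2) ℂ}

theorem Exchange.map {X Y : Matrix (Fin 2) (Fin 2) A} (h : Exchange R X Y) (f : A →ₐ[ℂ] B) :
    Exchange R (X.map f) (Y.map f) := by
  rw [exchange_iff] at *
  intro p q
  have := congrArg f (h p q)
  simpa only [map_sum, map_smul, map_mul, Matrix.map_apply] using this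

theorem Exchange.smul {X Y : Matrix (Fin 2) (Fin 2) A} (h : Exchange R X Y) (c d : ℂ) :
    Exchange R (c • X) (d • Y) := by
  rw [exchange_iff] at *
  intro p q
  have := congrArg (fun z => (c * d) • z) (h p q)
  simp only [Finset.smul_sum] at this
  convert this using 2 with r _ r _
  · simp only [Matrix.smul_apply, smul_mul_smul_comm, smul_smul]; congr 1; ring
  · simp only [Matrix.smul_apply, smul_mul_smul_comm, smul_smul]; congr 1; ring

variable (A R) in
theorem Exchange.one : Exchange R (1 : Matrix (Fin 2) (Fin 2) A) 1 := by
  have h1 : fstAux (1 : Matrix (Fin 2) (Fin 2) A) = 1 := by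
    ext ⟨a, b⟩ ⟨c, d⟩
    simp only [fstAux, Matrix.of_apply, Matrix.one_apply, Prod.mk.injEq]
    split_ifs <;> simp_all
  have h2 : sndAux (1 : Matrix (Fin 2) (Fin 2) A) = 1 := by
    ext ⟨a, b⟩ ⟨c, d⟩
    simp only [sndAux, Matrix.of_apply, Matrix.one_apply, Prod.mk.injEq]
    split_ifs <;> simp_all
  rw [Exchange, h1, h2]; simp

end Exchange

section

variable {L : ℕ} {η : ℂ} {ws : Fin L → ℂ}

theorem exchange_rAux {x y z : ℂ} (j : Fin L) (hx : Complex.sinh (x - z + η) ≠ 0)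
    (hy : Complex.sinh (y - z + η) ≠ 0) :
    Exchange (sixVertex η (x - y)) (rAux η .principal (x - z) j) (rAux η .principal (y - z) j) := by
  have h := ((exchange_sixVertex_lax η (x - z) (y - z)).smul (Complex.sinh (x - z + η))⁻¹
    (Complex.sinh (y - z + η))⁻¹).map (siteHom j)
  rw [sub_sub_sub_cancel_right] at h
  convert h using 1
  · ext a c : 2
    simp only [rAux, Matrix.of_apply, Matrix.map_apply, Matrix.smul_apply, siteHom_apply,
      rMatrix_principal hx]
    rfl
  · ext a c : 2
    simp only [rAux, Matrix.of_apply, Matrix.map_apply, Matrix.smul_apply, siteHom_apply,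
      rMatrix_principal hy]
    rfl

theorem exchange_siteMonodromy {x y : ℂ} {l : List (Fin L)} (hl : l.Nodup)
    (hx : ∀ j ∈ l, Complex.sinh (x - ws j + η) ≠ 0)
    (hy : ∀ j ∈ l, Complex.sinh (y - ws j + η) ≠ 0) :
    Exchange (sixVertex η (x - y)) (siteMonodromy η .principal ws x l)
      (siteMonodromy η .principal ws y l) := by
  induction l with
  | nil => exact Exchange.one _ _
  | cons j l ih =>
    rw [List.nodup_cons] at hl
    rw [siteMonodromy_cons, siteMonodromy_cons]
    refine (ih hl.2 (fun k hk => hx k (by simp [hk])) (fun k hk => hy k (by simp [hk]))).mul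
      (exchange_rAux j (hx j (by simp)) (hy j (by simp))) ?_ ?_
    · intro a b c d
      exact siteOp_commute_siteMonodromy _ _ _ _ hl.1 _ _ _
    · intro a b c d
      exact (siteOp_commute_siteMonodromy _ _ _ _ hl.1 _ _ _).symm

/-! ### Action on the vacuum -/

/-- The vacuum vector. -/
def vacuum (L : ℕ) : Config L → ℂ := Pi.single (fun _ => 0) 1

theorem siteOp_mulVec_vacuum (j : Fin L) (x : Matrix (Fin 2) (Fin 2) ℂ) (h : x 1 0 = 0) :
    (siteOp j x).mulVec (vacuum L) = x 0 0 • vacuum L := by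
  ext s
  rw [vacuum, Matrix.mulVec_single_one]
  simp only [Matrix.col_apply, siteOp, Matrix.of_apply, Pi.smul_apply, smul_eq_mul]
  by_cases hs : s = fun _ => 0
  · subst hs; simp
  · rw [Pi.single_eq_of_ne hs, mul_zero]
    split_ifs with h'
    · have : s j = 1 := by
        by_contra hne
        refine hs (funext fun k => ?_)
        by_cases hk : k = j
        · subst hk; omega
        · exact h' k hk
      rw [this, h]
    · rfl

theorem siteMonodromy_mulVec_vacuum (x : ℂ) {l : List (Fin L)} (hl : l.Nodup) :
    (siteMonodromy η .principal ws x l 0 0).mulVec (vacuum L) = vacuum L ∧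
    (siteMonodromy η .principal ws x l 1 0).mulVec (vacuum L) = 0 ∧
    (siteMonodromy η .principal ws x l 1 1).mulVec (vacuum L) =
      (l.map fun j => bFun η (x - ws j)).prod • vacuum L := by
  induction l with
  | nil => simp
  | cons j l ih =>
    rw [List.nodup_cons] at hl
    obtain ⟨h0, h1, h2⟩ := ih hl.2
    have r00 : (rAux η .principal (x - ws j) j 0 0).mulVec (vacuum L) = vacuum L := by
      simp only [rAux, Matrix.of_apply]
      rw [siteOp_mulVec_vacuum]
      · simp [rMatrix]
      · simp [rMatrix]
    have r10 : (rAux η .principal (x - ws j) j 1 0).mulVec (vacuum L) = 0 := by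
      simp only [rAux, Matrix.of_apply]
      rw [siteOp_mulVec_vacuum]
      · simp [rMatrix]
      · simp [rMatrix]
    have r11 : (rAux η .principal (x - ws j) j 1 1).mulVec (vacuum L) =
        bFun η (x - ws j) • vacuum L := by
      simp only [rAux, Matrix.of_apply]
      rw [siteOp_mulVec_vacuum]
      · simp [rMatrix]
      · simp [rMatrix]
    have c01 := (siteOp_commute_siteMonodromy η .principal ws x hl.1
      (Matrix.of fun b d => rMatrix η .principal (x - ws j) (0, b) (1, d)) 1 0).eq
    simp only [siteMonodromy_cons, Matrix.mul_apply, Fin.sum_univ_two, Matrix.add_mulVec,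
      ← Matrix.mulVec_mulVec, r00, r10, r11, h0, h1, Matrix.mulVec_zero, add_zero, true_and,
      Matrix.mulVec_smul, h2]
    -- The entry `B` of the site `j` does not annihilate the vacuum, but it commutes with the `C`
    -- entry of the other sites, which does.
    have : (siteMonodromy η .principal ws x l 1 0).mulVec
        ((rAux η .principal (x - ws j) j 0 1).mulVec (vacuum L)) = 0 := by
      rw [Matrix.mulVec_mulVec, rAux, Matrix.of_apply, ← c01, ← Matrix.mulVec_mulVec, h1,
        Matrix.mulVec_zero]
    rw [this, zero_add, smul_smul, List.map_cons, List.prod_cons]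

/-! ### Bethe vectors -/

theorem exchange_relations {η u : ℂ} {A : Type*} [Ring A] [Algebra ℂ A]
    {X Y : Matrix (Fin 2) (Fin 2) A} (h : Exchange (sixVertex η u) X Y) :
    Complex.sinh (u + η) • (X 0 1 * Y 0 1) = Complex.sinh (u + η) • (Y 0 1 * X 0 1) ∧
    Complex.sinh u • (Y 0 0 * X 0 1) =
      Complex.sinh (u + η) • (X 0 1 * Y 0 0) - Complex.sinh η • (Y 0 1 * X 0 0) ∧
    Complex.sinh u • (X 1 1 * Y 0 1) =
      Complex.sinh (u + η) • (Y 0 1 * X 1 1) - Complex.sinh η • (X 0 1 * Y 1 1) := by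
  refine ⟨?_, ?_, ?_⟩
  · simpa [Fintype.sum_prod_type, sixVertex] using h.entry (0, 0) (1, 1)
  · have := h.entry (0, 0) (1, 0)
    simp [Fintype.sum_prod_type, sixVertex] at this
    rw [this]; abel
  · have := h.entry (1, 0) (1, 1)
    simp [Fintype.sum_prod_type, sixVertex] at this
    rw [← this]; abel

/-- The action on an off-shell Bethe vector of a family of operators `X` with
`X_i B_j = f B_j X_i + g B_i X_j`. -/
theorem offShell_action {ι : Type*} [DecidableEq ι] {n : Type*} [Fintype n] (η : ℂ) (y : ι → ℂ)
    (X B : ι → Matrix n n ℂ) (x : ι → ℂ) (vac : n → ℂ)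
    (hy : ∀ i j, i ≠ j → Complex.sinh (y j - y i) ≠ 0)
    (hB : ∀ i j, B i * B j = B j * B i)
    (hX : ∀ i j, i ≠ j → Complex.sinh (y j - y i) • (X i * B j) =
      Complex.sinh (y j - y i + η) • (B j * X i) - Complex.sinh η • (B i * X j))
    (hvac : ∀ i, (X i).mulVec vac = x i • vac)
    (Ψ : Finset ι → n → ℂ) (hΨ₀ : Ψ ∅ = vac)
    (hΨ : ∀ i S, i ∉ S → Ψ (insert i S) = (B i).mulVec (Ψ S)) (S : Finset ι) (m : ι)
    (hm : m ∉ S) :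
    (X m).mulVec (Ψ S) =
      (x m * ∏ k ∈ S, Complex.sinh (y k - y m + η) / Complex.sinh (y k - y m)) • Ψ S -
      ∑ k ∈ S, (x k * (Complex.sinh η / Complex.sinh (y k - y m)) *
        ∏ l ∈ S.erase k, Complex.sinh (y l - y k + η) / Complex.sinh (y l - y k)) •
          (B m).mulVec (Ψ (S.erase k)) := by
  induction S using Finset.induction_on generalizing m with
  | empty => simp [hΨ₀, hvac]
  | insert i S hi ih =>
    rw [Finset.mem_insert, not_or] at hm
    obtain ⟨hmi, hmS⟩ := hm
    have hne := hy m i hmi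
    have hrel : X m * B i = (Complex.sinh (y i - y m + η) / Complex.sinh (y i - y m)) • (B i * X m)
        - (Complex.sinh η / Complex.sinh (y i - y m)) • (B m * X i) := by
      have := congrArg (fun z => (Complex.sinh (y i - y m))⁻¹ • z) (hX m i hmi)
      simp only [smul_smul, smul_sub, inv_mul_cancel₀ hne, one_smul] at this
      rw [this, div_eq_inv_mul, div_eq_inv_mul]
    rw [hΨ i S hi, Matrix.mulVec_mulVec, hrel, Matrix.sub_mulVec, Matrix.smul_mulVec,
      Matrix.smul_mulVec, ← Matrix.mulVec_mulVec, ← Matrix.mulVec_mulVec, ih m hmS, ih i hi,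
      Finset.prod_insert hi, Finset.sum_insert hi, Finset.erase_insert hi]
    -- The vector `B_m B_i Ψ(S \ k)` arises twice: from the unwanted term of `X_m` after passing
    -- `B_i`, and from that of `X_i` after the exchange. The addition formula `key` merges the two
    -- coefficients into the one for `insert i S`.
    have hsum : ∑ k ∈ S, (x k * (Complex.sinh η / Complex.sinh (y k - y m)) *
        ∏ l ∈ (insert i S).erase k, Complex.sinh (y l - y k + η) / Complex.sinh (y l - y k)) •
          (B m).mulVec (Ψ ((insert i S).erase k)) =
        (Complex.sinh (y i - y m + η) / Complex.sinh (y i - y m)) •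
          ∑ k ∈ S, (x k * (Complex.sinh η / Complex.sinh (y k - y m)) *
            ∏ l ∈ S.erase k, Complex.sinh (y l - y k + η) / Complex.sinh (y l - y k)) •
            (B i).mulVec ((B m).mulVec (Ψ (S.erase k))) -
        (Complex.sinh η / Complex.sinh (y i - y m)) •
          ∑ k ∈ S, (x k * (Complex.sinh η / Complex.sinh (y k - y i)) *
            ∏ l ∈ S.erase k, Complex.sinh (y l - y k + η) / Complex.sinh (y l - y k)) •
            (B m).mulVec ((B i).mulVec (Ψ (S.erase k))) := by
      rw [Finset.smul_sum, Finset.smul_sum, ← Finset.sum_sub_distrib]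
      refine Finset.sum_congr rfl fun k hk => ?_
      have hki : k ≠ i := fun h => hi (h ▸ hk)
      have hkm : k ≠ m := fun h => hmS (h ▸ hk)
      have hik : i ∉ S.erase k := fun h => hi (Finset.mem_of_mem_erase h)
      rw [Finset.erase_insert_of_ne hki.symm, Finset.prod_insert hik, hΨ i _ hik,
        Matrix.mulVec_mulVec, Matrix.mulVec_mulVec, hB i m, smul_smul, smul_smul, ← sub_smul]
      congr 1
      have h1 := hy k i hki
      have h2 := hy m k hkm.symm
      have h3 := hy i k hki.symm
      have h4 : Complex.sinh (y k - y i) = - Complex.sinh (y i - y k) := by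
        rw [← Complex.sinh_neg, neg_sub]
      have key : Complex.sinh (y i - y k + η) * Complex.sinh (y i - y m) =
          Complex.sinh (y i - y m + η) * Complex.sinh (y i - y k) +
            Complex.sinh η * Complex.sinh (y k - y m) := by
        have e1 := Complex.cosh_sq (y i)
        have e2 := Complex.cosh_sq (y k)
        have e3 := Complex.cosh_sq (y m)
        simp only [Complex.sinh_add, Complex.sinh_sub, Complex.cosh_sub]
        grind
      rw [h4]
      field_simp
      linear_combination (x k * Complex.sinh η * ∏ l ∈ S.erase k,
        Complex.sinh (y l - y k + η) / Complex.sinh (y l - y k)) * key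
    rw [hsum]
    simp only [Matrix.mulVec_sub, Matrix.mulVec_smul, Matrix.mulVec_sum, smul_sub, smul_smul]
    have e1 : Complex.sinh (y i - y m + η) / Complex.sinh (y i - y m) *
        (x m * ∏ k ∈ S, Complex.sinh (y k - y m + η) / Complex.sinh (y k - y m)) =
        x m * (Complex.sinh (y i - y m + η) / Complex.sinh (y i - y m) *
        ∏ k ∈ S, Complex.sinh (y k - y m + η) / Complex.sinh (y k - y m)) := by ring
    have e2 : Complex.sinh η / Complex.sinh (y i - y m) *
        (x i * ∏ k ∈ S, Complex.sinh (y k - y i + η) / Complex.sinh (y k - y i)) =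
        x i * (Complex.sinh η / Complex.sinh (y i - y m)) *
        ∏ k ∈ S, Complex.sinh (y k - y i + η) / Complex.sinh (y k - y i) := by ring
    rw [e1, e2]
    abel

end

/-! ### Bethe equations and eigenvectors of the transfer matrix. -/

section Eigenvector

variable {L M : ℕ} {η : ℂ} {ws : Fin L → ℂ}

theorem bFun_ne_zero_of_dHalf {x : ℂ} (h : dHalf η ws x ≠ 0) (j : Fin L) :
    Complex.sinh (x - ws j) ≠ 0 ∧ Complex.sinh (x - ws j + η) ≠ 0 := by
  rw [dHalf, Finset.prod_ne_zero_iff] at h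
  have := h j (Finset.mem_univ _)
  rw [bFun, div_ne_zero_iff] at this
  exact this

theorem list_prod_mulVec_eq {ι n : Type*} [DecidableEq ι] [Fintype n] [DecidableEq n]
    (B : ι → Matrix n n ℂ) (vac : n → ℂ) (Ψ : Finset ι → n → ℂ) (hΨ₀ : Ψ ∅ = vac)
    (hΨ : ∀ i S, i ∉ S → Ψ (insert i S) = (B i).mulVec (Ψ S)) (l : List ι) (hl : l.Nodup) :
    ((l.map B).prod).mulVec vac = Ψ l.toFinset := by
  induction l with
  | nil => simp [hΨ₀]
  | cons i l ih =>
    rw [List.nodup_cons] at hl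
    rw [List.map_cons, List.prod_cons, ← Matrix.mulVec_mulVec, ih hl.2, List.toFinset_cons,
      hΨ i _ (by simpa using hl.1)]

/-- The Bethe equations say exactly that the unwanted terms of `A` and `D` cancel for each `k`. The
wanted term of `D` disappears through `d m = 0`, which leaves that of `A` as the eigenvalue. -/
theorem add_mulVec_list_prod {ι n : Type*} [DecidableEq ι] [Fintype n] [DecidableEq n] (η : ℂ)
    (y : ι → ℂ) (A B D : ι → Matrix n n ℂ) (d : ι → ℂ) (vac : n → ℂ)
    (hy : ∀ i j, i ≠ j → Complex.sinh (y j - y i) ≠ 0)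
    (hB : ∀ i j, B i * B j = B j * B i)
    (hA : ∀ i j, i ≠ j → Complex.sinh (y j - y i) • (A i * B j) =
      Complex.sinh (y j - y i + η) • (B j * A i) - Complex.sinh η • (B i * A j))
    (hD : ∀ i j, i ≠ j → Complex.sinh (y i - y j) • (D i * B j) =
      Complex.sinh (y i - y j + η) • (B j * D i) - Complex.sinh η • (B i * D j))
    (hA₀ : ∀ i, (A i).mulVec vac = vac) (hD₀ : ∀ i, (D i).mulVec vac = d i • vac)
    (l : List ι) (hl : l.Nodup) (m : ι) (hm : m ∉ l) (hdm : d m = 0)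
    (hBethe : ∀ k ∈ l, ∏ i ∈ l.toFinset.erase k, Complex.sinh (y i - y k + η) =
      d k * ∏ i ∈ l.toFinset.erase k, Complex.sinh (y i - y k - η)) :
    (A m + D m).mulVec ((l.map B).prod.mulVec vac) =
      (∏ k ∈ l.toFinset, Complex.sinh (y k - y m + η) / Complex.sinh (y k - y m)) •
        (l.map B).prod.mulVec vac := by
  have hc : ∀ S : Finset ι, (S : Set ι).Pairwise (Function.onFun Commute B) :=
    fun S i _ j _ _ => hB i j
  let Ψ : Finset ι → n → ℂ := fun S => (S.noncommProd B (hc S)).mulVec vac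
  have hΨ₀ : Ψ ∅ = vac := by simp [Ψ]
  have hΨ : ∀ i S, i ∉ S → Ψ (insert i S) = (B i).mulVec (Ψ S) := by
    intro i S hi
    simp only [Ψ]
    rw [Finset.noncommProd_insert_of_notMem _ _ _ _ hi, Matrix.mulVec_mulVec]
  have hm' : m ∉ l.toFinset := by simpa using hm
  have eA := offShell_action η y A B (fun _ => 1) vac hy hB hA (by simpa using hA₀) Ψ hΨ₀ hΨ
    l.toFinset m hm'
  -- The relation for `D` is that for `A` with `η` replaced by `-η`, so the same expansion applies.
  have eD := offShell_action (-η) y D B d vac hy hB (by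
      intro i j h
      have h' := hD i j h
      have e1 : y j - y i = - (y i - y j) := by ring
      have e2 : y j - y i + -η = - (y i - y j + η) := by ring
      rw [e2, e1, Complex.sinh_neg, Complex.sinh_neg, Complex.sinh_neg, neg_smul, neg_smul,
        neg_smul, h']
      abel) hD₀ Ψ hΨ₀ hΨ l.toFinset m hm'
  rw [list_prod_mulVec_eq B vac Ψ hΨ₀ hΨ l hl, Matrix.add_mulVec, eA, eD, hdm, zero_mul, zero_smul,
    zero_sub, one_mul, sub_add_eq_add_sub, add_sub_assoc, ← neg_add', ← Finset.sum_add_distrib,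
    Finset.sum_eq_zero, neg_zero, add_zero]
  intro k hk
  rw [← add_smul]
  convert zero_smul ℂ _
  have h := hBethe k (by simpa using hk)
  simp only [Finset.prod_div_distrib, Complex.sinh_neg, ← sub_eq_add_neg, h]
  ring

/-- A solution of the Bethe-ansatz equations gives an eigenvector of the transfer matrix at an
inhomogeneity. -/
theorem transfer_mulVec_bProd (x : Fin M → ℂ) (hB : BetheEquations η (dHalf η ws) x)
    (hdist : ∀ α β, α ≠ β → Complex.sinh (x α - x β) ≠ 0) (k : Fin L)
    (hk : ∀ j, Complex.sinh (ws k - ws j + η) ≠ 0) :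
    (monodromy η .principal ws (ws k) 0 0 + monodromy η .principal ws (ws k) 1 1).mulVec
        ((bProd (monodromy η .principal ws) x).mulVec (vacuum L)) =
      (∏ α, bFun η (x α - ws k))⁻¹ • (bProd (monodromy η .principal ws) x).mulVec (vacuum L) := by
  -- The spectral parameter `ws k` of the transfer matrix is adjoined to the rapidities as the value
  -- at `none`.
  let y : Option (Fin M) → ℂ := fun o => o.elim (ws k) x
  have hgood : ∀ i j, Complex.sinh (y i - ws j + η) ≠ 0 := by
    rintro (_ | α) j
    · exact hk j
    · exact (bFun_ne_zero_of_dHalf (hB α).1 j).2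
  have hex : ∀ i j, Exchange (sixVertex η (y i - y j)) (monodromy η .principal ws (y i))
      (monodromy η .principal ws (y j)) := by
    intro i j
    rw [monodromy_eq, monodromy_eq]
    exact exchange_siteMonodromy (List.nodup_finRange L) (fun l _ => hgood i l)
      (fun l _ => hgood j l)
  have hne : ∀ i j, i ≠ j → Complex.sinh (y j - y i) ≠ 0 := by
    rintro (_ | α) (_ | β) h
    · exact absurd rfl h
    · exact (bFun_ne_zero_of_dHalf (hB β).1 k).1
    · have := (bFun_ne_zero_of_dHalf (hB α).1 k).1
      rw [← neg_ne_zero, ← Complex.sinh_neg, neg_sub] at this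
      exact this
    · exact hdist β α fun h' => h (by rw [h'])
  have hcomm : ∀ i j, monodromy η .principal ws (y i) 0 1 * monodromy η .principal ws (y j) 0 1 =
      monodromy η .principal ws (y j) 0 1 * monodromy η .principal ws (y i) 0 1 := by
    -- Cancelling the common factor needs `sinh (y i - y j + η) ≠ 0`. For a pair containing `none`
    -- this holds in one order only, by `d ≠ 0`; for two rapidities it is a denominator of the Bethe
    -- equations up to sign.
    have aux : ∀ i j, Complex.sinh (y i - y j + η) ≠ 0 →
        monodromy η .principal ws (y i) 0 1 * monodromy η .principal ws (y j) 0 1 =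
      monodromy η .principal ws (y j) 0 1 * monodromy η .principal ws (y i) 0 1 := by
      intro i j h
      exact smul_right_injective _ h (exchange_relations (hex i j)).1
    rintro (_ | α) (_ | β)
    · rfl
    · exact (aux (some β) none (bFun_ne_zero_of_dHalf (hB β).1 k).2).symm
    · exact aux (some α) none (bFun_ne_zero_of_dHalf (hB α).1 k).2
    · by_cases h : α = β
      · subst h; rfl
      · refine aux (some α) (some β) ?_
        have := (hB β).2.1 α h
        rw [← neg_ne_zero, ← Complex.sinh_neg] at this
        convert this using 2
        simp only [y, Option.elim_some]; ring
  have hvac : ∀ i, (monodromy η .principal ws (y i) 0 0).mulVec (vacuum L) = vacuum L ∧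
      (monodromy η .principal ws (y i) 1 1).mulVec (vacuum L) =
        dHalf η ws (y i) • vacuum L := by
    intro i
    have := siteMonodromy_mulVec_vacuum (η := η) (ws := ws) (y i) (List.nodup_finRange L)
    rw [monodromy_eq, dHalf, ← List.prod_ofFn, List.ofFn_eq_map]
    exact ⟨this.1, this.2.2⟩
  have hset : ((List.finRange M).map some).toFinset =
      Finset.univ.map (Function.Embedding.some (α := Fin M)) := by ext o; simp
  have h := add_mulVec_list_prod η y (fun i => monodromy η .principal ws (y i) 0 0)
    (fun i => monodromy η .principal ws (y i) 0 1) (fun i => monodromy η .principal ws (y i) 1 1)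
    (fun i => dHalf η ws (y i)) (vacuum L) hne hcomm
    (fun i j _ => (exchange_relations (hex j i)).2.1)
    (fun i j _ => (exchange_relations (hex i j)).2.2) (fun i => (hvac i).1) (fun i => (hvac i).2)
    ((List.finRange M).map some)
    (List.Nodup.map (Option.some_injective _) (List.nodup_finRange M)) none (by simp) (by
      rw [dHalf]
      exact Finset.prod_eq_zero (Finset.mem_univ k) (by simp [y, bFun])) (by
      intro o ho
      obtain ⟨α, -, rfl⟩ := List.mem_map.1 ho
      have he : (Finset.univ.map (Function.Embedding.some (α := Fin M))).erase (some α) =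
          (Finset.univ.erase α).map Function.Embedding.some := by
        ext o; cases o <;> simp
      rw [hset, he, Finset.prod_map, Finset.prod_map]
      obtain ⟨h1, h2, h3⟩ := hB α
      have hn : ∏ β ∈ Finset.univ.erase α, Complex.sinh (x α - x β - η) ≠ 0 :=
        Finset.prod_ne_zero_iff.2 fun β hβ => h2 β (Finset.ne_of_mem_erase hβ)
      rw [Finset.prod_div_distrib, div_eq_div_iff h1 hn, one_mul] at h3
      -- The expansion has `x β - x α` where the Bethe equations have `x α - x β`; the resulting
      -- signs agree on both sides.
      have hs : ∀ c : ℂ, ∏ β ∈ Finset.univ.erase α, Complex.sinh (x β - x α - c) =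
          (∏ β ∈ Finset.univ.erase α, (-1)) *
            ∏ β ∈ Finset.univ.erase α, Complex.sinh (x α - x β + c) := by
        intro c
        rw [← Finset.prod_mul_distrib]
        refine Finset.prod_congr rfl fun β _ => ?_
        rw [neg_one_mul, ← Complex.sinh_neg]
        congr 1; ring
      have hs1 := hs η
      have hs2 := hs (-η)
      simp only [sub_neg_eq_add, ← sub_eq_add_neg] at hs2
      change ∏ β ∈ Finset.univ.erase α, Complex.sinh (x β - x α + η) =
        dHalf η ws (x α) * ∏ β ∈ Finset.univ.erase α, Complex.sinh (x β - x α - η)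
      rw [hs1, hs2, h3]
      ring)
  rw [hset, Finset.prod_map, List.map_map] at h
  rw [bProd, List.ofFn_eq_map, ← Finset.prod_inv_distrib]
  simp only [bFun, inv_div]
  exact h

end Eigenvector

/-! ### The quantum inverse scattering problem. -/

section InverseScattering

variable {L : ℕ} {η : ℂ} {ws : Fin L → ℂ}

/-- The transfer matrix of the sites in a list. -/
def siteTransfer (η : ℂ) (ws : Fin L → ℂ) (x : ℂ) (l : List (Fin L)) : Op L :=
  siteMonodromy η .principal ws x l 0 0 + siteMonodromy η .principal ws x l 1 1

theorem siteOp_single_mul (j : Fin L) (a b c d : Fin 2) :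
    siteOp j (Matrix.single a b (1 : ℂ)) * siteOp j (Matrix.single c d 1) =
      if b = c then siteOp j (Matrix.single a d 1) else 0 := by
  rw [← siteOp_mul]
  split_ifs with h
  · subst h; simp
  · rw [Matrix.single_mul_single_of_ne _ _ _ _ h]; exact map_zero (siteHom j)

theorem siteOp_eq_sum_single (j : Fin L) (x : Matrix (Fin 2) (Fin 2) ℂ) :
    siteOp j x = ∑ p : Fin 2 × Fin 2, x p.1 p.2 • siteOp j (Matrix.single p.1 p.2 1) := by
  conv_lhs => rw [Matrix.matrix_eq_sum_single x]
  simp only [← siteHom_apply, ← map_smul, ← map_sum, Fintype.sum_prod_type]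
  simp [Matrix.smul_single]

/-- `R(0)` is the permutation of the auxiliary space and the site, since `b(0) = 0` and `c(0) = 1`.
-/
theorem rAux_zero (hη : Complex.sinh η ≠ 0) (j : Fin L) (a c : Fin 2) :
    rAux η .principal 0 j a c = siteOp j (Matrix.single c a 1) := by
  rw [rAux, Matrix.of_apply]
  congr 1
  rw [rMatrix_principal (by simpa using hη)]
  ext b d
  fin_cases a <;> fin_cases b <;> fin_cases c <;> fin_cases d <;>
    simp [sixVertex, hη, Matrix.single]

/-- At the inhomogeneity of the first site, the entries of the monodromy matrix are the elementary
operators of this site times the transfer matrix. -/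
theorem siteMonodromy_cons_self (hη : Complex.sinh η ≠ 0) {j : Fin L} {l : List (Fin L)}
    (hj : j ∉ l) (a b : Fin 2) :
    siteMonodromy η .principal ws (ws j) (j :: l) a b =
      siteOp j (Matrix.single b a 1) * siteTransfer η ws (ws j) (j :: l) := by
  have hc := fun y a c => (siteOp_commute_siteMonodromy η .principal ws (ws j) hj y a c).eq
  -- With `R(0)` a permutation, the transfer matrix is `∑ T_{pq} e^{p,q}` with `T` the monodromy of
  -- the remaining sites; multiplication by `e^{b,a}` selects the row `p = a`.
  simp only [siteTransfer, siteMonodromy_cons, sub_self, Matrix.mul_apply, rAux_zero hη,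
    Fin.sum_univ_two, ← hc, mul_add, ← mul_assoc, siteOp_single_mul]
  fin_cases a <;> fin_cases b <;> simp

/-- Together with `sum_matrixUnit_mul_sum`, this brings both sides of the intertwining relation
below to the form `∑ (operator on the other sites) * e p y`. The coefficients of the two forms are
the two sides of an entry of the exchange relation for the other sites. -/
theorem sum_mul_sum_matrixUnit {A : Type*} [Ring A] [Algebra ℂ A] (e : Fin 2 → Fin 2 → A)
    (he : ∀ a b c d, e a b * e c d = if b = c then e a d else 0) (U W : Fin 2 → Fin 2 → A)
    (hW : ∀ a b c d, e a b * W c d = W c d * e a b)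
    (ρ : Fin 2 × Fin 2 → Fin 2 × Fin 2 → ℂ) (a c : Fin 2) :
    (∑ p, ∑ q, U p q * e p q) * ∑ b, W a b * ∑ x, ∑ y, ρ (b, x) (c, y) • e x y =
      ∑ p, ∑ y, (∑ r : Fin 2 × Fin 2, ρ r (c, y) • (U p r.2 * W a r.1)) * e p y := by
  have h : ∀ p q b x y, (U p q * e p q) * (W a b * (ρ (b, x) (c, y) • e x y)) =
      if q = x then ρ (b, x) (c, y) • (U p q * W a b * e p y) else 0 := by
    intro p q b x y
    have : (U p q * e p q) * (W a b * (ρ (b, x) (c, y) • e x y)) =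
        ρ (b, x) (c, y) • (U p q * (e p q * W a b) * e x y) := by
      simp only [mul_smul_comm, mul_assoc]
    rw [this, hW, mul_assoc, mul_assoc, he]
    split_ifs <;> simp [mul_assoc]
  simp only [Finset.mul_sum, Finset.sum_mul, h]
  simp only [Fin.sum_univ_two, Fintype.sum_prod_type, smul_mul_assoc]
  simp
  abel

theorem sum_matrixUnit_mul_sum {A : Type*} [Ring A] [Algebra ℂ A] (e : Fin 2 → Fin 2 → A)
    (he : ∀ a b c d, e a b * e c d = if b = c then e a d else 0) (U W : Fin 2 → Fin 2 → A)
    (hU : ∀ a b c d, e a b * U c d = U c d * e a b)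
    (hW : ∀ a b c d, e a b * W c d = W c d * e a b)
    (ρ : Fin 2 × Fin 2 → Fin 2 × Fin 2 → ℂ) (a c : Fin 2) :
    (∑ b, (∑ x, ∑ y, ρ (a, x) (b, y) • e x y) * W b c) * ∑ p, ∑ q, U p q * e p q =
      ∑ p, ∑ y, (∑ r : Fin 2 × Fin 2, ρ (a, p) r • (W r.1 c * U r.2 y)) * e p y := by
  have h : ∀ p q b x y, ((ρ (a, x) (b, y) • e x y) * W b c) * (U p q * e p q) =
      if y = p then ρ (a, x) (b, y) • (W b c * U p q * e x q) else 0 := by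
    intro p q b x y
    have : ((ρ (a, x) (b, y) • e x y) * W b c) * (U p q * e p q) =
        ρ (a, x) (b, y) • ((e x y * W b c) * U p q * e p q) := by
      simp only [smul_mul_assoc, mul_assoc]
    rw [this, hW, mul_assoc (W b c), hU, ← mul_assoc, mul_assoc _ (e x y), he]
    split_ifs <;> simp
  simp only [Finset.mul_sum, Finset.sum_mul, h]
  simp only [Fin.sum_univ_two, Fintype.sum_prod_type, smul_mul_assoc]
  simp
  abel

/-- The transfer matrix at the inhomogeneity of the first site moves this site to the end. -/
theorem siteTransfer_mul_siteMonodromy {j : Fin L} {l : List (Fin L)}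
    (hl : (j :: l).Nodup) {x : ℂ} (hη : Complex.sinh η ≠ 0)
    (hx : ∀ k ∈ j :: l, Complex.sinh (x - ws k + η) ≠ 0)
    (hj : ∀ k ∈ l, Complex.sinh (ws j - ws k + η) ≠ 0) (a c : Fin 2) :
    siteTransfer η ws (ws j) (j :: l) * siteMonodromy η .principal ws x (j :: l) a c =
      siteMonodromy η .principal ws x (l ++ [j]) a c * siteTransfer η ws (ws j) (j :: l) := by
  rw [List.nodup_cons] at hl
  have hE := (exchange_siteMonodromy (ws := ws) (x := x) (y := ws j) (η := η) hl.2
    (fun k hk => hx k (by simp [hk])) hj).entry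
  have hx0 := hx j (by simp)
  have hr : ∀ a c, rAux η .principal (x - ws j) j a c =
      (Complex.sinh (x - ws j + η))⁻¹ • ∑ p, ∑ q, sixVertex η (x - ws j) (a, p) (c, q) •
        siteOp j (Matrix.single p q 1) := by
    intro a c
    rw [rAux, Matrix.of_apply, rMatrix_principal hx0]
    refine (map_smul (siteHom j) _
      (Matrix.of fun b d => sixVertex η (x - ws j) (a, b) (c, d))).trans (congrArg _ ?_)
    rw [siteHom_apply, siteOp_eq_sum_single, Fintype.sum_prod_type]
    rfl
  have h1 : siteTransfer η ws (ws j) (j :: l) =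
      ∑ p, ∑ q, siteMonodromy η .principal ws (ws j) l p q * siteOp j (Matrix.single p q 1) := by
    rw [siteTransfer, siteMonodromy_cons, sub_self]
    simp only [Matrix.mul_apply, rAux_zero hη, Fin.sum_univ_two]
  have hee := fun a b c d => siteOp_single_mul (L := L) j a b c d
  have hU := fun a b c d => (siteOp_commute_siteMonodromy η .principal ws (ws j) hl.1
    (Matrix.single a b 1) c d).eq
  have hW := fun a b c d => (siteOp_commute_siteMonodromy η .principal ws x hl.1
    (Matrix.single a b 1) c d).eq
  rw [h1, siteMonodromy_append, siteMonodromy_singleton, siteMonodromy_cons, Matrix.mul_apply,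
    Matrix.mul_apply]
  simp only [hr, mul_smul_comm, smul_mul_assoc, ← Finset.smul_sum]
  congr 1
  refine (sum_mul_sum_matrixUnit _ hee (siteMonodromy η .principal ws (ws j) l)
    (siteMonodromy η .principal ws x l) hW (sixVertex η (x - ws j)) a c).trans ?_
  refine Eq.trans ?_ (sum_matrixUnit_mul_sum _ hee (siteMonodromy η .principal ws (ws j) l)
    (siteMonodromy η .principal ws x l) hU hW (sixVertex η (x - ws j)) a c).symm
  refine Finset.sum_congr rfl fun p _ => Finset.sum_congr rfl fun y _ => ?_
  exact congrArg (· * siteOp j (Matrix.single p y 1)) (hE (a, p) (c, y)).symm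

theorem siteTransfer_mul_siteTransfer {j : Fin L} {l : List (Fin L)}
    (hl : (j :: l).Nodup) {x : ℂ} (hη : Complex.sinh η ≠ 0)
    (hx : ∀ k ∈ j :: l, Complex.sinh (x - ws k + η) ≠ 0)
    (hj : ∀ k ∈ l, Complex.sinh (ws j - ws k + η) ≠ 0) :
    siteTransfer η ws (ws j) (j :: l) * siteTransfer η ws x (j :: l) =
      siteTransfer η ws x (l ++ [j]) * siteTransfer η ws (ws j) (j :: l) := by
  conv_lhs => rw [siteTransfer.eq_1 η ws x]
  conv_rhs => rw [siteTransfer.eq_1 η ws x]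
  rw [mul_add, add_mul, siteTransfer_mul_siteMonodromy hl hη hx hj,
    siteTransfer_mul_siteMonodromy hl hη hx hj]

/-- The product of the transfer matrices at the first inhomogeneities moves the first sites to the
end. -/
theorem prod_siteTransfer_mul_siteMonodromy (hη : Complex.sinh η ≠ 0)
    (hw : ∀ j k, Complex.sinh (ws j - ws k + η) ≠ 0) (l l' : List (Fin L))
    (hl : (l ++ l').Nodup) {x : ℂ} (hx : ∀ k, Complex.sinh (x - ws k + η) ≠ 0) (a c : Fin 2) :
    (l.map fun j => siteTransfer η ws (ws j) (l ++ l')).prod *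
        siteMonodromy η .principal ws x (l ++ l') a c =
      siteMonodromy η .principal ws x (l' ++ l) a c *
        (l.map fun j => siteTransfer η ws (ws j) (l ++ l')).prod := by
  induction l generalizing l' x a c with
  | nil => simp
  | cons j l ih =>
    have hl' : (j :: (l ++ l')).Nodup := hl
    have hl2 : (l ++ (l' ++ [j])).Nodup := by
      rw [← List.append_assoc]
      exact (List.perm_append_singleton j (l ++ l')).nodup_iff.2 hl
    -- The transfer matrix at `ws j` is brought to the right of the remaining ones; passing them, it
    -- moves the site `j` to the end of their site order, which is the order in the induction
    -- hypothesis.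
    have hmove : ∀ m : List (Fin L), siteTransfer η ws (ws j) (j :: (l ++ l')) *
        (m.map fun k => siteTransfer η ws (ws k) (j :: (l ++ l'))).prod =
        (m.map fun k => siteTransfer η ws (ws k) (l ++ (l' ++ [j]))).prod *
          siteTransfer η ws (ws j) (j :: (l ++ l')) := by
      intro m
      induction m with
      | nil => simp
      | cons k m ihm =>
        rw [List.map_cons, List.prod_cons, ← mul_assoc,
          siteTransfer_mul_siteTransfer hl' hη (fun _ _ => hw _ _) (fun _ _ => hw _ _), mul_assoc,
          ihm, List.map_cons, List.prod_cons, mul_assoc, List.append_assoc]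
    simp only [List.cons_append, List.map_cons, List.prod_cons]
    rw [hmove, mul_assoc, siteTransfer_mul_siteMonodromy hl' hη (fun _ _ => hx _)
      (fun _ _ => hw _ _), ← mul_assoc, List.append_assoc, ih (l' ++ [j]) hl2 hx, ← mul_assoc,
      List.append_assoc, List.singleton_append]

/-- The solution of the quantum inverse scattering problem for a product of elementary
operators. -/
theorem prod_siteMonodromy (hη : Complex.sinh η ≠ 0)
    (hw : ∀ j k, Complex.sinh (ws j - ws k + η) ≠ 0) (l l' : List (Fin L))
    (hl : (l ++ l').Nodup) (a b : Fin L → Fin 2) :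
    (l.map fun j => siteMonodromy η .principal ws (ws j) (l ++ l') (a j) (b j)).prod =
      (l.map fun j => siteOp j (Matrix.single (b j) (a j) 1)).prod *
        (l.map fun j => siteTransfer η ws (ws j) (l ++ l')).prod := by
  -- Induction on the last factor. The transfer matrices of the earlier sites, pulled through it,
  -- move these sites to the end, so that `j` becomes the first site and `siteMonodromy_cons_self`
  -- applies. Its transfer matrix is then carried back to the original site order.
  induction l using List.reverseRecOn generalizing l' with
  | nil => simp
  | append_singleton l j ih =>
    simp only [List.append_assoc, List.singleton_append] at hl ⊢
    have hj : j ∉ l' ++ l := by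
      have := (List.perm_append_comm (l₁ := l) (l₂ := j :: l')).nodup_iff.1 hl
      rw [List.cons_append, List.nodup_cons] at this
      exact this.1
    simp only [List.map_append, List.prod_append, List.map_singleton, List.prod_singleton]
    have h0 := fun x hx a c =>
      prod_siteTransfer_mul_siteMonodromy hη hw l (j :: l') hl (x := x) hx a c
    rw [ih (j :: l') hl, mul_assoc, h0 _ (fun _ => hw _ _), List.cons_append,
      siteMonodromy_cons_self hη hj, siteTransfer, mul_assoc, add_mul, ← List.cons_append,
      ← h0 _ (fun _ => hw _ _), ← h0 _ (fun _ => hw _ _), ← mul_add, ← mul_assoc, ← mul_assoc,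
      siteTransfer]
    simp only [mul_assoc]

end InverseScattering

/-! ### Monodromy entries at inhomogeneities as matrix units, up to the eigenvalues. -/

section Inverse

theorem vacExp_eq {L : ℕ} (X Y : Op L) :
    vacExp (X * Y) = (X.mulVec (Y.mulVec (vacuum L))) (fun _ => 0) := by
  rw [Matrix.mulVec_mulVec, vacuum, Matrix.mulVec_single_one]; rfl

@[simp] theorem symm_site {Ns ℓ : ℕ} (b : Fin Ns) (β : Fin ℓ) :
    finProdFinEquiv.symm (site b β) = (b, β) := by
  rw [site, Equiv.symm_apply_apply]

/-- The sites of the first `m` blocks in increasing order. -/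
def blockSites {Ns m : ℕ} (ℓ : ℕ) (hm : m ≤ Ns) : List (Fin (Ns * ℓ)) :=
  (List.ofFn fun k : Fin m => List.ofFn fun β : Fin ℓ => site (Fin.castLE hm k) β).flatten

theorem blockSites_eq {Ns m : ℕ} (ℓ : ℕ) (hm : m ≤ Ns) :
    blockSites ℓ hm = List.ofFn fun i : Fin (m * ℓ) => Fin.castLE (Nat.mul_le_mul_right ℓ hm) i := by
  rw [List.ofFn_mul, blockSites]
  congr 2
  ext1 k
  congr 1
  ext1 β
  ext
  simp [site, mul_comm, add_comm]

theorem mem_blockSites {Ns m : ℕ} (ℓ : ℕ) (hm : m ≤ Ns) (j : Fin (Ns * ℓ)) :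
    j ∈ blockSites ℓ hm ↔ (j : ℕ) < m * ℓ := by
  rw [blockSites_eq, List.mem_ofFn]
  constructor
  · rintro ⟨i, rfl⟩; exact i.2
  · intro h; exact ⟨⟨j, h⟩, rfl⟩

theorem exists_blockSites_append {Ns m : ℕ} (ℓ : ℕ) (hm : m ≤ Ns) :
    ∃ l, blockSites ℓ hm ++ l = List.finRange (Ns * ℓ) := by
  refine ⟨(List.finRange (Ns * ℓ)).drop (m * ℓ), ?_⟩
  rw [blockSites_eq]
  conv_rhs => rw [← List.take_append_drop (m * ℓ) (List.finRange (Ns * ℓ))]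
  congr 1
  have := Nat.mul_le_mul_right ℓ hm
  refine List.ext_getElem (by simp [this]) fun i h1 h2 => ?_
  ext
  simp

theorem prod_map_blockSites {Ns m : ℕ} (ℓ : ℕ) (hm : m ≤ Ns) {A : Type*} [Monoid A]
    (f : Fin (Ns * ℓ) → A) : ((blockSites ℓ hm).map f).prod =
      (List.ofFn fun k : Fin m =>
        (List.ofFn fun β : Fin ℓ => f (site (Fin.castLE hm k) β)).prod).prod := by
  rw [blockSites, List.map_flatten, List.prod_flatten, List.map_map, List.map_ofFn]
  congr 2
  ext1 k
  simp [List.map_ofFn, Function.comp_def]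

/-- A product of entries of monodromy matrices at the inhomogeneities of the first blocks, between
products of `C` operators and a Bethe vector. -/
theorem vacExp_prod_monodromy {Ns ℓ m N M : ℕ} (hm : m ≤ Ns) {η : ℂ}
    (hη : 1 ≤ ℓ → Complex.sinh η ≠ 0) {ws : Fin (Ns * ℓ) → ℂ}
    (hw : ∀ j k, Complex.sinh (ws j - ws k + η) ≠ 0) (μ : Fin N → ℂ) (x : Fin M → ℂ)
    (hB : BetheEquations η (dHalf η ws) x)
    (hdist : ∀ α β, α ≠ β → Complex.sinh (x α - x β) ≠ 0) (e e' : Fin m → Fin ℓ → Fin 2) :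
    vacExp (cProd (monodromy η .principal ws) μ *
      (List.ofFn fun k : Fin m => (List.ofFn fun β : Fin ℓ =>
        monodromy η .principal ws (ws (site (Fin.castLE hm k) β)) (e k β) (e' k β)).prod).prod *
      bProd (monodromy η .principal ws) x) =
    (phiFun η (m * ℓ) x ws)⁻¹ * vacExp (cProd (monodromy η .principal ws) μ *
      (List.ofFn fun k : Fin m => (List.ofFn fun β : Fin ℓ =>
        siteOp (site (Fin.castLE hm k) β) (Matrix.single (e' k β) (e k β) 1)).prod).prod *
      bProd (monodromy η .principal ws) x) := by
  -- Sequences on the first `m` blocks are extended to all sites; the value `0` on the other blocks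
  -- is never used.
  let ext : (Fin m → Fin ℓ → Fin 2) → Fin (Ns * ℓ) → Fin 2 := fun e j =>
    if h : ((finProdFinEquiv.symm j).1 : ℕ) < m then e ⟨_, h⟩ (finProdFinEquiv.symm j).2 else 0
  have hext : ∀ e k β, ext e (site (Fin.castLE hm k) β) = e k β := by
    intro e k β
    simp only [ext, symm_site]
    exact dif_pos k.2
  have hsites : ((blockSites ℓ hm).map fun j =>
        monodromy η .principal ws (ws j) (ext e j) (ext e' j)).prod =
      ((blockSites ℓ hm).map fun j => siteOp j (Matrix.single (ext e' j) (ext e j) 1)).prod *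
        ((blockSites ℓ hm).map fun j => monodromy η .principal ws (ws j) 0 0 +
          monodromy η .principal ws (ws j) 1 1).prod := by
    rcases Nat.eq_zero_or_pos ℓ with rfl | hl
    · have : blockSites 0 hm = [] := by
        rw [List.eq_nil_iff_forall_not_mem]
        intro j
        exact (Nat.not_lt_zero _ j.2).elim
      simp [this]
    · obtain ⟨l, h⟩ := exists_blockSites_append ℓ hm
      have := prod_siteMonodromy (hη hl) hw (blockSites ℓ hm) l
        (by rw [h]; exact List.nodup_finRange _) (ext e) (ext e')
      rw [h] at this
      simpa only [siteTransfer, ← monodromy_eq] using this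
  have heig : ∀ l : List (Fin (Ns * ℓ)), (l.map fun j => monodromy η .principal ws (ws j) 0 0 +
          monodromy η .principal ws (ws j) 1 1).prod.mulVec
        ((bProd (monodromy η .principal ws) x).mulVec (vacuum (Ns * ℓ))) =
      (l.map fun j => (∏ α, bFun η (x α - ws j))⁻¹).prod •
        (bProd (monodromy η .principal ws) x).mulVec (vacuum (Ns * ℓ)) := by
    intro l
    induction l with
    | nil => simp
    | cons j l ih =>
      rw [List.map_cons, List.prod_cons, ← Matrix.mulVec_mulVec, ih, Matrix.mulVec_smul,
        transfer_mulVec_bProd x hB hdist j (hw j), smul_smul, List.map_cons, List.prod_cons,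
        mul_comm (List.prod _)]
  have hphi : ((blockSites ℓ hm).map fun j => (∏ α, bFun η (x α - ws j))⁻¹).prod =
      (phiFun η (m * ℓ) x ws)⁻¹ := by
    have hnd : (blockSites ℓ hm).Nodup := by
      obtain ⟨l, h⟩ := exists_blockSites_append ℓ hm
      exact (List.nodup_append.1 (h ▸ List.nodup_finRange _)).1
    rw [← List.prod_toFinset _ hnd, phiFun, ← Finset.prod_inv_distrib]
    refine Finset.prod_congr ?_ fun _ _ => rfl
    ext j
    simp [mem_blockSites]
  have h1 := prod_map_blockSites ℓ hm fun j =>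
    monodromy η .principal ws (ws j) (ext e j) (ext e' j)
  have h2 := prod_map_blockSites ℓ hm fun j =>
    siteOp j (Matrix.single (ext e' j) (ext e j) 1)
  simp only [hext] at h1 h2
  rw [← h1, ← h2, hsites, vacExp_eq, vacExp_eq, ← mul_assoc, ← Matrix.mulVec_mulVec, heig,
    Matrix.mulVec_smul, hphi]
  rfl

end Inverse

/-! ### The vectors `‖ℓ, n⟩` and their square lengths. -/

section Kets

variable {ℓ : ℕ}

/-- The number of ones in a configuration. -/
def ones (s : Config ℓ) : ℕ := ∑ β, if s β = 1 then 1 else 0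

/-- The sum of the (1-based) positions of the ones in a configuration. -/
def onesSum (s : Config ℓ) : ℕ := ∑ β : Fin ℓ, if s β = 1 then (β : ℕ) + 1 else 0

theorem ones_eq_card (s : Config ℓ) :
    ones s = (Finset.univ.filter fun β => s β = 1).card := by
  rw [ones, Finset.card_filter]

theorem mem_seqs {n : ℕ} (s : Config ℓ) : s ∈ seqs ℓ n ↔ ones s = n := by
  rw [seqs, Finset.mem_filter, ones_eq_card]; simp

theorem ones_le (s : Config ℓ) : ones s ≤ ℓ := by
  rw [ones_eq_card]
  exact (Finset.card_le_univ _).trans (by simp)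

theorem ones_update {s : Config ℓ} {j : Fin ℓ} (h : s j = 1) :
    ones (Function.update s j 0) + 1 = ones s := by
  rw [ones, ones, ← Finset.add_sum_erase _ _ (Finset.mem_univ j),
    ← Finset.add_sum_erase _ _ (Finset.mem_univ j), add_right_comm]
  simp only [Function.update_self, h, zero_ne_one, if_false, if_true, zero_add]
  congr 1
  exact Finset.sum_congr rfl fun k hk => by rw [Function.update_of_ne (Finset.ne_of_mem_erase hk)]

theorem onesSum_update {s : Config ℓ} {j : Fin ℓ} (h : s j = 1) :
    onesSum (Function.update s j 0) + (j + 1) = onesSum s := by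
  rw [onesSum, onesSum, ← Finset.add_sum_erase _ _ (Finset.mem_univ j),
    ← Finset.add_sum_erase _ _ (Finset.mem_univ j), add_right_comm]
  simp only [Function.update_self, h, zero_ne_one, if_false, if_true, zero_add]
  congr 1
  exact Finset.sum_congr rfl fun k hk => by rw [Function.update_of_ne (Finset.ne_of_mem_erase hk)]

theorem siteOp_mulVec_apply {L : ℕ} (j : Fin L) (x : Matrix (Fin 2) (Fin 2) ℂ) (v : Config L → ℂ)
    (s : Config L) :
    (siteOp j x).mulVec v s = ∑ a, x (s j) a * v (Function.update s j a) := by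
  rw [Matrix.mulVec, dotProduct]
  symm
  refine Fintype.sum_of_injective (Function.update s j) (Function.update_injective s j) _ _ ?_ ?_
  · intro u hu
    rw [siteOp, Matrix.of_apply, if_neg, zero_mul]
    intro h
    refine hu ⟨u j, ?_⟩
    ext k
    by_cases hk : k = j
    · subst hk; simp
    · simp [hk, h k hk]
  · intro a
    rw [siteOp, Matrix.of_apply, if_pos]
    · simp
    · intro k hk; simp [hk]

theorem prod_kInv_mulVec_apply (η : ℂ) (l : List (Fin ℓ)) (v : Config ℓ → ℂ) (s : Config ℓ) :
    ((l.map fun k => siteOp k (kInv η)).prod.mulVec v) s =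
      (l.map fun k => Complex.exp (η * if s k = 1 then 1 else -1)).prod * v s := by
  induction l generalizing v with
  | nil => simp
  | cons k l ih =>
    rw [List.map_cons, List.prod_cons, ← Matrix.mulVec_mulVec, siteOp_mulVec_apply, List.map_cons,
      List.prod_cons, mul_assoc, ← ih]
    rcases Fin.exists_fin_two.1 ⟨s k, rfl⟩ with h | h
    · have : Function.update s k 0 = s := by rw [← h, Function.update_eq_self]
      simp [h, kInv, this, qPar, Complex.exp_neg]
    · have : Function.update s k 1 = s := by rw [← h, Function.update_eq_self]
      simp [h, kInv, this, qPar]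

theorem sum_sign_Ioi (s : Config ℓ) (j : Fin ℓ) :
    ∑ k ∈ Finset.Ioi j, (if s k = 1 then (1 : ℂ) else -1) =
      2 * ((Finset.univ.filter fun k => s k = 1).filter fun k => j < k).card + (j + 1) - ℓ := by
  have h : ∀ k, (if s k = 1 then (1 : ℂ) else -1) = 2 * (if s k = 1 then 1 else 0) - 1 := by
    intro k; split_ifs <;> norm_num
  simp only [h, Finset.sum_sub_distrib, ← Finset.mul_sum]
  rw [Finset.sum_const, Fin.card_Ioi, nsmul_one, Finset.sum_boole]
  have : (Finset.Ioi j).filter (fun k => s k = 1) =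
      (Finset.univ.filter fun k => s k = 1).filter fun k => j < k := by
    ext k; simp [and_comm]
  rw [this]
  have hj := j.2
  have : ((ℓ - 1 - (j : ℕ) : ℕ) : ℂ) = ℓ - 1 - j := by
    rw [Nat.cast_sub (by omega), Nat.cast_sub (by omega)]; simp
  rw [this]; ring

theorem lowering_mulVec_apply (η : ℂ) (v : Config ℓ → ℂ) (s : Config ℓ) :
    (lowering η ℓ).mulVec v s = ∑ j ∈ Finset.univ.filter (fun j => s j = 1),
      Complex.exp (η * (2 * ((Finset.univ.filter fun k => s k = 1).filter fun k => j < k).card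
        + (j + 1) - ℓ)) * v (Function.update s j 0) := by
  rw [lowering, Matrix.sum_mulVec, Finset.sum_apply, Finset.sum_filter]
  refine Finset.sum_congr rfl fun j _ => ?_
  rw [← Matrix.mulVec_mulVec, siteOp_mulVec_apply, Fin.sum_univ_two]
  rcases Fin.exists_fin_two.1 ⟨s j, rfl⟩ with h | h
  · simp [h, xMinus]
  · rw [if_pos h, prod_kInv_mulVec_apply, ← sum_sign_Ioi, Finset.mul_sum, Complex.exp_sum]
    have hl : ((List.finRange ℓ).filter fun k => j < k).toFinset = Finset.Ioi j := by
      ext k; simp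
    rw [← hl, List.prod_toFinset _ ((List.nodup_finRange ℓ).filter _)]
    simp only [h, xMinus, Matrix.of_apply, Matrix.cons_val_zero, Matrix.cons_val_one, one_mul,
      zero_mul, add_zero]
    congr 2
    refine List.map_congr_left fun k hk => ?_
    have hk' : j < k := by simpa using (List.mem_filter.1 hk).2
    rw [Function.update_of_ne hk'.ne']

/-- From the top downwards, the elements of `S` have `0, 1, 2, …` elements above them. -/
theorem sum_pow_card_filter_lt {α : Type*} [LinearOrder α] (S : Finset α) (z : ℂ) :
    ∑ j ∈ S, z ^ (S.filter fun k => j < k).card = ∑ m ∈ Finset.range S.card, z ^ m := by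
  induction S using Finset.induction_on_min with
  | empty => simp
  | insert a S ha ih =>
    have hn : a ∉ S := fun h => lt_irrefl _ (ha a h)
    rw [Finset.sum_insert hn, Finset.card_insert_of_notMem hn, Finset.sum_range_succ, ← ih, add_comm]
    congr 1
    · refine Finset.sum_congr rfl fun j hj => ?_
      rw [Finset.filter_insert, if_neg (ha j hj).not_gt]
    · rw [Finset.filter_insert, if_neg (lt_irrefl a), Finset.filter_true_of_mem ha]

theorem qPar_ne_zero (η : ℂ) : qPar η ≠ 0 := Complex.exp_ne_zero η

theorem qPar_sub_inv (η : ℂ) : qPar η - (qPar η)⁻¹ = 2 * Complex.sinh η := by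
  rw [qPar, ← Complex.exp_neg, Complex.sinh]; ring

theorem qInt_eq (η : ℂ) (n : ℕ) : qInt η n = Complex.sinh (n * η) / Complex.sinh η := by
  have : qPar η ^ n - (qPar η)⁻¹ ^ n = 2 * Complex.sinh (n * η) := by
    rw [Complex.sinh, qPar, ← Complex.exp_neg, ← Complex.exp_nat_mul, ← Complex.exp_nat_mul,
      mul_neg]
    ring
  rw [qInt, this, qPar_sub_inv, mul_div_mul_left _ _ two_ne_zero]

theorem sum_range_pow_eq_qInt {η : ℂ} (hη : Complex.sinh η ≠ 0) (n : ℕ) :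
    ∑ m ∈ Finset.range (n + 1), (qPar η ^ 2) ^ m = qPar η ^ n * qInt η (n + 1) := by
  have hq := qPar_ne_zero η
  have hs : qPar η - (qPar η)⁻¹ ≠ 0 := by
    rw [qPar_sub_inv]; exact mul_ne_zero two_ne_zero hη
  have h2 : qPar η ^ 2 - 1 ≠ 0 := by
    have : qPar η ^ 2 - 1 = qPar η * (qPar η - (qPar η)⁻¹) := by field_simp
    rw [this]; exact mul_ne_zero hq hs
  rw [geom_sum_eq (sub_ne_zero.1 h2), qInt, inv_pow]
  have : qPar η - (qPar η)⁻¹ = (qPar η ^ 2 - 1) / qPar η := by field_simp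
  rw [this]
  field_simp
  ring

theorem qFact_ne_zero {η : ℂ} (hη : ∀ n : ℕ, 1 ≤ n → n ≤ ℓ → Complex.sinh (n * η) ≠ 0) {n : ℕ}
    (hn : n ≤ ℓ) : qFact η n ≠ 0 := by
  rw [qFact, Finset.prod_ne_zero_iff]
  intro k hk
  rw [Finset.mem_range] at hk
  rw [qInt_eq]
  refine div_ne_zero (hη _ (by omega) (by omega)) ?_
  simpa using hη 1 le_rfl (by omega)

/-- The exponent of `q` in the components of `‖ℓ, n⟩`. -/
def ketExp (ℓ n : ℕ) (s : Config ℓ) : ℂ := onesSum s - n * ℓ + n * (n - 1) / 2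

/-- In the step from `n` to `n + 1` the last created one may be any of the ones of `s`. Its position
completes `onesSum s`, and what still depends on the choice is `q²` to the number of ones on its
right. The sum is geometric and equals `q^n [n+1]_q`, the factor that extends the `q`-factorial. -/
theorem lowering_pow_mulVec {η : ℂ} (hη : ∀ n : ℕ, 1 ≤ n → n ≤ ℓ → Complex.sinh (n * η) ≠ 0)
    {n : ℕ} (hn : n ≤ ℓ) (s : Config ℓ) :
    (lowering η ℓ ^ n).mulVec (vacuum ℓ) s =
      if ones s = n then qFact η n * Complex.exp (η * ketExp ℓ n s) else 0 := by
  induction n generalizing s with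
  | zero =>
    rw [pow_zero, Matrix.one_mulVec, vacuum, ones_eq_card]
    by_cases hs : s = fun _ => 0
    · subst hs; simp [qFact, ketExp, onesSum]
    · rw [Pi.single_eq_of_ne hs, if_neg]
      intro h
      refine hs (funext fun k => ?_)
      have := Finset.filter_eq_empty_iff.1 (Finset.card_eq_zero.1 h) (Finset.mem_univ k)
      omega
  | succ n ih =>
    have h1 : Complex.sinh η ≠ 0 := by simpa using hη 1 le_rfl (by omega)
    rw [pow_succ', ← Matrix.mulVec_mulVec, lowering_mulVec_apply]
    have hterm : ∀ j ∈ Finset.univ.filter (fun j => s j = 1),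
        Complex.exp (η * (2 * ((Finset.univ.filter fun k => s k = 1).filter fun k => j < k).card
          + (j + 1) - ℓ)) * (lowering η ℓ ^ n).mulVec (vacuum ℓ) (Function.update s j 0) =
        if ones s = n + 1 then
          qFact η n * Complex.exp (η * (onesSum s - (n + 1) * ℓ + n * (n - 1) / 2)) *
            (qPar η ^ 2) ^ ((Finset.univ.filter fun k => s k = 1).filter fun k => j < k).card
        else 0 := by
      intro j hj
      have hj' := (Finset.mem_filter.1 hj).2
      rw [ih (by omega)]
      have e1 := ones_update hj'
      have e2 : (onesSum s : ℂ) = onesSum (Function.update s j 0) + (j + 1) := by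
        rw [← onesSum_update hj']; push_cast; ring
      by_cases h : ones s = n + 1
      · rw [if_pos h, if_pos (by omega), ketExp, e2, qPar, ← pow_mul, ← Complex.exp_nat_mul,
          mul_left_comm, mul_assoc (qFact η n), ← Complex.exp_add, ← Complex.exp_add]
        congr 2
        push_cast
        ring
      · rw [if_neg h, if_neg (by omega), mul_zero]
    rw [Finset.sum_congr rfl hterm]
    split_ifs with h
    · rw [← Finset.mul_sum, sum_pow_card_filter_lt, ← ones_eq_card, h, sum_range_pow_eq_qInt h1,
        qFact, qFact, Finset.prod_range_succ, ketExp, qPar, ← Complex.exp_nat_mul]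
      have : η * (onesSum s - ((n + 1 : ℕ) : ℂ) * ℓ + ((n + 1 : ℕ) : ℂ) * (((n + 1 : ℕ) : ℂ) - 1) / 2)
          = η * (onesSum s - (n + 1) * ℓ + n * (n - 1) / 2) + n * η := by
        push_cast; ring
      rw [this, Complex.exp_add]
      ring
    · simp

theorem ket_apply {η : ℂ} (hη : ∀ n : ℕ, 1 ≤ n → n ≤ ℓ → Complex.sinh (n * η) ≠ 0)
    {n : ℕ} (hn : n ≤ ℓ) (s : Config ℓ) :
    ket η ℓ n s = if ones s = n then Complex.exp (η * ketExp ℓ n s) else 0 := by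
  have h := lowering_pow_mulVec hη hn s
  rw [ket, Pi.smul_apply, smul_eq_mul]
  rw [vacuum] at h
  rw [h]
  split_ifs
  · rw [inv_mul_cancel_left₀ (qFact_ne_zero hη hn)]
  · simp

/-- The generating function of the sums of the positions of `n` ones. -/
def gaussSum (q : ℂ) (ℓ n : ℕ) : ℂ :=
  ∑ s : Config ℓ, if ones s = n then q ^ (2 * onesSum s) else 0

theorem ones_cons (a : Fin 2) (s : Config ℓ) :
    ones (Fin.cons a s : Config (ℓ + 1)) = (if a = 1 then 1 else 0) + ones s := by
  rw [ones, Fin.sum_univ_succ, ones]; simp only [Fin.cons_zero, Fin.cons_succ]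

/-- A new first site shifts every other position by one, whence the term `ones s`. -/
theorem onesSum_cons (a : Fin 2) (s : Config ℓ) :
    onesSum (Fin.cons a s : Config (ℓ + 1)) = (if a = 1 then 1 else 0) + onesSum s + ones s := by
  rw [onesSum, Fin.sum_univ_succ, onesSum, ones, add_assoc, ← Finset.sum_add_distrib]
  simp only [Fin.cons_zero, Fin.cons_succ, Fin.val_zero, Fin.val_succ, zero_add]
  congr 1
  refine Finset.sum_congr rfl fun β _ => ?_
  split_ifs <;> rfl

theorem gaussSum_succ (q : ℂ) (ℓ n : ℕ) :
    gaussSum q (ℓ + 1) n = ∑ a : Fin 2, ∑ s : Config ℓ,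
      if (if a = 1 then 1 else 0) + ones s = n then
        q ^ (2 * ((if a = 1 then 1 else 0) + onesSum s + ones s)) else 0 := by
  rw [gaussSum, ← Fintype.sum_prod_type',
    ← (Fin.consEquiv fun _ : Fin (ℓ + 1) => Fin 2).sum_comp]
  refine Finset.sum_congr rfl fun p _ => ?_
  change (if ones (Fin.cons p.1 p.2 : Config (ℓ + 1)) = n then
    q ^ (2 * onesSum (Fin.cons p.1 p.2 : Config (ℓ + 1))) else 0) = _
  rw [ones_cons, onesSum_cons]

theorem gaussSum_succ_zero (q : ℂ) (ℓ : ℕ) : gaussSum q (ℓ + 1) 0 = gaussSum q ℓ 0 := by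
  rw [gaussSum_succ, Fin.sum_univ_two, gaussSum]
  simp only [zero_ne_one, if_false, if_true, zero_add]
  rw [Finset.sum_eq_zero (s := Finset.univ) (f := fun s : Config ℓ =>
    if 1 + ones s = 0 then q ^ (2 * (1 + onesSum s + ones s)) else 0)
    (fun s _ => if_neg (by omega)), add_zero]
  refine Finset.sum_congr rfl fun s _ => ?_
  split_ifs with h
  · rw [h, add_zero]
  · rfl

theorem gaussSum_succ_succ (q : ℂ) (ℓ n : ℕ) : gaussSum q (ℓ + 1) (n + 1) =
    q ^ (2 * (n + 1)) * (gaussSum q ℓ (n + 1) + gaussSum q ℓ n) := by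
  rw [gaussSum_succ, Fin.sum_univ_two, gaussSum, gaussSum, mul_add, Finset.mul_sum, Finset.mul_sum]
  simp only [zero_ne_one, if_false, if_true, zero_add]
  congr 1
  · refine Finset.sum_congr rfl fun s _ => ?_
    split_ifs with h
    · rw [h, ← pow_add]; congr 1; ring
    · simp
  · refine Finset.sum_congr rfl fun s _ => ?_
    by_cases h : ones s = n
    · rw [if_pos (by omega), if_pos h, h, ← pow_add]; congr 1; ring
    · rw [if_neg (by omega), if_neg h, mul_zero]

theorem gaussSum_of_lt (q : ℂ) {ℓ n : ℕ} (h : ℓ < n) : gaussSum q ℓ n = 0 :=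
  Finset.sum_eq_zero fun s _ => if_neg (by have := ones_le s; omega)

theorem qFact_succ (η : ℂ) (n : ℕ) : qFact η (n + 1) = qFact η n * qInt η (n + 1) := by
  rw [qFact, Finset.prod_range_succ, qFact]

/-- The sum over `n`-subsets of `q` to twice the sum of their elements is a `q`-binomial coefficient
times a power of `q`. Splitting off the first site gives the `q`-Pascal recursion, which `key`
verifies. Without division the identity holds for every `η`. -/
theorem qFact_mul_gaussSum (η : ℂ) (n m : ℕ) :
    qFact η n * qFact η m * gaussSum (qPar η) (n + m) n =
      qFact η (n + m) * qPar η ^ (n * (n + m + 1)) := by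
  have hq := qPar_ne_zero η
  suffices H : ∀ L n m, n + m = L → qFact η n * qFact η m * gaussSum (qPar η) L n =
      qFact η L * qPar η ^ (n * (L + 1)) from H _ n m rfl
  intro L
  induction L with
  | zero =>
    intro n m h
    obtain ⟨rfl, rfl⟩ : n = 0 ∧ m = 0 := by omega
    simp [gaussSum, ones, onesSum, qFact]
  | succ L ih =>
    rintro (_ | n) m h
    · obtain rfl : m = L + 1 := by omega
      have h0 := ih 0 L (by omega)
      rw [gaussSum_succ_zero, qFact_succ]
      simp only [zero_mul, pow_zero, mul_one] at h0 ⊢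
      linear_combination qInt η (L + 1) * h0
    · rw [gaussSum_succ_succ]
      rcases m with _ | m
      · obtain rfl : n = L := by omega
        have h0 := ih n 0 (by omega)
        rw [gaussSum_of_lt _ (Nat.lt_succ_self n), zero_add, qFact_succ]
        have e : qPar η ^ ((n + 1) * (n + 1 + 1)) =
            qPar η ^ (2 * (n + 1)) * qPar η ^ (n * (n + 1)) := by rw [← pow_add]; congr 1; ring
        rw [e]
        linear_combination qInt η (n + 1) * qPar η ^ (2 * (n + 1)) * h0
      · obtain rfl : L = n + m + 1 := by omega
        have h1 := ih (n + 1) m (by omega)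
        have h2 := ih n (m + 1) (by omega)
        have key : qPar η ^ (2 * (n + 1)) * (qInt η (m + 1) * qPar η ^ ((n + 1) * (n + m + 1 + 1)) +
            qInt η (n + 1) * qPar η ^ (n * (n + m + 1 + 1))) =
            qInt η (n + m + 1 + 1) * qPar η ^ ((n + 1) * (n + m + 1 + 1 + 1)) := by
          have e : qPar η ^ ((n + 1) * (n + m + 1 + 1 + 1)) = qPar η ^ (2 * (n + 1)) *
              qPar η ^ (n * (n + m + 1 + 1)) * qPar η ^ (m + 1) := by
            rw [← pow_add, ← pow_add]; congr 1; ring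
          have e' : qPar η ^ ((n + 1) * (n + m + 1 + 1)) =
              qPar η ^ (n * (n + m + 1 + 1)) * (qPar η ^ (n + 1) * qPar η ^ (m + 1)) := by
            rw [← pow_add, ← pow_add]; congr 1; ring
          have e2 : n + m + 1 + 1 = (n + 1) + (m + 1) := by ring
          rw [e, e', qInt, qInt, qInt, e2, pow_add _ (n + 1) (m + 1), pow_add _ (n + 1) (m + 1),
            inv_pow, inv_pow]
          field_simp
          ring
        have hm : qFact η (m + 1) = qFact η m * qInt η (m + 1) := qFact_succ η m
        have hn : qFact η (n + 1) = qFact η n * qInt η (n + 1) := qFact_succ η n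
        rw [qFact_succ η (n + m + 1), mul_assoc (qFact η (n + m + 1)), ← key]
        linear_combination (qInt η (m + 1) * qPar η ^ (2 * (n + 1))) * h1 +
          (qInt η (n + 1) * qPar η ^ (2 * (n + 1))) * h2 +
          (qFact η (n + 1) * qPar η ^ (2 * (n + 1)) * gaussSum (qPar η) (n + m + 1) (n + 1)) * hm +
          (qFact η (m + 1) * qPar η ^ (2 * (n + 1)) * gaussSum (qPar η) (n + m + 1) n) * hn

theorem sqLength_eq {η : ℂ} (hη : ∀ n : ℕ, 1 ≤ n → n ≤ ℓ → Complex.sinh (n * η) ≠ 0)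
    {n : ℕ} (hn : n ≤ ℓ) :
    sqLength η ℓ n = qBinom η ℓ n * Complex.exp (-η * (n * (ℓ - n))) := by
  have h1 : sqLength η ℓ n =
      Complex.exp (2 * η * (- (n * ℓ) + n * (n - 1) / 2)) * gaussSum (qPar η) ℓ n := by
    rw [sqLength, dotProduct, gaussSum, Finset.mul_sum]
    refine Finset.sum_congr rfl fun s _ => ?_
    rw [ket_apply hη hn]
    split_ifs
    · rw [← Complex.exp_add, qPar, ← Complex.exp_nat_mul, ← Complex.exp_add, ketExp]
      congr 1; push_cast; ring
    · simp
  obtain ⟨m, rfl⟩ := Nat.exists_eq_add_of_le hn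
  have h2 := qFact_mul_gaussSum η n m
  have hn' := qFact_ne_zero hη hn
  have hm' := qFact_ne_zero hη (Nat.le_add_left m n)
  rw [h1, qBinom, Nat.add_sub_cancel_left, div_mul_eq_mul_div, eq_div_iff (mul_ne_zero hm' hn')]
  have h3 : Complex.exp (-η * (n * ((n + m : ℕ) - n))) =
      Complex.exp (2 * η * (- (n * (n + m : ℕ)) + n * (n - 1) / 2)) *
        qPar η ^ (n * (n + m + 1)) := by
    rw [qPar, ← Complex.exp_nat_mul, ← Complex.exp_add]; congr 1; push_cast; ring
  rw [h3]
  linear_combination Complex.exp (2 * η * (- (n * (n + m : ℕ)) + n * (n - 1) / 2)) * h2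

theorem qBinom_ne_zero {η : ℂ} (hη : ∀ n : ℕ, 1 ≤ n → n ≤ ℓ → Complex.sinh (n * η) ≠ 0)
    {n : ℕ} (hn : n ≤ ℓ) : qBinom η ℓ n ≠ 0 :=
  div_ne_zero (qFact_ne_zero hη le_rfl)
    (mul_ne_zero (qFact_ne_zero hη (Nat.sub_le _ _)) (qFact_ne_zero hη hn))

theorem sqLength_ne_zero {η : ℂ} (hη : ∀ n : ℕ, 1 ≤ n → n ≤ ℓ → Complex.sinh (n * η) ≠ 0)
    {n : ℕ} (hn : n ≤ ℓ) : sqLength η ℓ n ≠ 0 := by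
  rw [sqLength_eq hη hn]
  exact mul_ne_zero (qBinom_ne_zero hη hn) (Complex.exp_ne_zero _)

end Kets

/-! ### Rows that are symmetric in the sites of each block -/

section Swap

variable {L : ℕ}

/-- A row vector is invariant under the exchange of two sites. -/
def SwapInvariant (j j' : Fin L) (v : Config L → ℂ) : Prop :=
  ∀ s, v (s ∘ Equiv.swap j j') = v s

theorem swapInvariant_vecMul_siteOp {j j' k : Fin L} (hk : k ≠ j) (hk' : k ≠ j')
    (x : Matrix (Fin 2) (Fin 2) ℂ) {v : Config L → ℂ} (hv : SwapInvariant j j' v) :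
    SwapInvariant j j' (Matrix.vecMul v (siteOp k x)) := by
  intro s
  rw [vecMul_siteOp_apply, vecMul_siteOp_apply]
  refine Finset.sum_congr rfl fun a _ => ?_
  have h := hv (Function.update s k a)
  rw [Function.update_comp_equiv, Equiv.symm_swap, Equiv.swap_apply_of_ne_of_ne hk hk'] at h
  rw [h, Function.comp_apply, Equiv.swap_apply_of_ne_of_ne hk hk']

theorem swapInvariant_vecMul_siteMonodromy {j j' : Fin L} (η : ℂ) (w : Grading) (ws : Fin L → ℂ)
    (x : ℂ) {l : List (Fin L)} (hj : j ∉ l) (hj' : j' ∉ l) (a c : Fin 2) {v : Config L → ℂ}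
    (hv : SwapInvariant j j' v) :
    SwapInvariant j j' (Matrix.vecMul v (siteMonodromy η w ws x l a c)) := by
  induction l generalizing a c v with
  | nil =>
    by_cases h : a = c
    · simpa [h] using hv
    · intro s; simp [h]
  | cons k l ih =>
    rw [List.mem_cons, not_or] at hj hj'
    rw [siteMonodromy_cons, Matrix.mul_apply]
    simp only [Matrix.vecMul_sum, ← Matrix.vecMul_vecMul]
    intro s
    rw [Finset.sum_apply, Finset.sum_apply]
    exact Finset.sum_congr rfl fun b _ =>
      swapInvariant_vecMul_siteOp (Ne.symm hj.1) (Ne.symm hj'.1) _ (ih hj.2 hj'.2 a b hv) s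

/-- This is the basic fusion identity. At argument `-η` the six-vertex matrix is a multiple of `1 -
P`, with `P` the permutation, so by Yang–Baxter the product of two `R`-matrices at `u + η` and `u`
preserves the rows annihilated by `1 - P`. Here it is checked entry by entry. -/
theorem sum_symm_rMatrix {η u : ℂ} (h1 : Complex.sinh (u + η) ≠ 0)
    (h2 : Complex.sinh (u + η + η) ≠ 0) (f : Fin 2 → Fin 2 → ℂ) (hf : ∀ x y, f x y = f y x)
    (a c p q : Fin 2) :
    ∑ b, ∑ x, ∑ y, f x y * rMatrix η .principal (u + η) (a, y) (b, p) *
        rMatrix η .principal u (b, x) (c, q) =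
      ∑ b, ∑ x, ∑ y, f x y * rMatrix η .principal (u + η) (a, y) (b, q) *
        rMatrix η .principal u (b, x) (c, p) := by
  rw [rMatrix_principal h1, rMatrix_principal h2]
  have hf' := hf 0 1
  have e1 := Complex.cosh_sq u
  have e2 := Complex.cosh_sq η
  simp only [Matrix.smul_apply, smul_eq_mul, Fin.sum_univ_two]
  fin_cases a <;> fin_cases c <;> fin_cases p <;> fin_cases q <;> simp [sixVertex, hf']
  all_goals
    try field_simp
    try simp only [Complex.sinh_add, Complex.cosh_add]
    try grind

/-- Two neighbouring sites whose inhomogeneities differ by `η`: symmetric rows are mapped to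
symmetric rows. -/
theorem swapInvariant_vecMul_pair {η : ℂ} {ws : Fin L → ℂ} {x : ℂ} {j j' : Fin L} (hjj : j ≠ j')
    (hw : ws j' = ws j - η) (h1 : Complex.sinh (x - ws j + η) ≠ 0)
    (h2 : Complex.sinh (x - ws j' + η) ≠ 0) (a c : Fin 2) {v : Config L → ℂ}
    (hv : SwapInvariant j j' v) :
    SwapInvariant j j' (Matrix.vecMul v (siteMonodromy η .principal ws x [j, j'] a c)) := by
  have hx : x - ws j' = x - ws j + η := by rw [hw]; ring
  have key : ∀ s : Config L,
      Matrix.vecMul v (siteMonodromy η .principal ws x [j, j'] a c) s =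
      ∑ b, ∑ y, ∑ z, v (Function.update (Function.update s j y) j' z) *
        rMatrix η .principal (x - ws j + η) (a, z) (b, s j') *
        rMatrix η .principal (x - ws j) (b, y) (c, s j) := by
    intro s
    rw [siteMonodromy_cons, siteMonodromy_singleton, Matrix.mul_apply, Matrix.vecMul_sum,
      Finset.sum_apply]
    refine Finset.sum_congr rfl fun b _ => ?_
    rw [← Matrix.vecMul_vecMul, rAux, rAux, Matrix.of_apply, Matrix.of_apply, vecMul_siteOp_apply]
    refine Finset.sum_congr rfl fun y _ => ?_
    rw [vecMul_siteOp_apply, Finset.sum_mul]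
    refine Finset.sum_congr rfl fun z _ => ?_
    rw [Function.update_of_ne hjj.symm, Matrix.of_apply, Matrix.of_apply, hx]
  intro s
  have hover : ∀ y z, Function.update (Function.update (s ∘ Equiv.swap j j') j y) j' z =
      Function.update (Function.update s j y) j' z := by
    intro y z
    ext k
    by_cases hk' : k = j'
    · subst hk'; simp
    · rw [Function.update_of_ne hk', Function.update_of_ne hk']
      by_cases hk : k = j
      · subst hk; simp
      · rw [Function.update_of_ne hk, Function.update_of_ne hk, Function.comp_apply,
          Equiv.swap_apply_of_ne_of_ne hk hk']
  rw [key, key]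
  simp only [hover, Function.comp_apply, Equiv.swap_apply_left, Equiv.swap_apply_right]
  refine sum_symm_rMatrix h1 (hx ▸ h2)
    (fun y z => v (Function.update (Function.update s j y) j' z)) ?_ a c _ _
  intro y z
  have h := hv (Function.update (Function.update s j y) j' z)
  rw [Function.update_comp_equiv, Function.update_comp_equiv, Equiv.symm_swap,
    Equiv.swap_apply_left, Equiv.swap_apply_right, Function.update_comm hjj.symm, hover] at h
  exact h.symm

theorem finRange_eq_append {j j' : Fin L} (h : (j : ℕ) + 1 = j') :
    ∃ l l', List.finRange L = l ++ ([j, j'] ++ l') := by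
  refine ⟨(List.finRange L).take j, (List.finRange L).drop (j + 2), ?_⟩
  conv_lhs => rw [← List.take_append_drop (j : ℕ) (List.finRange L)]
  congr 1
  have hj : (j : ℕ) < (List.finRange L).length := by simp
  have hj' : (j : ℕ) + 1 < (List.finRange L).length := by rw [h]; simp
  rw [List.drop_eq_getElem_cons hj, List.drop_eq_getElem_cons hj']
  have e1 : (List.finRange L)[(j : ℕ)] = j := by ext; simp
  have e2 : (List.finRange L)[(j : ℕ) + 1] = j' := by ext; simp [h]
  rw [e1, e2]
  rfl

/-- The monodromy factors into the sites before the pair, the pair, and the sites after it; the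
outer factors act away from both sites and so respect the exchange trivially. -/
theorem swapInvariant_vecMul_monodromy {η : ℂ} {ws : Fin L → ℂ} {x : ℂ} {j j' : Fin L}
    (hjj : (j : ℕ) + 1 = j') (hw : ws j' = ws j - η)
    (hx : ∀ k, Complex.sinh (x - ws k + η) ≠ 0) (a c : Fin 2) {v : Config L → ℂ}
    (hv : SwapInvariant j j' v) :
    SwapInvariant j j' (Matrix.vecMul v (monodromy η .principal ws x a c)) := by
  obtain ⟨l, l', hl⟩ := finRange_eq_append hjj
  have hnd := hl ▸ List.nodup_finRange L
  have hne : j ≠ j' := by rintro rfl; omega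
  have h1 : j ∉ l ∧ j' ∉ l ∧ j ∉ l' ∧ j' ∉ l' := by
    simp only [List.nodup_append, List.mem_append, List.mem_cons, List.not_mem_nil,
      List.nodup_cons] at hnd
    grind
  rw [monodromy_eq, hl, siteMonodromy_append, siteMonodromy_append]
  simp only [Matrix.mul_apply, Matrix.vecMul_sum, ← Matrix.vecMul_vecMul, Finset.sum_mul]
  intro s
  simp only [Finset.sum_apply]
  exact Finset.sum_congr rfl fun b _ => Finset.sum_congr rfl fun d _ =>
    swapInvariant_vecMul_siteMonodromy _ _ _ _ h1.1 h1.2.1 _ _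
      (swapInvariant_vecMul_pair hne hw (hx _) (hx _) _ _
        (swapInvariant_vecMul_siteMonodromy _ _ _ _ h1.2.2.1 h1.2.2.2 _ _ hv)) s

end Swap

/-! ### From exchanges of neighbouring sites to symmetry within blocks. -/

section Blocks

variable {Ns ℓ : ℕ}

/-- The restriction of a configuration to a block. -/
def blockConf (s : Config (Ns * ℓ)) (b : Fin Ns) : Config ℓ := fun β => s (site b β)

/-- The configuration `s`, replaced by `a` in the block `b`. -/
def setBlock (s : Config (Ns * ℓ)) (b : Fin Ns) (a : Config ℓ) : Config (Ns * ℓ) := fun j =>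
  if (finProdFinEquiv.symm j).1 = b then a (finProdFinEquiv.symm j).2 else s j

theorem config_ext {s t : Config (Ns * ℓ)} (h : ∀ b, blockConf s b = blockConf t b) : s = t := by
  ext1 j
  have := congrFun (h (finProdFinEquiv.symm j).1) (finProdFinEquiv.symm j).2
  simpa only [blockConf, site, Prod.mk.eta, Equiv.apply_symm_apply] using this

theorem setBlock_site (s : Config (Ns * ℓ)) (b : Fin Ns) (a : Config ℓ) (c : Fin Ns) (β : Fin ℓ) :
    setBlock s b a (site c β) = if c = b then a β else s (site c β) := by
  simp only [setBlock, symm_site]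

theorem blockConf_setBlock (s : Config (Ns * ℓ)) (b : Fin Ns) (a : Config ℓ) (c : Fin Ns) :
    blockConf (setBlock s b a) c = if c = b then a else blockConf s c := by
  ext1 β
  rw [blockConf, setBlock_site]
  split_ifs <;> rfl

@[simp] theorem blockConf_setBlock_self (s : Config (Ns * ℓ)) (b : Fin Ns) (a : Config ℓ) :
    blockConf (setBlock s b a) b = a := by
  rw [blockConf_setBlock, if_pos rfl]

@[simp] theorem setBlock_blockConf (s : Config (Ns * ℓ)) (b : Fin Ns) :
    setBlock s b (blockConf s b) = s := by
  refine config_ext fun c => ?_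
  rw [blockConf_setBlock]
  split_ifs with h
  · rw [h]
  · rfl

theorem setBlock_injective (s : Config (Ns * ℓ)) (b : Fin Ns) :
    Function.Injective (setBlock s b) := by
  intro a a' h
  rw [← blockConf_setBlock_self s b a, h, blockConf_setBlock_self]

theorem vecMul_blockOp_apply (v : Config (Ns * ℓ) → ℂ) (b : Fin Ns) (X : Op ℓ)
    (t : Config (Ns * ℓ)) :
    Matrix.vecMul v (blockOp b X) t = ∑ a, v (setBlock t b a) * X a (blockConf t b) := by
  rw [Matrix.vecMul, dotProduct]
  symm
  refine Fintype.sum_of_injective (setBlock t b) (setBlock_injective t b) _ _ ?_ ?_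
  · intro u hu
    rw [blockOp, Matrix.of_apply, if_neg, mul_zero]
    intro h
    refine hu ⟨blockConf u b, config_ext fun c => ?_⟩
    rw [blockConf_setBlock]
    split_ifs with hc
    · rw [hc]
    · ext1 β; exact (h c hc β).symm
  · intro a
    rw [blockOp, Matrix.of_apply, if_pos]
    · simp only [setBlock_site, if_true]; rfl
    · intro c hc β; rw [setBlock_site, if_neg hc]

theorem blockOp_mulVec_apply (v : Config (Ns * ℓ) → ℂ) (b : Fin Ns) (X : Op ℓ)
    (s : Config (Ns * ℓ)) :
    (blockOp b X).mulVec v s = ∑ a, X (blockConf s b) a * v (setBlock s b a) := by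
  rw [Matrix.mulVec, dotProduct]
  symm
  refine Fintype.sum_of_injective (setBlock s b) (setBlock_injective s b) _ _ ?_ ?_
  · intro u hu
    rw [blockOp, Matrix.of_apply, if_neg, zero_mul]
    intro h
    refine hu ⟨blockConf u b, config_ext fun c => ?_⟩
    rw [blockConf_setBlock]
    split_ifs with hc
    · rw [hc]
    · ext1 β; exact h c hc β
  · intro a
    rw [blockOp, Matrix.of_apply, if_pos]
    · simp only [setBlock_site, if_true]; rfl
    · intro c hc β; rw [setBlock_site, if_neg hc]

/-- A row vector whose components depend only on the numbers of ones in the blocks. -/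
def BlockSymmetric (v : Config (Ns * ℓ) → ℂ) : Prop :=
  ∀ s t, (∀ b, ones (blockConf s b) = ones (blockConf t b)) → v s = v t

theorem ones_comp_equiv (s : Config ℓ) (σ : Equiv.Perm (Fin ℓ)) : ones (s ∘ σ) = ones s :=
  Equiv.sum_comp σ fun β => if s β = 1 then 1 else 0

theorem exists_perm_of_ones_eq {s t : Config ℓ} (h : ones s = ones t) :
    ∃ σ : Equiv.Perm (Fin ℓ), t = s ∘ σ := by
  rw [ones_eq_card, ones_eq_card, ← Fintype.card_subtype, ← Fintype.card_subtype] at h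
  let e := Fintype.equivOfCardEq h.symm
  refine ⟨e.extendSubtype, funext fun β => ?_⟩
  by_cases hβ : t β = 1
  · have := e.extendSubtype_mem β hβ
    rw [Function.comp_apply, hβ, this]
  · have := e.extendSubtype_not_mem β hβ
    rw [Function.comp_apply]
    omega

theorem setBlock_comp_swap (s : Config (Ns * ℓ)) (b : Fin Ns) (a : Config ℓ) (β β' : Fin ℓ) :
    setBlock s b a ∘ Equiv.swap (site b β) (site b β') = setBlock s b (a ∘ Equiv.swap β β') := by
  have hinj : ∀ (c d : Fin Ns) (γ δ : Fin ℓ), site c γ = site d δ ↔ c = d ∧ γ = δ := by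
    intro c d γ δ
    rw [site, site, finProdFinEquiv.injective.eq_iff, Prod.mk.injEq]
  refine config_ext fun c => funext fun γ => ?_
  simp only [blockConf, Function.comp_apply, setBlock_site]
  by_cases hc : c = b
  · subst hc
    rw [if_pos rfl]
    rcases eq_or_ne γ β with rfl | h1
    · simp [setBlock_site]
    · rcases eq_or_ne γ β' with rfl | h2
      · simp [setBlock_site]
      · rw [Equiv.swap_apply_of_ne_of_ne (by simp [hinj, h1]) (by simp [hinj, h2]),
          Equiv.swap_apply_of_ne_of_ne h1 h2, setBlock_site, if_pos rfl]
  · rw [if_neg hc, Equiv.swap_apply_of_ne_of_ne (by simp [hinj, hc]) (by simp [hinj, hc]),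
      setBlock_site, if_neg hc]

theorem BlockSymmetric.swapInvariant {v : Config (Ns * ℓ) → ℂ} (hv : BlockSymmetric v) (b : Fin Ns)
    (β β' : Fin ℓ) : SwapInvariant (site b β) (site b β') v := by
  intro s
  refine hv _ _ fun c => ?_
  have h := setBlock_comp_swap s b (blockConf s b) β β'
  rw [setBlock_blockConf] at h
  rw [h, blockConf_setBlock]
  split_ifs with hc
  · rw [ones_comp_equiv, hc]
  · rfl

/-- Adjacent transpositions generate all permutations of a block, and configurations with equal
numbers of ones in a block differ by such a permutation. -/
theorem blockSymmetric_of_swapInvariant {v : Config (Ns * ℓ) → ℂ}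
    (h : ∀ (b : Fin Ns) (β β' : Fin ℓ), (β : ℕ) + 1 = β' →
      SwapInvariant (site b β) (site b β') v) : BlockSymmetric v := by
  have h1 : ∀ (b : Fin Ns) (σ : Equiv.Perm (Fin ℓ)) (s : Config (Ns * ℓ)) (a : Config ℓ),
      v (setBlock s b (a ∘ σ)) = v (setBlock s b a) := by
    intro b σ
    rcases ℓ with _ | n
    · intro s a
      congr 2
      exact Subsingleton.elim _ _
    · let G : Submonoid (Equiv.Perm (Fin (n + 1))) :=
        { carrier := {σ | ∀ (s : Config (Ns * (n + 1))) (a : Config (n + 1)),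
            v (setBlock s b (a ∘ σ)) = v (setBlock s b a)}
          one_mem' := fun s a => rfl
          mul_mem' := by
            intro σ τ hσ hτ s a
            rw [Equiv.Perm.coe_mul, ← Function.comp_assoc, hτ, hσ] }
      have hG : G = ⊤ := by
        rw [eq_top_iff, ← Equiv.Perm.mclosure_swap_castSucc_succ, Submonoid.closure_le]
        rintro _ ⟨i, rfl⟩ s a
        have := h b i.castSucc i.succ (by simp) (setBlock s b a)
        rwa [setBlock_comp_swap] at this
      have : σ ∈ G := hG ▸ Submonoid.mem_top σ
      exact this
  intro s t hst
  -- The configuration `s` is changed into `t` one block at a time; `S` is the set of blocks already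
  -- replaced.
  have h2 : ∀ S : Finset (Fin Ns),
      v (fun j => if (finProdFinEquiv.symm j).1 ∈ S then t j else s j) = v s := by
    intro S
    induction S using Finset.induction_on with
    | empty => simp
    | insert b S hb ih =>
      rw [← ih]
      obtain ⟨σ, hσ⟩ := exists_perm_of_ones_eq (hst b)
      set u : Config (Ns * ℓ) := fun j => if (finProdFinEquiv.symm j).1 ∈ S then t j else s j
      have e1 : u = setBlock u b (blockConf s b) := by
        refine config_ext fun c => ?_
        rw [blockConf_setBlock]
        split_ifs with hc
        · subst hc
          ext1 β
          simp [-finProdFinEquiv_symm_apply, u, blockConf, hb]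
        · rfl
      have e2 : (fun j => if (finProdFinEquiv.symm j).1 ∈ insert b S then t j else s j) =
          setBlock u b (blockConf s b ∘ σ) := by
        rw [← hσ]
        refine config_ext fun c => ?_
        rw [blockConf_setBlock]
        ext1 β
        by_cases hc : c = b
        · simp [-finProdFinEquiv_symm_apply, blockConf, hc]
        · simp [-finProdFinEquiv_symm_apply, blockConf, hc, u]
      rw [e2, h1, ← e1]
  have := h2 Finset.univ
  simpa using this.symm

theorem completeStrings_site (η : ℂ) (ξ : Fin Ns → ℂ) (b : Fin Ns) (β : Fin ℓ) :
    completeStrings η ℓ ξ (site b β) = ξ b - (β : ℕ) * η := by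
  simp [-finProdFinEquiv_symm_apply, completeStrings, strings]

/-- For complete strings the principal monodromy matrix preserves the symmetric rows. -/
theorem BlockSymmetric.vecMul_monodromy {η : ℂ} {ξ : Fin Ns → ℂ} {x : ℂ}
    (hx : ∀ j, Complex.sinh (x - completeStrings η ℓ ξ j + η) ≠ 0) (a c : Fin 2)
    {v : Config (Ns * ℓ) → ℂ} (hv : BlockSymmetric v) :
    BlockSymmetric (Matrix.vecMul v (monodromy η .principal (completeStrings η ℓ ξ) x a c)) := by
  refine blockSymmetric_of_swapInvariant fun b β β' h => ?_
  refine swapInvariant_vecMul_monodromy ?_ ?_ hx a c (hv.swapInvariant b β β')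
  · simp [site]; omega
  · rw [completeStrings_site, completeStrings_site, ← h]; push_cast; ring

end Blocks

/-! ### Conjugation by diagonal matrices -/

section Conj

variable {L : ℕ}

/-- The conjugate of an operator by a diagonal matrix. -/
def diagConj (y : Config L → ℂ) (A : Op L) : Op L :=
  Matrix.diagonal y * A * Matrix.diagonal y⁻¹

theorem diagConj_apply (y : Config L → ℂ) (A : Op L) (s t : Config L) :
    diagConj y A s t = y s * A s t * (y t)⁻¹ := by
  rw [diagConj, Matrix.mul_diagonal, Matrix.diagonal_mul, Pi.inv_apply]

theorem diagonal_inv_mul_diagonal {y : Config L → ℂ} (hy : ∀ s, y s ≠ 0) :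
    Matrix.diagonal y⁻¹ * Matrix.diagonal y = 1 := by
  rw [Matrix.diagonal_mul_diagonal, ← Matrix.diagonal_one]
  congr 1; ext s; simp [hy]

theorem diagConj_mul {y : Config L → ℂ} (hy : ∀ s, y s ≠ 0) (A B : Op L) :
    diagConj y (A * B) = diagConj y A * diagConj y B := by
  have h := diagonal_inv_mul_diagonal hy
  calc diagConj y (A * B) = Matrix.diagonal y * A * 1 * B * Matrix.diagonal y⁻¹ := by
        rw [diagConj, mul_one, mul_assoc _ A B]
    _ = _ := by rw [← h, diagConj, diagConj]; simp only [mul_assoc]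

theorem diagConj_smul (y : Config L → ℂ) (c : ℂ) (A : Op L) :
    diagConj y (c • A) = c • diagConj y A := by
  simp [diagConj]

theorem diagConj_diagConj (y z : Config L → ℂ) (A : Op L) :
    diagConj y (diagConj z A) = diagConj (y * z) A := by
  ext s t; simp only [diagConj_apply, Pi.mul_apply, mul_inv]; ring

theorem vacExp_diagConj {y : Config L → ℂ} (hy : ∀ s, y s ≠ 0) (A : Op L) :
    vacExp (diagConj y A) = vacExp A := by
  rw [vacExp, diagConj_apply, vacExp]
  field_simp [hy]

theorem prod_ofFn_smul_diagConj {y : Config L → ℂ} (hy : ∀ s, y s ≠ 0) {n : ℕ} (c : Fin n → ℂ)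
    (A : Fin n → Op L) : (List.ofFn fun k => c k • diagConj y (A k)).prod =
      (∏ k, c k) • diagConj y (List.ofFn A).prod := by
  induction n with
  | zero =>
    ext s t
    simp only [List.ofFn_zero, List.prod_nil, Finset.univ_eq_empty, Finset.prod_empty, one_smul,
      diagConj_apply]
    by_cases h : s = t
    · subst h; simp [hy]
    · simp [h]
  | succ n ih =>
    rw [List.ofFn_succ, List.prod_cons, ih, List.ofFn_succ, List.prod_cons, diagConj_mul hy,
      Fin.prod_univ_succ, smul_mul_smul_comm]

/-- The operator `A` preserves a class of row vectors, on which it acts like `A'`. -/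
def ActsAs (P : (Config L → ℂ) → Prop) (A A' : Op L) : Prop :=
  ∀ v, P v → P (Matrix.vecMul v A) ∧ Matrix.vecMul v A = Matrix.vecMul v A'

variable {P : (Config L → ℂ) → Prop}

/-- `ActsAs` includes that `v A` stays in the class, which is what permits replacing the next factor
too. Thus a product of operators is simplified factor by factor, from the left. -/
theorem ActsAs.mul {A A' B B' : Op L} (h : ActsAs P A A') (h' : ActsAs P B B') :
    ActsAs P (A * B) (A' * B') := by
  intro v hv
  obtain ⟨h1, h2⟩ := h v hv
  obtain ⟨h3, h4⟩ := h' _ h1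
  rw [← Matrix.vecMul_vecMul, ← Matrix.vecMul_vecMul, ← h2]
  exact ⟨h3, h4⟩

theorem ActsAs.one : ActsAs P 1 1 := fun v hv => ⟨by rwa [Matrix.vecMul_one], rfl⟩

theorem ActsAs.prod_ofFn {n : ℕ} {A A' : Fin n → Op L} (h : ∀ k, ActsAs P (A k) (A' k)) :
    ActsAs P (List.ofFn A).prod (List.ofFn A').prod := by
  induction n with
  | zero => simpa using ActsAs.one
  | succ n ih =>
    rw [List.ofFn_succ, List.ofFn_succ, List.prod_cons, List.prod_cons]
    exact (h 0).mul (ih fun k => h k.succ)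

theorem ActsAs.smul (hP : ∀ (c : ℂ) v, P v → P (c • v)) {A A' : Op L} (h : ActsAs P A A') (c : ℂ) :
    ActsAs P (c • A) (c • A') := by
  intro v hv
  obtain ⟨h1, h2⟩ := h v hv
  rw [Matrix.vecMul_smul, Matrix.vecMul_smul, h2]
  exact ⟨hP c _ (h2 ▸ h1), rfl⟩

theorem ActsAs.vacExp_eq {A A' : Op L} (h : ActsAs P A A') (hP : P (vacuum L)) :
    vacExp A = vacExp A' := by
  have := congrFun (h _ hP).2 fun _ => 0
  rwa [vacuum, Matrix.single_one_vecMul, Matrix.single_one_vecMul] at this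

end Conj

/-! ### Rows fixed by the projections, and gauge transformations acting on them. -/

section Gauge

variable {Ns ℓ : ℕ}

theorem BlockSymmetric.mul {f v : Config (Ns * ℓ) → ℂ} (hf : BlockSymmetric f)
    (hv : BlockSymmetric v) : BlockSymmetric (f * v) := by
  intro s t h
  rw [Pi.mul_apply, Pi.mul_apply, hf s t h, hv s t h]

theorem BlockSymmetric.smul (c : ℂ) (v : Config (Ns * ℓ) → ℂ) (hv : BlockSymmetric v) :
    BlockSymmetric (c • v) := by
  intro s t h
  rw [Pi.smul_apply, Pi.smul_apply, hv s t h]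

theorem blockSymmetric_vacuum : BlockSymmetric (vacuum (Ns * ℓ)) := by
  have key : ∀ s t : Config (Ns * ℓ), (∀ b, ones (blockConf s b) = ones (blockConf t b)) →
      s = (fun _ => 0) → t = fun _ => 0 := by
    rintro s t h rfl
    refine config_ext fun b => funext fun β => ?_
    have h1 := h b
    have h0 : ones (blockConf (fun _ => 0 : Config (Ns * ℓ)) b) = 0 := by
      simp [ones, blockConf]
    rw [h0, ones, eq_comm, Finset.sum_eq_zero_iff] at h1
    have := h1 β (Finset.mem_univ β)
    by_contra hne
    have h2 : blockConf t b β = 1 := by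
      have : blockConf t b β ≠ 0 := hne
      omega
    rw [if_pos h2] at this
    exact one_ne_zero this
  intro s t h
  rw [vacuum, Pi.single_apply, Pi.single_apply]
  exact if_congr ⟨key s t h, key t s fun b => (h b).symm⟩ rfl rfl

/-- The components of the symmetric row vector in a block of grading `+`, up to factors that depend
only on the number of ones. -/
def stringWeight (η : ℂ) (a : Config ℓ) : ℂ :=
  Complex.exp (η * (ones a * (ℓ + 1) / 2 - onesSum a))

/-- The product of the weights of all blocks. -/
def chainWeight (η : ℂ) (s : Config (Ns * ℓ)) : ℂ := ∏ b, stringWeight η (blockConf s b)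

theorem stringWeight_ne_zero (η : ℂ) (a : Config ℓ) : stringWeight η a ≠ 0 := Complex.exp_ne_zero _

theorem chainWeight_ne_zero (η : ℂ) (s : Config (Ns * ℓ)) : chainWeight η s ≠ 0 :=
  Finset.prod_ne_zero_iff.2 fun _ _ => stringWeight_ne_zero _ _

theorem chainWeight_setBlock (η : ℂ) (s : Config (Ns * ℓ)) (b : Fin Ns) (a : Config ℓ) :
    chainWeight η (setBlock s b a) * stringWeight η (blockConf s b) =
      chainWeight η s * stringWeight η a := by
  rw [chainWeight, chainWeight, ← Finset.mul_prod_erase _ _ (Finset.mem_univ b),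
    ← Finset.mul_prod_erase _ (fun c => stringWeight η (blockConf s c)) (Finset.mem_univ b),
    blockConf_setBlock_self]
  have : ∏ c ∈ Finset.univ.erase b, stringWeight η (blockConf (setBlock s b a) c) =
      ∏ c ∈ Finset.univ.erase b, stringWeight η (blockConf s c) :=
    Finset.prod_congr rfl fun c hc => by
      rw [blockConf_setBlock, if_neg (Finset.ne_of_mem_erase hc)]
  rw [this]; ring

/-- The row vectors in the image of the projections, in grading `+`. -/
def QSymmetric (η : ℂ) (v : Config (Ns * ℓ) → ℂ) : Prop := BlockSymmetric (v * chainWeight η)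

theorem QSymmetric.smul (η c : ℂ) (v : Config (Ns * ℓ) → ℂ) (hv : QSymmetric η v) :
    QSymmetric η (c • v) := by
  rw [QSymmetric, smul_mul_assoc]
  exact BlockSymmetric.smul c _ hv

theorem qSymmetric_vacuum (η : ℂ) : QSymmetric η (vacuum (Ns * ℓ)) := by
  have : vacuum (Ns * ℓ) * chainWeight η =
      chainWeight η (fun _ => 0 : Config (Ns * ℓ)) • vacuum (Ns * ℓ) := by
    ext s
    rw [Pi.mul_apply, Pi.smul_apply, vacuum, Pi.single_apply]
    split_ifs with h
    · simp [h]
    · simp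
  rw [QSymmetric, this]
  exact BlockSymmetric.smul _ _ blockSymmetric_vacuum

theorem vecMul_mul_eq_vecMul_diagConj {L : ℕ} {z : Config L → ℂ} (hz : ∀ s, z s ≠ 0) (A : Op L)
    (v : Config L → ℂ) :
    Matrix.vecMul v A * z = Matrix.vecMul (v * z) (diagConj z⁻¹ A) := by
  ext t
  simp only [Pi.mul_apply, Matrix.vecMul, dotProduct, Finset.sum_mul, diagConj_apply, Pi.inv_apply,
    inv_inv]
  refine Finset.sum_congr rfl fun s _ => ?_
  have := hz s
  field_simp

/-- Multiplication by `chainWeight η` identifies the rows of grading `+` with the blockwise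
symmetric ones and turns `A` into its conjugate, so invariance may be checked in principal grading.
-/
theorem actsAs_qSymmetric {η : ℂ} {A A' : Op (Ns * ℓ)}
    (h : ActsAs BlockSymmetric (diagConj (chainWeight η)⁻¹ A) A') : ActsAs (QSymmetric η) A A := by
  intro v hv
  refine ⟨?_, rfl⟩
  rw [QSymmetric, vecMul_mul_eq_vecMul_diagConj (chainWeight_ne_zero η)]
  exact (h _ hv).1

theorem actsAs_diagonal {η : ℂ} {f : Config (Ns * ℓ) → ℂ} (hf : BlockSymmetric f) {A : Op (Ns * ℓ)}
    (hA : ∀ v, QSymmetric η v → Matrix.vecMul v A = Matrix.vecMul v (Matrix.diagonal f)) :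
    ActsAs (QSymmetric η) A (Matrix.diagonal f) := by
  intro v hv
  refine ⟨?_, hA v hv⟩
  rw [hA v hv]
  have : Matrix.vecMul v (Matrix.diagonal f) * chainWeight η = f * (v * chainWeight η) := by
    ext s; simp only [Pi.mul_apply, Matrix.vecMul_diagonal]; ring
  rw [QSymmetric, this]
  exact hf.mul hv

theorem ket_eq {η : ℂ} (hη : ∀ n : ℕ, 1 ≤ n → n ≤ ℓ → Complex.sinh (n * η) ≠ 0)
    {n : ℕ} (hn : n ≤ ℓ) (a : Config ℓ) :
    ket η ℓ n a = if ones a = n then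
      Complex.exp (-(η * (n * (ℓ - n)) / 2)) * (stringWeight η a)⁻¹ else 0 := by
  rw [ket_apply hη hn]
  split_ifs with h
  · rw [stringWeight, ← Complex.exp_neg, ← Complex.exp_add, ketExp, h]
    congr 1; ring
  · rfl

theorem QSymmetric.setBlock_mul {η : ℂ} {v : Config (Ns * ℓ) → ℂ} (hv : QSymmetric η v)
    (t : Config (Ns * ℓ)) (b : Fin Ns) (a : Config ℓ) (h : ones a = ones (blockConf t b)) :
    v (setBlock t b a) * stringWeight η a = v t * stringWeight η (blockConf t b) := by
  have h1 := hv (setBlock t b a) t fun c => by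
    rw [blockConf_setBlock]; split_ifs with hc
    · rw [hc, h]
    · rfl
  rw [Pi.mul_apply, Pi.mul_apply] at h1
  have h2 := chainWeight_setBlock η t b a
  have h3 := chainWeight_ne_zero η t
  refine mul_left_cancel₀ h3 ?_
  linear_combination (- v (setBlock t b a)) * h2 + stringWeight η (blockConf t b) * h1

/-- In its dependence on one block such a row is, for each number of ones, a multiple of `ket`.
Contraction with `ket` therefore produces the square length, which cancels the normalisation of
`bra`. The case `x = 0` says that the projection fixes these rows. -/
theorem vecMul_blockOp_phiSpin {η : ℂ}
    (hη : ∀ n : ℕ, 1 ≤ n → n ≤ ℓ → Complex.sinh (n * η) ≠ 0) (b : Fin Ns) (x : ℂ)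
    {v : Config (Ns * ℓ) → ℂ} (hv : QSymmetric η v) :
    Matrix.vecMul v (blockOp b (phiSpin η ℓ x)) =
      Matrix.vecMul v (Matrix.diagonal fun s => Complex.exp (ones (blockConf s b) * x)) := by
  ext t
  rw [vecMul_blockOp_apply, Matrix.vecMul_diagonal]
  set n := ones (blockConf t b) with hn
  have hnl : n ≤ ℓ := ones_le _
  have hphi : ∀ a, phiSpin η ℓ x a (blockConf t b) = Complex.exp (n * x) *
      (ket η ℓ n a * ((sqLength η ℓ n)⁻¹ * ket η ℓ n (blockConf t b))) := by
    intro a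
    rw [phiSpin, Matrix.sum_apply, Finset.sum_eq_single n]
    · rw [Matrix.smul_apply, Matrix.vecMulVec_apply, bra, Pi.smul_apply, smul_eq_mul, smul_eq_mul]
    · intro k hk hkn
      have hk' : k ≤ ℓ := by have := Finset.mem_range.1 hk; omega
      rw [Matrix.smul_apply, Matrix.vecMulVec_apply, bra, Pi.smul_apply,
        ket_apply hη hk' (blockConf t b), if_neg (by omega)]
      simp
    · intro h; exact absurd (Finset.mem_range.2 (by omega)) h
  have hterm : ∀ a, v (setBlock t b a) * phiSpin η ℓ x a (blockConf t b) =
      v t * Complex.exp (n * x) * (sqLength η ℓ n)⁻¹ * (ket η ℓ n a * ket η ℓ n a) := by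
    intro a
    rw [hphi]
    by_cases ha : ones a = n
    · have h := hv.setBlock_mul t b a ha
      rw [ket_eq hη hnl, if_pos ha, ket_eq hη hnl, if_pos hn.symm]
      have h1 := stringWeight_ne_zero η a
      have h2 := stringWeight_ne_zero η (blockConf t b)
      have h3 : v (setBlock t b a) * (stringWeight η (blockConf t b))⁻¹ =
          v t * (stringWeight η a)⁻¹ := by
        field_simp; rw [h, mul_comm]
      linear_combination (Complex.exp (n * x) * Complex.exp (-(η * (n * (ℓ - n)) / 2)) *
        (stringWeight η a)⁻¹ * (sqLength η ℓ n)⁻¹ * Complex.exp (-(η * (n * (ℓ - n)) / 2))) * h3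
    · rw [ket_apply hη hnl a, if_neg ha]; ring
  rw [Finset.sum_congr rfl fun a _ => hterm a, ← Finset.mul_sum]
  have : ∑ a, ket η ℓ n a * ket η ℓ n a = sqLength η ℓ n := rfl
  rw [this, inv_mul_cancel_right₀ (sqLength_ne_zero hη hnl)]

theorem blockSymmetric_exp_ones (b : Fin Ns) (x : ℂ) : BlockSymmetric
    fun s : Config (Ns * ℓ) => Complex.exp (ones (blockConf s b) * x) := by
  intro s t h
  simp only [h b]

theorem actsAs_blockOp_phiSpin {η : ℂ}
    (hη : ∀ n : ℕ, 1 ≤ n → n ≤ ℓ → Complex.sinh (n * η) ≠ 0) (b : Fin Ns) (x : ℂ) :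
    ActsAs (QSymmetric η) (blockOp b (phiSpin η ℓ x))
      (Matrix.diagonal fun s => Complex.exp (ones (blockConf s b) * x)) :=
  actsAs_diagonal (blockSymmetric_exp_ones b x) fun _ hv => vecMul_blockOp_phiSpin hη b x hv

theorem prod_ofFn_diagonal {L n : ℕ} (f : Fin n → Config L → ℂ) :
    (List.ofFn fun k => Matrix.diagonal (f k)).prod = Matrix.diagonal (∏ k, f k) := by
  induction n with
  | zero => simp
  | succ n ih =>
    rw [List.ofFn_succ, List.prod_cons, ih, Fin.prod_univ_succ, Matrix.diagonal_mul_diagonal]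
    rfl

theorem actsAs_projAll {η : ℂ} (hη : ∀ n : ℕ, 1 ≤ n → n ≤ ℓ → Complex.sinh (n * η) ≠ 0) :
    ActsAs (QSymmetric η) (projAll η Ns ℓ) 1 := by
  have hp : proj η ℓ = phiSpin η ℓ 0 := by simp [proj, phiSpin]
  have h := ActsAs.prod_ofFn fun b : Fin Ns => actsAs_blockOp_phiSpin (Ns := Ns) hη b 0
  rw [prod_ofFn_diagonal] at h
  rw [projAll, hp]
  convert h
  rw [← Matrix.diagonal_one]
  congr 1; ext s; simp

/-- The eigenvalues of the gauge transformation. -/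
def gaugeWeight (η : ℂ) (ℓ : ℕ) (ξ : Fin Ns → ℂ) (k : ℤ) (s : Config (Ns * ℓ)) : ℂ :=
  Complex.exp (k * ∑ b, ones (blockConf s b) * center η ℓ ξ b)

variable {η : ℂ} {ξ : Fin Ns → ℂ}

theorem gaugeWeight_ne_zero (k : ℤ) (s : Config (Ns * ℓ)) : gaugeWeight η ℓ ξ k s ≠ 0 :=
  Complex.exp_ne_zero _

theorem blockSymmetric_gaugeWeight (k : ℤ) : BlockSymmetric (gaugeWeight η ℓ ξ k) := by
  intro s t h
  simp only [gaugeWeight, h]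

theorem gaugeWeight_mul (k k' : ℤ) :
    gaugeWeight η ℓ ξ k * gaugeWeight η ℓ ξ k' = gaugeWeight η ℓ ξ (k + k') := by
  ext s
  rw [Pi.mul_apply, gaugeWeight, gaugeWeight, gaugeWeight, ← Complex.exp_add]
  congr 1; push_cast; ring

theorem gaugeWeight_neg (k : ℤ) : gaugeWeight η ℓ ξ (-k) = (gaugeWeight η ℓ ξ k)⁻¹ := by
  ext s
  rw [Pi.inv_apply, gaugeWeight, gaugeWeight, ← Complex.exp_neg]
  congr 1; push_cast; ring

theorem actsAs_gauge (hη : ∀ n : ℕ, 1 ≤ n → n ≤ ℓ → Complex.sinh (n * η) ≠ 0) (k : ℤ) :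
    ActsAs (QSymmetric η) (gauge η ℓ ξ k) (Matrix.diagonal (gaugeWeight η ℓ ξ k)) := by
  have h := ActsAs.prod_ofFn fun b : Fin Ns =>
    actsAs_blockOp_phiSpin (Ns := Ns) hη b (k * center η ℓ ξ b)
  rw [prod_ofFn_diagonal] at h
  rw [gauge]
  convert h
  ext s
  rw [Finset.prod_apply, ← Complex.exp_sum, gaugeWeight, Finset.mul_sum]
  congr 1
  exact Finset.sum_congr rfl fun b _ => by ring

theorem actsAs_gauge_conj (hη : ∀ n : ℕ, 1 ≤ n → n ≤ ℓ → Complex.sinh (n * η) ≠ 0) (k : ℤ)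
    {A A' : Op (Ns * ℓ)} (h : ActsAs (QSymmetric η) A A') :
    ActsAs (QSymmetric η) (gauge η ℓ ξ k * A * gauge η ℓ ξ (-k))
      (diagConj (gaugeWeight η ℓ ξ k) A') := by
  rw [diagConj, ← gaugeWeight_neg]
  exact ((actsAs_gauge hη k).mul h).mul (actsAs_gauge hη (-k))

/-! ### The monodromy matrices of grading `+` and of principal grading -/

/-- The eigenvalues of the gauge transformation of the spin-1/2 chain. -/
def siteWeight {L : ℕ} (ws : Fin L → ℂ) (s : Config L) : ℂ :=
  Complex.exp (∑ j, if s j = 1 then ws j else 0)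

theorem siteWeight_ne_zero {L : ℕ} (ws : Fin L → ℂ) (s : Config L) : siteWeight ws s ≠ 0 :=
  Complex.exp_ne_zero _

/-- The factors `e^{±(x - w)}` of grading `+` split into `e^{±x}`, which depends only on the
auxiliary indices, and `e^{∓w}`, a diagonal conjugation at the site. -/
theorem rAux_plus {L : ℕ} (η x : ℂ) (ws : Fin L → ℂ) (j : Fin L) (a c : Fin 2) :
    rAux η .plus (x - ws j) j a c =
      Complex.exp ((((a : ℕ) : ℂ) - ((c : ℕ) : ℂ)) * x) •
        diagConj (siteWeight ws) (rAux η .principal (x - ws j) j a c) := by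
  ext s t
  rw [Matrix.smul_apply, diagConj_apply]
  simp only [rAux, Matrix.of_apply, siteOp]
  split_ifs with h
  · have hw : siteWeight ws s * (siteWeight ws t)⁻¹ =
        Complex.exp ((if s j = 1 then ws j else 0) - if t j = 1 then ws j else 0) := by
      rw [siteWeight, siteWeight, ← Complex.exp_neg, ← Complex.exp_add, ← sub_eq_add_neg,
        ← Finset.sum_sub_distrib, Finset.sum_eq_single j]
      · intro k _ hk; rw [h k hk, sub_self]
      · intro h; exact absurd (Finset.mem_univ j) h
    rw [smul_eq_mul, mul_right_comm (siteWeight ws s), hw]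
    generalize s j = p
    generalize t j = q
    fin_cases a <;> fin_cases c <;> fin_cases p <;> fin_cases q <;>
      simp [rMatrix, Grading.sigma, ← mul_assoc, ← Complex.exp_add, sub_eq_add_neg, add_comm]
  · simp

theorem siteMonodromy_plus {L : ℕ} (η x : ℂ) (ws : Fin L → ℂ) (l : List (Fin L)) (a c : Fin 2) :
    siteMonodromy η .plus ws x l a c = Complex.exp ((((a : ℕ) : ℂ) - ((c : ℕ) : ℂ)) * x) •
        diagConj (siteWeight ws) (siteMonodromy η .principal ws x l a c) := by
  induction l generalizing a c with
  | nil =>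
    ext s t
    rw [Matrix.smul_apply, diagConj_apply]
    by_cases h : a = c
    · by_cases h' : s = t
      · simp [h, h', siteWeight_ne_zero]
      · simp [h, h']
    · simp [h]
  | cons j l ih =>
    have hsum : ∀ A B : Op L, diagConj (siteWeight ws) (A + B) =
        diagConj (siteWeight ws) A + diagConj (siteWeight ws) B := by
      intro A B; rw [diagConj, mul_add, add_mul]; rfl
    rw [siteMonodromy_cons, siteMonodromy_cons, Matrix.mul_apply, Matrix.mul_apply,
      Fin.sum_univ_two, Fin.sum_univ_two, hsum, diagConj_mul (siteWeight_ne_zero ws),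
      diagConj_mul (siteWeight_ne_zero ws), ih, ih, rAux_plus, rAux_plus, smul_mul_smul_comm,
      smul_mul_smul_comm, smul_add, ← Complex.exp_add, ← Complex.exp_add]
    congr 2 <;> congr 1 <;> ring

/-- The centre `Λ_b` is the mean of the inhomogeneities of a string. The mean gives the gauge
weight, and the deviations from it give the position-dependent weights of `‖ℓ, n⟩`; so the spin-1/2
gauge transformation matches the fused one. -/
theorem siteWeight_completeStrings (s : Config (Ns * ℓ)) :
    siteWeight (completeStrings η ℓ ξ) s = chainWeight η s * gaugeWeight η ℓ ξ 1 s := by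
  rw [siteWeight, chainWeight, gaugeWeight]
  simp only [stringWeight]
  rw [← Complex.exp_sum, ← Complex.exp_add, Int.cast_one, one_mul, ← Finset.sum_add_distrib]
  congr 1
  rw [← finProdFinEquiv.sum_comp, Fintype.sum_prod_type]
  refine Finset.sum_congr rfl fun b _ => ?_
  change ∑ β, (if blockConf s b β = 1 then completeStrings η ℓ ξ (site b β) else 0) = _
  simp only [completeStrings_site]
  generalize blockConf s b = a
  have h : ∀ β : Fin ℓ, (if a β = 1 then ξ b - (β : ℕ) * η else 0) =
      (ξ b + η) * ((if a β = 1 then 1 else 0 : ℕ) : ℂ) -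
        η * ((if a β = 1 then (β : ℕ) + 1 else 0 : ℕ) : ℂ) := by
    intro β; split_ifs
    · push_cast; ring
    · simp
  rw [Finset.sum_congr rfl fun β _ => h β, Finset.sum_sub_distrib, ← Finset.mul_sum,
    ← Finset.mul_sum, ← Nat.cast_sum, ← Nat.cast_sum, center]
  change (ξ b + η) * (ones a : ℂ) - η * (onesSum a : ℂ) = _
  ring

theorem monodromy_plus (x : ℂ) (a c : Fin 2) :
    monodromy η .plus (completeStrings η ℓ ξ) x a c =
      Complex.exp ((((a : ℕ) : ℂ) - ((c : ℕ) : ℂ)) * x) •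
        diagConj (chainWeight η * gaugeWeight η ℓ ξ 1)
          (monodromy η .principal (completeStrings η ℓ ξ) x a c) := by
  have : siteWeight (completeStrings η ℓ ξ) = chainWeight η * gaugeWeight η ℓ ξ 1 :=
    funext siteWeight_completeStrings
  rw [monodromy_eq, monodromy_eq, siteMonodromy_plus, this]

theorem actsAs_monodromy_principal {x : ℂ}
    (hx : ∀ j, Complex.sinh (x - completeStrings η ℓ ξ j + η) ≠ 0) (a c : Fin 2) :
    ActsAs BlockSymmetric (monodromy η .principal (completeStrings η ℓ ξ) x a c)
      (monodromy η .principal (completeStrings η ℓ ξ) x a c) :=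
  fun _ hv => ⟨hv.vecMul_monodromy hx a c, rfl⟩

theorem BlockSymmetric.actsAs_diagConj {f : Config (Ns * ℓ) → ℂ} (hf : BlockSymmetric f)
    {A : Op (Ns * ℓ)} (hA : ActsAs BlockSymmetric A A) :
    ActsAs BlockSymmetric (diagConj f A) (diagConj f A) := by
  have hd : ∀ f : Config (Ns * ℓ) → ℂ, BlockSymmetric f →
      ActsAs BlockSymmetric (Matrix.diagonal f) (Matrix.diagonal f) := by
    intro f hf v hv
    refine ⟨?_, rfl⟩
    have : Matrix.vecMul v (Matrix.diagonal f) = v * f := by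
      ext s; rw [Matrix.vecMul_diagonal]; rfl
    rw [this]
    exact hv.mul hf
  refine ((hd f hf).mul hA).mul (hd _ ?_)
  intro s t h
  rw [Pi.inv_apply, Pi.inv_apply, hf s t h]

theorem actsAs_monodromy_plus {x : ℂ}
    (hx : ∀ j, Complex.sinh (x - completeStrings η ℓ ξ j + η) ≠ 0) (a c : Fin 2) :
    ActsAs (QSymmetric η) (monodromy η .plus (completeStrings η ℓ ξ) x a c)
      (monodromy η .plus (completeStrings η ℓ ξ) x a c) := by
  rw [monodromy_plus]
  refine ActsAs.smul (fun c v => QSymmetric.smul η c v) ?_ _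
  refine actsAs_qSymmetric (A' := diagConj (gaugeWeight η ℓ ξ 1)
    (monodromy η .principal (completeStrings η ℓ ξ) x a c)) ?_
  · have : (chainWeight η)⁻¹ * (chainWeight η * gaugeWeight η ℓ ξ 1) = gaugeWeight η ℓ ξ 1 := by
      ext s
      simp only [Pi.mul_apply, Pi.inv_apply]
      exact inv_mul_cancel_left₀ (chainWeight_ne_zero η s) _
    rw [diagConj_diagConj, this]
    exact (blockSymmetric_gaugeWeight 1).actsAs_diagConj (actsAs_monodromy_principal hx a c)

theorem actsAs_spinMonodromyPlus (hη : ∀ n : ℕ, 1 ≤ n → n ≤ ℓ → Complex.sinh (n * η) ≠ 0) {x : ℂ}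
    (hx : ∀ j, Complex.sinh (x - completeStrings η ℓ ξ j + η) ≠ 0) (a c : Fin 2) :
    ActsAs (QSymmetric η) (spinMonodromyPlus η ℓ ξ x a c)
      (monodromy η .plus (completeStrings η ℓ ξ) x a c) := by
  have h := ((actsAs_projAll hη).mul (actsAs_monodromy_plus hx a c)).mul (actsAs_projAll hη)
  rwa [one_mul, mul_one] at h

theorem actsAs_gaugeInv (hη : ∀ n : ℕ, 1 ≤ n → n ≤ ℓ → Complex.sinh (n * η) ≠ 0)
    {T : ℂ → Matrix (Fin 2) (Fin 2) (Op (Ns * ℓ))} {x : ℂ} {a c : Fin 2} {A : Op (Ns * ℓ)}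
    (h : ActsAs (QSymmetric η) (T x a c) A) :
    ActsAs (QSymmetric η) (gaugeInv η ℓ ξ T x a c)
      (Complex.exp ((((c : ℕ) : ℂ) - ((a : ℕ) : ℂ)) * x) •
        diagConj (gaugeWeight η ℓ ξ (-1)) A) :=
  ActsAs.smul (fun c v => QSymmetric.smul η c v) (actsAs_gauge_conj hη (-1) h) _

/-- On the symmetric rows, the spin-`ℓ/2` monodromy matrix is a gauge transform of the principal
spin-1/2 monodromy matrix. -/
theorem actsAs_spinMonodromy (hη : ∀ n : ℕ, 1 ≤ n → n ≤ ℓ → Complex.sinh (n * η) ≠ 0) {x : ℂ}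
    (hx : ∀ j, Complex.sinh (x - completeStrings η ℓ ξ j + η) ≠ 0) (w : Grading) (a c : Fin 2) :
    ActsAs (QSymmetric η) (spinMonodromy η ℓ ξ w x a c)
      (Complex.exp (w.sigma * ((((a : ℕ) : ℂ) - ((c : ℕ) : ℂ)) * x)) •
        diagConj (gaugeWeight η ℓ ξ w.sigma * chainWeight η)
          (monodromy η .principal (completeStrings η ℓ ξ) x a c)) := by
  have h1 := actsAs_spinMonodromyPlus (ξ := ξ) hη hx a c
  -- Grading `+` carries the gauge weight with exponent `1`, and each inverse gauge transformation
  -- lowers the exponent by one: `1`, `0`, `-1` for `+`, `p`, `-`, which is `σ(w)`. The powers of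
  -- `e^x` change in the same way.
  cases w with
  | plus =>
    rw [monodromy_plus, mul_comm (chainWeight η)] at h1
    simpa [spinMonodromy, Grading.sigma] using h1
  | principal =>
    have h2 := actsAs_gaugeInv (ξ := ξ) hη h1
    rw [monodromy_plus, diagConj_smul, diagConj_diagConj, mul_left_comm, gaugeWeight_mul, smul_smul,
      ← Complex.exp_add, mul_comm (chainWeight η)] at h2
    convert h2 using 3
    · rfl
    · simp only [Grading.sigma]; push_cast; ring
    · rfl
  | minus =>
    have h2 := actsAs_gaugeInv (ξ := ξ) hη (actsAs_gaugeInv (ξ := ξ) hη h1)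
    rw [monodromy_plus, diagConj_smul, diagConj_smul, diagConj_smul, diagConj_diagConj,
      diagConj_diagConj, gaugeWeight_mul, mul_left_comm, gaugeWeight_mul, smul_smul, smul_smul,
      ← Complex.exp_add, ← Complex.exp_add, mul_comm (chainWeight η)] at h2
    convert h2 using 3
    · rfl
    · simp only [Grading.sigma]; push_cast; ring
    · rfl

end Gauge

/-! ### Elementary operators of spin `ℓ/2` on symmetric rows. -/

section Elementary

variable {Ns ℓ : ℕ} {η : ℂ}

/-- The operator leaves the other blocks unchanged, so their weights cancel and only the weights of
block `k` remain. -/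
theorem vecMul_diagConj_blockOp_apply (k : Fin Ns) (A : Op ℓ) (v : Config (Ns * ℓ) → ℂ)
    (t : Config (Ns * ℓ)) :
    Matrix.vecMul v (diagConj (chainWeight η)⁻¹ (blockOp k A)) t =
      ∑ a, v (setBlock t k a) * ((stringWeight η a)⁻¹ * A a (blockConf t k) *
        stringWeight η (blockConf t k)) := by
  have hv : v = v * (chainWeight η)⁻¹ * chainWeight η := by
    ext s
    exact (inv_mul_cancel_right₀ (chainWeight_ne_zero η s) _).symm
  conv_lhs => rw [hv]
  rw [← vecMul_mul_eq_vecMul_diagConj (chainWeight_ne_zero η), Pi.mul_apply, vecMul_blockOp_apply,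
    Finset.sum_mul]
  refine Finset.sum_congr rfl fun a _ => ?_
  rw [Pi.mul_apply, Pi.inv_apply]
  have h1 := chainWeight_setBlock η t k a
  have h2 := chainWeight_ne_zero η (setBlock t k a)
  have h3 := stringWeight_ne_zero η a
  field_simp
  linear_combination (-v (setBlock t k a) * A a (blockConf t k)) * h1

theorem vecMul_blockOp_sum_single_apply (k : Fin Ns) (j : ℕ) (e' : Config ℓ)
    (v : Config (Ns * ℓ) → ℂ) (t : Config (Ns * ℓ)) :
    Matrix.vecMul v (blockOp k (∑ e ∈ seqs ℓ j, Matrix.single e' e 1)) t =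
      if ones (blockConf t k) = j then v (setBlock t k e') else 0 := by
  rw [vecMul_blockOp_apply]
  have h : ∀ a, (∑ e ∈ seqs ℓ j, Matrix.single e' e (1 : ℂ)) a (blockConf t k) =
      if a = e' then (if ones (blockConf t k) = j then 1 else 0) else 0 := by
    intro a
    rw [Matrix.sum_apply]
    by_cases ha : a = e'
    · subst ha
      simp only [Matrix.single_apply, true_and, if_true, Finset.sum_ite_eq', mem_seqs]
    · rw [if_neg ha]
      exact Finset.sum_eq_zero fun e _ => by rw [Matrix.single_apply, if_neg fun h => ha h.1.symm]
  simp only [h, mul_ite, mul_one, mul_zero, Finset.sum_ite_eq', Finset.mem_univ, if_true]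

/-- On the symmetric rows, an elementary operator of a block of spin `ℓ/2` is a sum of products of
elementary operators of the sites. -/
theorem actsAs_elemPrincipal (hη : ∀ n : ℕ, 1 ≤ n → n ≤ ℓ → Complex.sinh (n * η) ≠ 0) (g : ℕ → ℂ)
    (k : Fin Ns) {i j : ℕ} (hi : i ≤ ℓ) (hj : j ≤ ℓ) {e' : Config ℓ} (he' : e' ∈ seqs ℓ i) :
    ActsAs BlockSymmetric (diagConj (chainWeight η)⁻¹ (elemPrincipal η ℓ g k i j))
      (normHat η ℓ g i j • blockOp k (∑ e ∈ seqs ℓ j, Matrix.single e' e 1)) := by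
  intro v hv
  rw [mem_seqs] at he'
  have key : Matrix.vecMul v (diagConj (chainWeight η)⁻¹ (elemPrincipal η ℓ g k i j)) =
      Matrix.vecMul v (normHat η ℓ g i j • blockOp k (∑ e ∈ seqs ℓ j, Matrix.single e' e 1)) := by
    ext t
    rw [Matrix.vecMul_smul, Pi.smul_apply, vecMul_blockOp_sum_single_apply, elemPrincipal,
      vecMul_diagConj_blockOp_apply]
    by_cases ht : ones (blockConf t k) = j
    -- Symmetry replaces `a` by the fixed `e'` in the argument of `v`, and the weights of `bra` and
    -- of the conjugation cancel. The remaining sum over `a` is the square length of `‖ℓ, i⟩`.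
    · have hterm : ∀ a, v (setBlock t k a) * ((stringWeight η a)⁻¹ *
          ((g j / g i) • Matrix.vecMulVec (ket η ℓ i) (bra η ℓ j)) a (blockConf t k) *
            stringWeight η (blockConf t k)) =
          v (setBlock t k e') * (g j / g i) * (sqLength η ℓ j)⁻¹ *
            Complex.exp (η * (i * (ℓ - i)) / 2) * Complex.exp (-(η * (j * (ℓ - j)) / 2)) *
              (ket η ℓ i a * ket η ℓ i a) := by
        intro a
        rw [Matrix.smul_apply, Matrix.vecMulVec_apply, bra, Pi.smul_apply, ket_eq hη hj, if_pos ht,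
          ket_eq hη hi]
        by_cases ha : ones a = i
        · have hva : v (setBlock t k a) = v (setBlock t k e') := by
            refine hv _ _ fun c => ?_
            rw [blockConf_setBlock, blockConf_setBlock]
            split_ifs
            · rw [ha, he']
            · rfl
          rw [if_pos ha, hva, smul_eq_mul, smul_eq_mul]
          have h1 := stringWeight_ne_zero η a
          have h2 := stringWeight_ne_zero η (blockConf t k)
          rw [Complex.exp_neg, Complex.exp_neg]
          have h3 := Complex.exp_ne_zero (η * (i * (ℓ - i)) / 2)
          field_simp
        · rw [if_neg ha]; simp
      rw [Finset.sum_congr rfl fun a _ => hterm a, ← Finset.mul_sum, if_pos ht]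
      have hF : ∑ a, ket η ℓ i a * ket η ℓ i a = sqLength η ℓ i := rfl
      rw [hF, sqLength_eq hη hi, sqLength_eq hη hj, normHat, smul_eq_mul, mul_inv,
        ← Complex.exp_neg]
      -- The square lengths contribute full powers `q^{∓n(ℓ-n)}`, the prefactors in `ket_eq` half
      -- powers of opposite sign; half powers are left, as in `normHat`.
      have hexp : Complex.exp (-(-η * (j * (ℓ - j)))) * Complex.exp (η * (i * (ℓ - i)) / 2) *
          Complex.exp (-(η * (j * (ℓ - j)) / 2)) * Complex.exp (-η * (i * (ℓ - i))) =
          Complex.exp (η * (-((i : ℂ) * ((ℓ : ℂ) - i)) / 2 + (j : ℂ) * ((ℓ : ℂ) - j) / 2)) := by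
        rw [← Complex.exp_add, ← Complex.exp_add, ← Complex.exp_add]; congr 1; ring
      rw [← hexp]
      ring
    · rw [if_neg ht, smul_zero]
      refine Finset.sum_eq_zero fun a _ => ?_
      rw [Matrix.smul_apply, Matrix.vecMulVec_apply, bra, Pi.smul_apply, ket_eq hη hj, if_neg ht]
      simp
  refine ⟨?_, key⟩
  rw [key, Matrix.vecMul_smul]
  refine BlockSymmetric.smul _ _ fun s t h => ?_
  rw [vecMul_blockOp_sum_single_apply, vecMul_blockOp_sum_single_apply, h k]
  have : v (setBlock s k e') = v (setBlock t k e') := by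
    refine hv _ _ fun c => ?_
    rw [blockConf_setBlock, blockConf_setBlock]
    split_ifs
    · rfl
    · exact h c
  rw [this]

/-- The conjugation by `chainWeight` and its inverse cancels. It is kept so that elementary
operators and monodromy matrices carry the same outer conjugation, which then drops out of the
vacuum expectation value. -/
theorem actsAs_elemOp (hη : ∀ n : ℕ, 1 ≤ n → n ≤ ℓ → Complex.sinh (n * η) ≠ 0) (ξ : Fin Ns → ℂ)
    (g : ℕ → ℂ) (w : Grading) (k : Fin Ns) {i j : ℕ} (hi : i ≤ ℓ) (hj : j ≤ ℓ) :
    ActsAs (QSymmetric η) (elemOp η ℓ ξ g w k i j)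
      (diagConj (gaugeWeight η ℓ ξ w.sigma * chainWeight η)
        (diagConj (chainWeight η)⁻¹ (elemPrincipal η ℓ g k i j))) := by
  -- Any member of `S_i` serves: it is needed only to know that the class of rows is preserved.
  have hseq : ∃ e' : Config ℓ, e' ∈ seqs ℓ i := by
    obtain ⟨s, -, hs⟩ := Finset.exists_subset_card_eq
      (s := (Finset.univ : Finset (Fin ℓ))) (n := i) (by simpa using hi)
    refine ⟨fun β => if β ∈ s then 1 else 0, ?_⟩
    rw [mem_seqs, ones_eq_card, ← hs]
    congr 1; ext β; simp
  obtain ⟨e', he'⟩ := hseq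
  have h := actsAs_qSymmetric (actsAs_elemPrincipal hη g k hi hj he')
  have e : diagConj (gaugeWeight η ℓ ξ w.sigma * chainWeight η)
        (diagConj (chainWeight η)⁻¹ (elemPrincipal η ℓ g k i j)) =
      diagConj (gaugeWeight η ℓ ξ w.sigma) (elemPrincipal η ℓ g k i j) := by
    rw [diagConj_diagConj]
    congr 1
    ext s
    exact mul_inv_cancel_right₀ (chainWeight_ne_zero η s) _
  rw [e]
  cases w with
  | plus => exact actsAs_gauge_conj hη 1 h
  | minus => exact actsAs_gauge_conj hη (-1) h
  | principal =>
    have : diagConj (gaugeWeight η ℓ ξ Grading.principal.sigma) (elemPrincipal η ℓ g k i j) =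
        elemPrincipal η ℓ g k i j := by
      ext s t
      simp [diagConj_apply, gaugeWeight, Grading.sigma]
    rw [this]
    exact h

/-! ### Products of elementary operators of the sites -/

theorem prod_siteOp_single_mulVec {L : ℕ} {l : List (Fin L)} (hl : l.Nodup) (p q : Fin L → Fin 2)
    (v : Config L → ℂ) (s : Config L) :
    ((l.map fun j => siteOp j (Matrix.single (p j) (q j) 1)).prod.mulVec v) s =
      if ∀ j ∈ l, s j = p j then v (fun j => if j ∈ l then q j else s j) else 0 := by
  induction l generalizing s with
  | nil => simp
  | cons k l ih =>
    rw [List.nodup_cons] at hl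
    rw [List.map_cons, List.prod_cons, ← Matrix.mulVec_mulVec, siteOp_mulVec_apply]
    simp only [ih hl.2, Matrix.single_apply]
    by_cases hk : p k = s k
    · rw [Finset.sum_eq_single (q k)]
      · have h1 : (∀ j ∈ l, Function.update s k (q k) j = p j) ↔ ∀ j ∈ k :: l, s j = p j := by
          simp only [List.mem_cons, forall_eq_or_imp]
          constructor
          · intro h
            refine ⟨hk.symm, fun j hj => ?_⟩
            rw [← h j hj, Function.update_of_ne (ne_of_mem_of_not_mem hj hl.1)]
          · rintro ⟨-, h⟩ j hj
            rw [Function.update_of_ne (ne_of_mem_of_not_mem hj hl.1), h j hj]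
        have h2 : (fun j => if j ∈ l then q j else Function.update s k (q k) j) =
            fun j => if j ∈ k :: l then q j else s j := by
          ext1 j
          by_cases hj : j ∈ l
          · simp [hj]
          · by_cases hjk : j = k
            · subst hjk; simp
            · simp [hj, hjk]
        rw [h2, if_pos ⟨hk, rfl⟩, one_mul]
        exact if_congr h1 rfl rfl
      · intro b _ hb
        rw [if_neg fun h => hb h.2.symm, zero_mul]
      · intro h; exact absurd (Finset.mem_univ _) h
    · rw [if_neg fun h => hk (h k (by simp)).symm]
      exact Finset.sum_eq_zero fun b _ => by rw [if_neg fun h => hk h.1, zero_mul]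

theorem blockOp_single (k : Fin Ns) (p q : Config ℓ) :
    blockOp k (Matrix.single p q 1) =
      (List.ofFn fun β : Fin ℓ => siteOp (site k β) (Matrix.single (p β) (q β) 1)).prod := by
  have hinj : Function.Injective (site k : Fin ℓ → Fin (Ns * ℓ)) := by
    intro β β' h
    have := finProdFinEquiv.injective h
    exact (Prod.mk.inj this).2
  have hl : (List.ofFn (site k : Fin ℓ → Fin (Ns * ℓ))).Nodup := List.nodup_ofFn.2 hinj
  refine Matrix.mulVec_injective (funext fun v => funext fun s => ?_)
  have h := prod_siteOp_single_mulVec hl (fun j => p (finProdFinEquiv.symm j).2)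
    (fun j => q (finProdFinEquiv.symm j).2) v s
  rw [List.map_ofFn] at h
  simp only [Function.comp_def, symm_site] at h
  rw [h, blockOp_mulVec_apply]
  have h1 : (∀ j ∈ List.ofFn (site k : Fin ℓ → Fin (Ns * ℓ)),
      s j = p (finProdFinEquiv.symm j).2) ↔ p = blockConf s k := by
    simp only [List.forall_mem_ofFn_iff, symm_site]
    exact ⟨fun h => funext fun β => (h β).symm, fun h β => (congrFun h β).symm⟩
  have h2 : (fun j => if j ∈ List.ofFn (site k : Fin ℓ → Fin (Ns * ℓ)) then
      q (finProdFinEquiv.symm j).2 else s j) = setBlock s k q := by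
    ext1 j
    obtain ⟨⟨c, β⟩, rfl⟩ := finProdFinEquiv.surjective j
    change (if site c β ∈ _ then q (finProdFinEquiv.symm (site c β)).2 else s (site c β)) =
      setBlock s k q (site c β)
    rw [setBlock_site, symm_site]
    refine if_congr (List.mem_ofFn.trans ⟨?_, ?_⟩) rfl rfl
    · rintro ⟨β', h⟩
      exact (Prod.mk.inj (finProdFinEquiv.injective h)).1.symm
    · rintro rfl; exact ⟨β, rfl⟩
  rw [h2, Finset.sum_eq_single q]
  · rw [Matrix.single_apply]
    simp only [h1, and_true]
    split_ifs <;> simp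
  · intro a _ ha
    rw [Matrix.single_apply, if_neg fun h => ha h.2.symm, zero_mul]
  · intro h; exact absurd (Finset.mem_univ _) h

theorem prod_ofFn_sum {R κ : Type*} [Semiring R] [DecidableEq κ] {n : ℕ} (S : Fin n → Finset κ)
    (f : Fin n → κ → R) : (List.ofFn fun k => ∑ e ∈ S k, f k e).prod =
      ∑ e ∈ Fintype.piFinset S, (List.ofFn fun k => f k (e k)).prod := by
  induction n with
  | zero => simp
  | succ n ih =>
    rw [List.ofFn_succ, List.prod_cons, ih, Finset.sum_mul_sum, ← Finset.sum_product']
    refine Finset.sum_nbij' (fun x => Fin.cons x.1 x.2) (fun e => (e 0, fun k => e k.succ))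
      ?_ ?_ ?_ ?_ ?_
    · rintro ⟨a, e⟩ h
      rw [Finset.mem_product, Fintype.mem_piFinset] at h
      rw [Fintype.mem_piFinset]
      exact Fin.cases h.1 h.2
    · intro e h
      rw [Fintype.mem_piFinset] at h
      rw [Finset.mem_product, Fintype.mem_piFinset]
      exact ⟨h 0, fun k => h k.succ⟩
    · rintro ⟨a, e⟩ _
      simp
    · intro e _
      exact Fin.cons_self_tail e
    · rintro ⟨a, e⟩ _
      simp [List.ofFn_succ]

theorem blockOp_sum {ι : Type*} (k : Fin Ns) (S : Finset ι) (X : ι → Op ℓ) :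
    blockOp k (∑ e ∈ S, X e) = ∑ e ∈ S, blockOp k (X e) := by
  ext s t
  simp only [blockOp, Matrix.of_apply, Matrix.sum_apply]
  split_ifs <;> simp

theorem prod_ofFn_smul {L n : ℕ} (c : Fin n → ℂ) (A : Fin n → Op L) :
    (List.ofFn fun k => c k • A k).prod = (∏ k, c k) • (List.ofFn A).prod := by
  induction n with
  | zero => simp
  | succ n ih =>
    rw [List.ofFn_succ, List.prod_cons, ih, List.ofFn_succ, List.prod_cons, Fin.prod_univ_succ,
      smul_mul_smul_comm]

variable {N M m : ℕ} {ξ : Fin Ns → ℂ}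

/-- The vacuum expectation values of the spin-`ℓ/2` chain in terms of the spin-1/2 chain with
complete strings. -/
theorem vacExp_spin (hη : ∀ n : ℕ, 1 ≤ n → n ≤ ℓ → Complex.sinh (n * η) ≠ 0) (g : ℕ → ℂ)
    (w : Grading) (μ : Fin N → ℂ) (lam : Fin M → ℂ)
    (hμ : ∀ α j, Complex.sinh (μ α - completeStrings η ℓ ξ j + η) ≠ 0)
    (hlam : ∀ α j, Complex.sinh (lam α - completeStrings η ℓ ξ j + η) ≠ 0)
    (b : Fin m → Fin Ns) (i j : Fin m → ℕ) (hi : ∀ k, i k ≤ ℓ) (hj : ∀ k, j k ≤ ℓ)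
    (e' : Fin m → Config ℓ) (he' : ∀ k, e' k ∈ seqs ℓ (i k)) :
    vacExp (cProd (spinMonodromy η ℓ ξ w) μ *
        (List.ofFn fun k => elemOp η ℓ ξ g w (b k) (i k) (j k)).prod *
        bProd (spinMonodromy η ℓ ξ w) lam) =
      (∏ k, normHat η ℓ g (i k) (j k)) * Complex.exp (w.sigma * (∑ k, μ k - ∑ γ, lam γ)) *
      ∑ e ∈ Fintype.piFinset (fun k => seqs ℓ (j k)),
        vacExp (cProd (monodromy η .principal (completeStrings η ℓ ξ)) μ *
          (List.ofFn fun k => (List.ofFn fun β : Fin ℓ =>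
            siteOp (site (b k) β) (Matrix.single (e' k β) (e k β) 1)).prod).prod *
          bProd (monodromy η .principal (completeStrings η ℓ ξ)) lam) := by
  have hy : ∀ s : Config (Ns * ℓ), (gaugeWeight η ℓ ξ w.sigma * chainWeight η :
      Config (Ns * ℓ) → ℂ) s ≠ 0 := fun s =>
    mul_ne_zero (gaugeWeight_ne_zero _ _) (chainWeight_ne_zero _ _)
  have hC := ActsAs.prod_ofFn fun α => actsAs_spinMonodromy (ξ := ξ) hη (hμ α) w 1 0
  have hB := ActsAs.prod_ofFn fun α => actsAs_spinMonodromy (ξ := ξ) hη (hlam α) w 0 1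
  have hE := ActsAs.prod_ofFn fun k => actsAs_elemOp hη ξ g w (b k) (hi k) (hj k)
  rw [prod_ofFn_smul_diagConj hy] at hC hB
  have hE1 := prod_ofFn_smul_diagConj hy (fun _ : Fin m => (1 : ℂ)) fun k =>
    diagConj (chainWeight η)⁻¹ (elemPrincipal η ℓ g (b k) (i k) (j k))
  simp only [one_smul, Finset.prod_const_one] at hE1
  rw [hE1] at hE
  have h1 := ((hC.mul hE).mul hB).vacExp_eq (qSymmetric_vacuum η)
  rw [smul_mul_assoc, smul_mul_smul_comm, ← diagConj_mul hy, ← diagConj_mul hy] at h1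
  have hC' := ActsAs.prod_ofFn fun α => actsAs_monodromy_principal (hμ α) 1 0
  have hB' := ActsAs.prod_ofFn fun α => actsAs_monodromy_principal (hlam α) 0 1
  have hE' := ActsAs.prod_ofFn fun k => actsAs_elemPrincipal hη g (b k) (hi k) (hj k) (he' k)
  -- Once the common conjugation is removed, the expectation value is evaluated again, now on the
  -- blockwise symmetric rows, where the elementary operators become sums of matrix units.
  have h2 := ((hC'.mul hE').mul hB').vacExp_eq blockSymmetric_vacuum
  have hsmul : ∀ (c : ℂ) (A : Op (Ns * ℓ)), vacExp (c • A) = c * vacExp A := fun _ _ => rfl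
  rw [hsmul, vacExp_diagConj hy, h2, prod_ofFn_smul] at h1
  simp only [blockOp_sum] at h1
  rw [prod_ofFn_sum, mul_smul_comm, smul_mul_assoc, hsmul, Finset.mul_sum, Finset.sum_mul] at h1
  have hsum : ∀ (S : Finset (Fin m → Config ℓ)) (A : (Fin m → Config ℓ) → Op (Ns * ℓ)),
      vacExp (∑ e ∈ S, A e) = ∑ e ∈ S, vacExp (A e) := by
    intro S A; rw [vacExp, Matrix.sum_apply]; rfl
  rw [hsum] at h1
  simp only [blockOp_single] at h1
  have hexp : (∏ k, Complex.exp (w.sigma * ((((1 : Fin 2) : ℕ) - ((0 : Fin 2) : ℕ)) * μ k))) *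
      ∏ k, Complex.exp (w.sigma * ((((0 : Fin 2) : ℕ) - ((1 : Fin 2) : ℕ)) * lam k)) =
      Complex.exp (w.sigma * (∑ k, μ k - ∑ γ, lam γ)) := by
    rw [← Complex.exp_sum, ← Complex.exp_sum, ← Complex.exp_add]
    congr 1
    simp [← Finset.mul_sum]
    ring
  rw [hexp, ← mul_assoc, mul_comm (Complex.exp _)] at h1
  exact h1

end Elementary

/-! ### The limit from almost complete to complete strings. -/

section Limits

variable {Ns ℓ : ℕ} {η : ℂ} {ξ : Fin Ns → ℂ} {r : Fin Ns → Fin ℓ → ℂ}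

theorem strings_eq (ε : ℂ) (j : Fin (Ns * ℓ)) : strings η ξ r ε j = completeStrings η ℓ ξ j +
    ε * r (finProdFinEquiv.symm j).1 (finProdFinEquiv.symm j).2 := by
  simp only [completeStrings, strings, mul_zero, add_zero]

theorem tendsto_strings (E : Set ℂ) (j : Fin (Ns * ℓ)) :
    Tendsto (fun ε => strings η ξ r ε j) (𝓝[E] (0 : ℂ)) (𝓝 (completeStrings η ℓ ξ j)) := by
  simp only [strings_eq]
  have : Continuous fun ε : ℂ => completeStrings η ℓ ξ j +
    ε * r (finProdFinEquiv.symm j).1 (finProdFinEquiv.symm j).2 := by fun_prop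
  have h := this.tendsto 0
  rw [zero_mul, add_zero] at h
  exact h.mono_left nhdsWithin_le_nhds

/-- The argument is `c + ε d`. If `sinh c ≠ 0`, continuity suffices. Otherwise `j ≠ k`, since `c =
η` on the diagonal; then `d ≠ 0` as the shifts `r` are distinct, and `cosh c ≠ 0`, so the zero at `ε
= 0` is simple and hence isolated. -/
theorem eventually_sinh_strings_ne_zero (hη : 1 ≤ ℓ → Complex.sinh η ≠ 0)
    (hr : Function.Injective fun p : Fin Ns × Fin ℓ => r p.1 p.2) {E : Set ℂ} (hE : (0 : ℂ) ∉ E) :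
    ∀ᶠ ε in 𝓝[E] (0 : ℂ), ∀ j k : Fin (Ns * ℓ),
      Complex.sinh (strings η ξ r ε j - strings η ξ r ε k + η) ≠ 0 := by
  rw [eventually_all]; intro j
  rw [eventually_all]; intro k
  have hle : 𝓝[E] (0 : ℂ) ≤ 𝓝[≠] 0 := nhdsWithin_mono _ fun x hx h0 => hE (h0 ▸ hx)
  refine Filter.Eventually.filter_mono hle ?_
  set c := completeStrings η ℓ ξ j - completeStrings η ℓ ξ k + η with hc
  set d := r (finProdFinEquiv.symm j).1 (finProdFinEquiv.symm j).2 -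
    r (finProdFinEquiv.symm k).1 (finProdFinEquiv.symm k).2 with hd
  have he : ∀ ε, strings η ξ r ε j - strings η ξ r ε k + η = c + ε * d := by
    intro ε; rw [strings_eq, strings_eq, hc, hd]; ring
  simp only [he]
  by_cases h0 : Complex.sinh c = 0
  · have hjk : j ≠ k := by
      rintro rfl
      rw [hc, sub_self, zero_add] at h0
      exact hη (finProdFinEquiv.symm j).2.pos h0
    have hd0 : d ≠ 0 := by
      rw [hd, sub_ne_zero]
      exact fun h => hjk (finProdFinEquiv.symm.injective (hr h))
    have hcosh : Complex.cosh c ≠ 0 := by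
      intro h
      have := Complex.cosh_sq c
      rw [h, h0] at this
      norm_num at this
    have hder : HasDerivAt (fun ε : ℂ => Complex.sinh (c + ε * d)) (Complex.cosh c * d) 0 := by
      have h1 : HasDerivAt (fun ε : ℂ => c + ε * d) d 0 := by
        simpa using ((hasDerivAt_id (0 : ℂ)).mul_const d).const_add c
      have h2 := h1.csinh
      rwa [zero_mul, add_zero] at h2
    exact hder.eventually_ne (mul_ne_zero hcosh hd0)
  · have hcont : Continuous fun ε : ℂ => Complex.sinh (c + ε * d) := by fun_prop
    have := hcont.tendsto 0
    rw [zero_mul, add_zero] at this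
    exact (this.eventually_ne h0).filter_mono nhdsWithin_le_nhds

theorem tendsto_rMatrix {F : Filter ℂ} {u : ℂ → ℂ} {u₀ : ℂ} (hu : Tendsto u F (𝓝 u₀))
    (h : Complex.sinh (u₀ + η) ≠ 0) (p q : Fin 2 × Fin 2) :
    Tendsto (fun ε => rMatrix η .principal (u ε) p q) F (𝓝 (rMatrix η .principal u₀ p q)) := by
  have hs : Tendsto (fun ε => Complex.sinh (u ε)) F (𝓝 (Complex.sinh u₀)) :=
    (Complex.continuous_sinh.tendsto u₀).comp hu
  have hs' : Tendsto (fun ε => Complex.sinh (u ε + η)) F (𝓝 (Complex.sinh (u₀ + η))) :=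
    (Complex.continuous_sinh.tendsto (u₀ + η)).comp (hu.add_const η)
  simp only [rMatrix, Matrix.of_apply, Grading.sigma, bFun, cFun, Int.cast_zero, zero_mul, neg_zero]
  split_ifs
  · exact tendsto_const_nhds
  · exact hs.div hs' h
  · exact tendsto_const_nhds.mul (tendsto_const_nhds.div hs' h)
  · exact tendsto_const_nhds.mul (tendsto_const_nhds.div hs' h)
  · exact tendsto_const_nhds

theorem tendsto_monodromy {L : ℕ} {F : Filter ℂ} {ws : ℂ → Fin L → ℂ} {ws₀ : Fin L → ℂ}
    (hws : ∀ j, Tendsto (fun ε => ws ε j) F (𝓝 (ws₀ j))) {x : ℂ → ℂ} {x₀ : ℂ}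
    (hx : Tendsto x F (𝓝 x₀)) (h : ∀ j, Complex.sinh (x₀ - ws₀ j + η) ≠ 0) (a c : Fin 2) :
    Tendsto (fun ε => monodromy η .principal (ws ε) (x ε) a c) F
      (𝓝 (monodromy η .principal ws₀ x₀ a c)) := by
  have hmat : Tendsto (fun ε => monodromy η .principal (ws ε) (x ε)) F
      (𝓝 (monodromy η .principal ws₀ x₀)) := by
    simp only [monodromy, List.ofFn_eq_map, ← List.map_reverse]
    refine tendsto_list_prod _ fun j _ => ?_
    refine tendsto_pi_nhds.2 fun a => tendsto_pi_nhds.2 fun c => tendsto_pi_nhds.2 fun s =>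
      tendsto_pi_nhds.2 fun t => ?_
    simp only [rAux, siteOp, Matrix.of_apply]
    split_ifs
    · exact tendsto_rMatrix (hx.sub (hws j)) (h j) _ _
    · exact tendsto_const_nhds
  exact tendsto_pi_nhds.1 (tendsto_pi_nhds.1 hmat a) c

theorem tendsto_prod_ofFn {L n : ℕ} {F : Filter ℂ} {A : ℂ → Fin n → Op L} {A₀ : Fin n → Op L}
    (h : ∀ k, Tendsto (fun ε => A ε k) F (𝓝 (A₀ k))) :
    Tendsto (fun ε => (List.ofFn (A ε)).prod) F (𝓝 (List.ofFn A₀).prod) := by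
  simp only [List.ofFn_eq_map]
  exact tendsto_list_prod _ fun k _ => h k

theorem tendsto_bFun {F : Filter ℂ} {u : ℂ → ℂ} {u₀ : ℂ} (hu : Tendsto u F (𝓝 u₀))
    (h : Complex.sinh (u₀ + η) ≠ 0) : Tendsto (fun ε => bFun η (u ε)) F (𝓝 (bFun η u₀)) := by
  simpa [rMatrix] using tendsto_rMatrix hu h (0, 1) (0, 1)

/-- Within a string the numerator of `b` at one site is the denominator at the preceding site. Only
the numerator at the first site remains, and it is a numerator of `dSpin`. -/
theorem bFun_completeStrings_ne_zero {x : ℂ} (hd : dSpin η ℓ ξ x ≠ 0)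
    (hx : ∀ j, Complex.sinh (x - completeStrings η ℓ ξ j + η) ≠ 0) (j : Fin (Ns * ℓ)) :
    bFun η (x - completeStrings η ℓ ξ j) ≠ 0 := by
  refine div_ne_zero ?_ (hx j)
  obtain ⟨⟨b, β⟩, rfl⟩ := finProdFinEquiv.surjective j
  change Complex.sinh (x - completeStrings η ℓ ξ (site b β)) ≠ 0
  rw [completeStrings_site]
  rcases Nat.eq_zero_or_pos (β : ℕ) with h | h
  · rw [dSpin, Finset.prod_ne_zero_iff] at hd
    have := (div_ne_zero_iff.1 (hd b (Finset.mem_univ b))).1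
    simpa [h] using this
  · have := hx (site b ⟨β - 1, by omega⟩)
    rw [completeStrings_site] at this
    convert this using 2
    simp only
    rw [Nat.cast_sub h]; push_cast; ring

end Limits

/-- The correlation functions of several blocks: the limits exist and their sum is the expectation
value in the spin-`ℓ/2` chain. -/
theorem exists_tendsto_and_vacExp_eq {ℓ Ns : ℕ} {η : ℂ}
    (hη : ∀ n : ℕ, 1 ≤ n → n ≤ ℓ → Complex.sinh (n * η) ≠ 0)
    (ξ : Fin Ns → ℂ) (r : Fin Ns → Fin ℓ → ℂ)
    (hr : Function.Injective fun p : Fin Ns × Fin ℓ => r p.1 p.2)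
    (g : ℕ → ℂ) (w : Grading) {N M : ℕ} (μ : Fin N → ℂ) (lam : Fin M → ℂ)
    (hμ : ∀ α j, Complex.sinh (μ α - completeStrings η ℓ ξ j + η) ≠ 0)
    (hlam : ∀ α j, Complex.sinh (lam α - completeStrings η ℓ ξ j + η) ≠ 0)
    (hd : ∀ α, dSpin η ℓ ξ (lam α) ≠ 0)
    (E : Set ℂ) (hE₀ : (0 : ℂ) ∉ E) (lamE : ℂ → Fin M → ℂ)
    (hBetheE : ∀ᶠ ε in 𝓝[E] (0 : ℂ), BetheEquations η (dHalf η (strings η ξ r ε)) (lamE ε))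
    (hdist : ∀ᶠ ε in 𝓝[E] (0 : ℂ),
      ∀ α β, α ≠ β → Complex.sinh (lamE ε α - lamE ε β) ≠ 0)
    (hlim : Tendsto lamE (𝓝[E] (0 : ℂ)) (𝓝 lam))
    {m : ℕ} (hm : m ≤ Ns) (i j : Fin m → ℕ) (hi : ∀ k, i k ≤ ℓ) (hj : ∀ k, j k ≤ ℓ)
    (e' : Fin m → Fin ℓ → Fin 2) (he' : ∀ k, e' k ∈ seqs ℓ (i k)) :
    ∃ X : (Fin m → Fin ℓ → Fin 2) → ℂ,
      (∀ e, Tendsto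
        (fun ε : ℂ => vacExp
          (cProd (monodromy η .principal (strings η ξ r ε)) μ *
            (List.ofFn fun k : Fin m => (List.ofFn fun β : Fin ℓ =>
              monodromy η .principal (strings η ξ r ε)
                (strings η ξ r ε (site (Fin.castLE hm k) β)) (e k β) (e' k β)).prod).prod *
            bProd (monodromy η .principal (strings η ξ r ε)) (lamE ε)))
        (𝓝[E] (0 : ℂ)) (𝓝 (X e))) ∧
      vacExp (cProd (spinMonodromy η ℓ ξ w) μ *
          (List.ofFn fun k : Fin m => elemOp η ℓ ξ g w (Fin.castLE hm k) (i k) (j k)).prod *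
          bProd (spinMonodromy η ℓ ξ w) lam) =
        (∏ k, normHat η ℓ g (i k) (j k)) *
          Complex.exp (w.sigma * (∑ k, μ k - ∑ γ, lam γ)) *
          phiFun η (m * ℓ) lam (completeStrings η ℓ ξ) *
          ∑ e ∈ Fintype.piFinset (fun k => seqs ℓ (j k)), X e := by
  have hη1 : 1 ≤ ℓ → Complex.sinh η ≠ 0 := fun h => by simpa using hη 1 le_rfl h
  have hphi : phiFun η (m * ℓ) lam (completeStrings η ℓ ξ) ≠ 0 :=
    Finset.prod_ne_zero_iff.2 fun j _ => Finset.prod_ne_zero_iff.2 fun α _ =>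
      bFun_completeStrings_ne_zero (hd α) (hlam α) j
  have hlim' : ∀ α, Tendsto (fun ε => lamE ε α) (𝓝[E] 0) (𝓝 (lam α)) := tendsto_pi_nhds.1 hlim
  -- The limits are the values at `ε = 0` after the monodromy entries have been replaced by matrix
  -- units and `φ⁻¹`. Individual factors `T(w_j)` may diverge as `ε → 0`; the rewritten expression
  -- does not.
  refine ⟨fun e => (phiFun η (m * ℓ) lam (completeStrings η ℓ ξ))⁻¹ *
    vacExp (cProd (monodromy η .principal (completeStrings η ℓ ξ)) μ *
      (List.ofFn fun k => (List.ofFn fun β : Fin ℓ =>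
        siteOp (site (Fin.castLE hm k) β) (Matrix.single (e' k β) (e k β) 1)).prod).prod *
      bProd (monodromy η .principal (completeStrings η ℓ ξ)) lam), fun e => ?_, ?_⟩
  · have hphiE : Tendsto (fun ε => phiFun η (m * ℓ) (lamE ε) (strings η ξ r ε)) (𝓝[E] 0)
        (𝓝 (phiFun η (m * ℓ) lam (completeStrings η ℓ ξ))) :=
      tendsto_finsetProd _ fun j _ => tendsto_finsetProd _ fun α _ =>
        tendsto_bFun ((hlim' α).sub (tendsto_strings E j)) (hlam α j)
    have hC : Tendsto (fun ε => cProd (monodromy η .principal (strings η ξ r ε)) μ) (𝓝[E] 0)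
        (𝓝 (cProd (monodromy η .principal (completeStrings η ℓ ξ)) μ)) :=
      tendsto_prod_ofFn fun α =>
        tendsto_monodromy (tendsto_strings E) tendsto_const_nhds (hμ α) 1 0
    have hB : Tendsto (fun ε => bProd (monodromy η .principal (strings η ξ r ε)) (lamE ε)) (𝓝[E] 0)
        (𝓝 (bProd (monodromy η .principal (completeStrings η ℓ ξ)) lam)) :=
      tendsto_prod_ofFn fun α => tendsto_monodromy (tendsto_strings E) (hlim' α) (hlam α) 0 1
    have hmul := (hC.mul_const (List.ofFn fun k => (List.ofFn fun β : Fin ℓ =>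
        siteOp (site (Fin.castLE hm k) β) (Matrix.single (e' k β) (e k β) 1)).prod).prod).mul hB
    have hvac := tendsto_pi_nhds.1 (tendsto_pi_nhds.1 hmul fun _ => 0) fun _ => 0
    refine ((hphiE.inv₀ hphi).mul hvac).congr' ?_
    filter_upwards [hBetheE, hdist, eventually_sinh_strings_ne_zero (ξ := ξ) hη1 hr hE₀]
      with ε h1 h2 h3
    exact (vacExp_prod_monodromy hm hη1 h3 μ (lamE ε) h1 h2 e e').symm
  · rw [vacExp_spin hη g w μ lam hμ hlam _ i j hi hj e' he', ← Finset.mul_sum, mul_assoc _ (phiFun _ _ _ _),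
      mul_inv_cancel_left₀ hphi]

end

end XXZ

theorem proposition4p5
    (ℓ Ns : ℕ) (hNs : 0 < Ns) (η : ℂ)
    (hη : ∀ n : ℕ, 1 ≤ n → n ≤ ℓ → Complex.sinh (n * η) ≠ 0)
    (ξ : Fin Ns → ℂ) (r : Fin Ns → Fin ℓ → ℂ)
    (hr : Function.Injective fun p : Fin Ns × Fin ℓ => r p.1 p.2)
    (g : ℕ → ℂ) (hg : ∀ n, n ≤ ℓ → g n ≠ 0) (w : XXZ.Grading)
    (N M : ℕ) (μ : Fin N → ℂ) (lam : Fin M → ℂ)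
    (hμ : ∀ α j, Complex.sinh (μ α - XXZ.completeStrings η ℓ ξ j + η) ≠ 0)
    (hlam : ∀ α j, Complex.sinh (lam α - XXZ.completeStrings η ℓ ξ j + η) ≠ 0)
    (hBethe : XXZ.BetheEquations η (XXZ.dSpin η ℓ ξ) lam)
    (E : Set ℂ) (hE₀ : (0 : ℂ) ∉ E) (hE : (0 : ℂ) ∈ closure E)
    (lamE : ℂ → Fin M → ℂ)
    (hBetheE : ∀ᶠ ε in 𝓝[E] (0 : ℂ),
      XXZ.BetheEquations η (XXZ.dHalf η (XXZ.strings η ξ r ε)) (lamE ε))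
    (hdist : ∀ᶠ ε in 𝓝[E] (0 : ℂ),
      ∀ α β, α ≠ β → Complex.sinh (lamE ε α - lamE ε β) ≠ 0)
    (hlim : Tendsto lamE (𝓝[E] (0 : ℂ)) (𝓝 lam)) :
    (∀ i j : ℕ, 1 ≤ i → i ≤ ℓ → 1 ≤ j → j ≤ ℓ → (i : ℤ) - j = (N : ℤ) - M →
      ∀ e' ∈ XXZ.seqs ℓ i, ∃ X : (Fin ℓ → Fin 2) → ℂ,
        (∀ e ∈ XXZ.seqs ℓ j, Tendsto
          (fun ε : ℂ => XXZ.vacExp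
            (XXZ.cProd (XXZ.monodromy η .principal (XXZ.strings η ξ r ε)) μ *
              (List.ofFn fun β : Fin ℓ =>
                XXZ.monodromy η .principal (XXZ.strings η ξ r ε)
                  (XXZ.strings η ξ r ε (XXZ.site ⟨0, hNs⟩ β)) (e β) (e' β)).prod *
              XXZ.bProd (XXZ.monodromy η .principal (XXZ.strings η ξ r ε)) (lamE ε)))
          (𝓝[E] (0 : ℂ)) (𝓝 (X e))) ∧
        XXZ.vacExp
            (XXZ.cProd (XXZ.spinMonodromy η ℓ ξ w) μ * XXZ.elemOp η ℓ ξ g w ⟨0, hNs⟩ i j *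
              XXZ.bProd (XXZ.spinMonodromy η ℓ ξ w) lam) =
          XXZ.normHat η ℓ g i j *
            Complex.exp (w.sigma * (∑ k, μ k - ∑ γ, lam γ)) *
            XXZ.phiFun η ℓ lam (XXZ.completeStrings η ℓ ξ) *
            ∑ e ∈ XXZ.seqs ℓ j, X e) ∧
    (∀ (m : ℕ) (hm : m ≤ Ns) (i j : Fin m → ℕ),
      (∀ k, 1 ≤ i k ∧ i k ≤ ℓ ∧ 1 ≤ j k ∧ j k ≤ ℓ) →
      (∑ k, (i k : ℤ)) - ∑ k, (j k : ℤ) = (N : ℤ) - M →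
      ∀ e' : Fin m → Fin ℓ → Fin 2, (∀ k, e' k ∈ XXZ.seqs ℓ (i k)) →
      ∃ X : (Fin m → Fin ℓ → Fin 2) → ℂ,
        (∀ e ∈ Fintype.piFinset (fun k => XXZ.seqs ℓ (j k)), Tendsto
          (fun ε : ℂ => XXZ.vacExp
            (XXZ.cProd (XXZ.monodromy η .principal (XXZ.strings η ξ r ε)) μ *
              (List.ofFn fun k : Fin m => (List.ofFn fun β : Fin ℓ =>
                XXZ.monodromy η .principal (XXZ.strings η ξ r ε)
                  (XXZ.strings η ξ r ε (XXZ.site (Fin.castLE hm k) β))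
                  (e k β) (e' k β)).prod).prod *
              XXZ.bProd (XXZ.monodromy η .principal (XXZ.strings η ξ r ε)) (lamE ε)))
          (𝓝[E] (0 : ℂ)) (𝓝 (X e))) ∧
        XXZ.vacExp
            (XXZ.cProd (XXZ.spinMonodromy η ℓ ξ w) μ *
              (List.ofFn fun k : Fin m =>
                XXZ.elemOp η ℓ ξ g w (Fin.castLE hm k) (i k) (j k)).prod *
              XXZ.bProd (XXZ.spinMonodromy η ℓ ξ w) lam) =
          (∏ k, XXZ.normHat η ℓ g (i k) (j k)) *
            Complex.exp (w.sigma * (∑ k, μ k - ∑ γ, lam γ)) *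
            XXZ.phiFun η (m * ℓ) lam (XXZ.completeStrings η ℓ ξ) *
            ∑ e ∈ Fintype.piFinset (fun k => XXZ.seqs ℓ (j k)), X e) := by
  have hd : ∀ α, XXZ.dSpin η ℓ ξ (lam α) ≠ 0 := fun α => (hBethe α).1
  refine ⟨fun i j _ hi _ hj _ e' he' => ?_, fun m hm i j hij _ e' he' =>
    (XXZ.exists_tendsto_and_vacExp_eq hη ξ r hr g w μ lam hμ hlam hd E hE₀ lamE hBetheE hdist hlim
      hm i j (fun k => (hij k).2.1) (fun k => (hij k).2.2.2) e' he').imp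
        fun X hX => ⟨fun e _ => hX.1 e, hX.2⟩⟩
  -- The single-block statement is the case `m = 1`, with families over `Fin 1` identified with
  -- single sequences.
  obtain ⟨X, hX, hsum⟩ := XXZ.exists_tendsto_and_vacExp_eq hη ξ r hr g w μ lam hμ hlam hd E hE₀
    lamE hBetheE hdist hlim (m := 1) hNs (fun _ => i) (fun _ => j) (fun _ => hi) (fun _ => hj)
    (fun _ => e') (fun _ => he')
  have h0 : Fin.castLE hNs (0 : Fin 1) = ⟨0, hNs⟩ := rfl
  refine ⟨fun e => X fun _ => e, fun e _ => ?_, ?_⟩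
  · simpa [List.ofFn_succ, h0] using hX fun _ => e
  · have hpi : ∑ e ∈ Fintype.piFinset (fun _ : Fin 1 => XXZ.seqs ℓ j), X e =
        ∑ e ∈ XXZ.seqs ℓ j, X fun _ => e := by
      refine Finset.sum_nbij' (fun e => e 0) (fun e _ => e) ?_ ?_ ?_ ?_ ?_
      · intro e h; exact Fintype.mem_piFinset.1 h 0
      · intro e h; exact Fintype.mem_piFinset.2 fun _ => h
      · intro e _; ext1 k; rw [Subsingleton.elim k 0]
      · intro e _; rfl
      · intro e _; congr 1; ext1 k; rw [Subsingleton.elim k 0]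
    have hphi : XXZ.phiFun η (1 * ℓ) lam (XXZ.completeStrings η ℓ ξ) =
        XXZ.phiFun η ℓ lam (XXZ.completeStrings η ℓ ξ) := by rw [one_mul]
    rw [hpi, hphi] at hsum
    simpa [List.ofFn_succ, h0] using hsum
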